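/- Let $M$ be a smooth ($C^\infty$, Hausdorff, second countable) $n$-manifold, $\mathfrak g$ a finite-dimensional real Lie algebra, and $p:L\to M$ a smooth Lie algebra bundle with fibre $\mathfrak g$ (a vector bundle with a Lie bracket on each fibre $L_x$, locally smoothly isomorphic to $U\times\mathfrak g$ by maps that are Lie algebra isomorphisms on fibres). Let $\operatorname{Aut}\mathfrak g$ be the group of Lie algebra automorphisms of $\mathfrak g$, $\operatorname{Inn}\mathfrak g$ the subgroup generated by all $\exp(\operatorname{ad}u)$, $u\in\mathfrak g$, and $\operatorname{Aut}^\delta\mathfrak g$ the group $\operatorname{Aut}\mathfrak g$ with the coarsest topology that is finer than the usual one and for which $\operatorname{Aut}\mathfrak g/\operatorname{Inn}\mathfrak g$ is discrete. Consider smooth linear connections $\nabla$ on $L$ with $\nabla_X[u,v]=[\nabla_Xu,v]+[u,\nabla_Xv]$ and with curvature $R^\nabla(X,Y)u=[\Omega(X,Y),u]$ for some differential 2-form $\Omega$ with values in $L$. Call $\nabla,\nabla'$ equivalent if $\nabla'_Xu=\nabla_Xu+[l(X),u]$ for some smooth bundle map $l:TM\to L$; let $\mathrm{Coup}(L)$ be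 the set of equivalence classes. Let $\mathrm{LAB}^\delta(L)$ be the set of classes of families of smooth, fibrewise Lie algebra isomorphic trivializations $\varphi_\alpha:U_\alpha\times\mathfrak g\to p^{-1}(U_\alpha)$ over open coverings $\{U_\alpha\}$ of $M$ whose transition functions $\varphi_\beta^{-1}\varphi_\alpha:U_\alpha\cap U_\beta\to\operatorname{Aut}^\delta\mathfrak g$ are continuous, two families $\{\varphi_\alpha\}$, $\{\varphi'_\beta\}$ being equivalent if all the maps $\varphi_\beta'^{-1}\varphi_\alpha:U_\alpha\cap U'_\beta\to\operatorname{Aut}^\delta\mathfrak g$ are continuous. Fix an atlas of charts $U_\alpha$ diffeomorphic to $\mathbb R^n$, points $x_\alpha\in U_\alpha$, Lie algebra isomorphisms $\psi_\alpha:\mathfrak g\to L_{x_\alpha}$, and, for $x\in U_\alpha$, smooth paths $\gamma_{\alpha,x}:[0,1]\to M$ from $x_\alpha$ to $x$ such that $(t,x)\mapsto\gamma_{\alpha,x}(t)$ is smooth on $[0,1]\times U_\alpha$ (for example the images of straight segments in $\mathbb R^n\cong U_\alpha$). For $\nabla$ as above let $\varphi^\nabla_\alpha(x):\mathfrak g\to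 L_x$, $x\in U_\alpha$, be $\psi_\alpha$ followed by parallel transport with respect to $\nabla$ along $\gamma_{\alpha,x}$. Theorem. For each such $\nabla$, each $\alpha$ and each $x\in U_\alpha$ the map $\varphi^\nabla_\alpha(x)$ is well defined and bijective. For all $\alpha,\beta$ and all $x\in U_{\alpha\beta}=U_\alpha\cap U_\beta$ the map $$\varphi^\nabla_{\alpha\beta}(x)=\varphi^\nabla_\beta(x)^{-1}\circ\varphi^\nabla_\alpha(x):\mathfrak g\to\mathfrak g$$ belongs to $\operatorname{Aut}\mathfrak g$, and the map $\varphi^\nabla_{\alpha\beta}:U_{\alpha\beta}\to\operatorname{Aut}^\delta\mathfrak g$ is continuous. Moreover, the $\varphi^\nabla_\alpha$ are smooth, fibrewise Lie algebra isomorphic trivializations of $L$ over $U_\alpha$, and the correspondence $\nabla\mapsto\{\varphi^\nabla_\alpha\}$ induces a well-defined map $f:\mathrm{Coup}(L)\to\mathrm{LAB}^\delta(L)$, $f([\nabla])=[\{\varphi^\nabla_\alpha\}]$. -/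

import Mathlib

open Bundle Set Filter Topology
open scoped Manifold ContDiff

noncomputable section

/-- A real Lie algebra carrying a norm. No relation between norm and bracket is required: in finite
dimension (the only case used) the norm only serves to fix the usual topology and smooth structure
of the vector space. (A single class is needed so that `NormedSpace ℝ g` and `LieAlgebra ℝ g` share
their vector space structure.) -/
class NormedLieAlgebra (g : Type*) extends NormedAddCommGroup g, NormedSpace ℝ g, LieRing g,
  LieAlgebra ℝ g

section Aut

variable {g : Type*} [NormedLieAlgebra g]

/-- The group `Aut g` of Lie algebra automorphisms, with composition. -/
instance lieAutGroup : Group (g ≃ₗ⁅ℝ⁆ g) where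
  mul a b := b.trans a
  mul_assoc _ _ _ := rfl
  one := 1
  one_mul _ := rfl
  mul_one _ := rfl
  inv a := a.symm
  inv_mul_cancel a := LieEquiv.ext fun x => a.symm_apply_apply x

theorem lieAut_mul_apply (a b : g ≃ₗ⁅ℝ⁆ g) (v : g) : (a * b) v = a (b v) := rfl

theorem lieAut_inv_apply (a : g ≃ₗ⁅ℝ⁆ g) (v : g) : a⁻¹ v = a.symm v := rfl

variable [FiniteDimensional ℝ g]

/-- A Lie algebra automorphism as an element of the normed algebra of continuous endomorphisms. -/
def lieAutToCLM (a : g ≃ₗ⁅ℝ⁆ g) : g →L[ℝ] g :=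
  LinearMap.toContinuousLinearMap (a.toLinearEquiv : g →ₗ[ℝ] g)

/-- `ad u = [u, ·]` as a continuous endomorphism. -/
def adCLM (u : g) : g →L[ℝ] g :=
  LinearMap.toContinuousLinearMap (LieAlgebra.ad ℝ g u : g →ₗ[ℝ] g)

theorem lieAutToCLM_apply (a : g ≃ₗ⁅ℝ⁆ g) (v : g) : lieAutToCLM a v = a v := rfl

theorem adCLM_apply (u v : g) : adCLM u v = ⁅u, v⁆ := rfl

variable (g) in
/-- The group `Inn g` of inner automorphisms: generated by the automorphisms `exp (ad u)`. -/
def innerAut : Subgroup (g ≃ₗ⁅ℝ⁆ g) :=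
  Subgroup.closure {a | ∃ u : g, lieAutToCLM a = NormedSpace.exp (adCLM u)}

variable (g) in
/-- The group `Aut g`, which carries the topology of `Aut^δ g` defined below. -/
abbrev AutDelta : Type _ := g ≃ₗ⁅ℝ⁆ g

/-- The topology of `Aut^δ g`: the coarsest topology which is finer than the usual topology of
`Aut g` (subspace topology from the endomorphisms of `g`) and for which the quotient
`Aut g / Inn g` is discrete, i.e. the cosets of `Inn g` are open. -/
instance autDeltaTopology : TopologicalSpace (AutDelta g) :=
  TopologicalSpace.induced (fun a : AutDelta g => lieAutToCLM a) inferInstance ⊓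
    TopologicalSpace.induced
      (fun a : g ≃ₗ⁅ℝ⁆ g => (QuotientGroup.mk a : (g ≃ₗ⁅ℝ⁆ g) ⧸ innerAut g)) ⊥

theorem exp_adCLM_conj (a : g ≃ₗ⁅ℝ⁆ g) (u : g) :
    lieAutToCLM a * NormedSpace.exp (adCLM u) * lieAutToCLM a⁻¹ =
      NormedSpace.exp (adCLM (a u)) := by
  let y : (g →L[ℝ] g)ˣ :=
    ⟨lieAutToCLM a, lieAutToCLM a⁻¹, by ext v; exact a.apply_symm_apply v,
      by ext v; exact a.symm_apply_apply v⟩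
  let _ : NormedAlgebra ℚ (g →L[ℝ] g) := NormedAlgebra.restrictScalars ℚ ℝ (g →L[ℝ] g)
  have h := NormedSpace.exp_units_conj (𝔸 := g →L[ℝ] g) y (adCLM u)
  have h2 : (y : g →L[ℝ] g) * adCLM u * ((y⁻¹ : (g →L[ℝ] g)ˣ) : g →L[ℝ] g) = adCLM (a u) := by
    ext v
    change a ⁅u, a.symm v⁆ = ⁅a u, v⁆
    rw [LieEquiv.map_lie, LieEquiv.apply_symm_apply]
  rw [h2] at h
  exact h.symm

instance innerAut_normal : (innerAut g).Normal := by
  constructor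
  intro b hb a
  induction hb using Subgroup.closure_induction with
  | mem b hb =>
    obtain ⟨u, hu⟩ := hb
    refine Subgroup.subset_closure ⟨a u, ?_⟩
    rw [← exp_adCLM_conj, ← hu]
    rfl
  | one => simp [one_mem]
  | mul x y _ _ hx hy =>
    have : a * (x * y) * a⁻¹ = (a * x * a⁻¹) * (a * y * a⁻¹) := by group
    rw [this]; exact mul_mem hx hy
  | inv x _ hx =>
    have : a * x⁻¹ * a⁻¹ = (a * x * a⁻¹)⁻¹ := by group
    rw [this]; exact inv_mem hx

theorem autDelta_continuous_iff {X : Type*} [TopologicalSpace X] {f : X → AutDelta g} :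
    Continuous f ↔ Continuous (fun x => lieAutToCLM (f x)) ∧
      Continuous[_, ⊥]
        (fun x => (QuotientGroup.mk (f x) : (g ≃ₗ⁅ℝ⁆ g) ⧸ innerAut g)) := by
  exact continuous_inf_rng.trans (and_congr continuous_induced_rng continuous_induced_rng)

theorem autDelta_continuous_mul {X : Type*} [TopologicalSpace X] {f h : X → AutDelta g}
    (hf : Continuous f) (hh : Continuous h) : Continuous (fun x => f x * h x) := by
  rw [autDelta_continuous_iff] at *
  refine ⟨hf.1.clm_comp hh.1, ?_⟩
  let _ : TopologicalSpace ((g ≃ₗ⁅ℝ⁆ g) ⧸ innerAut g) := ⊥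
  have : DiscreteTopology ((g ≃ₗ⁅ℝ⁆ g) ⧸ innerAut g) := ⟨rfl⟩
  exact hf.2.mul hh.2

theorem autDelta_continuous_inv {X : Type*} [TopologicalSpace X] {f : X → AutDelta g}
    (hf : Continuous f) : Continuous (fun x => (f x)⁻¹) := by
  rw [autDelta_continuous_iff] at *
  constructor
  · have h : ∀ x, lieAutToCLM (f x)⁻¹ =
        Ring.inverse (lieAutToCLM (f x)) := by
      intro x
      let y : (g →L[ℝ] g)ˣ :=
        ⟨lieAutToCLM (f x), lieAutToCLM (f x)⁻¹,
          by ext v; exact LieEquiv.apply_symm_apply (f x) v,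
          by ext v; exact LieEquiv.symm_apply_apply (f x) v⟩
      exact (Ring.inverse_unit y).symm
    have hu : ∀ x, IsUnit (lieAutToCLM (f x)) := fun x =>
      ⟨⟨lieAutToCLM (f x), lieAutToCLM (f x)⁻¹,
          by ext v; exact LieEquiv.apply_symm_apply (f x) v,
          by ext v; exact LieEquiv.symm_apply_apply (f x) v⟩, rfl⟩
    simp_rw [h]
    rw [continuous_iff_continuousAt]
    intro x
    obtain ⟨y, hy⟩ := hu x
    have := NormedRing.inverse_continuousAt y
    rw [hy] at this
    exact ContinuousAt.comp (f := fun x => lieAutToCLM (f x)) this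
      hf.1.continuousAt
  · let _ : TopologicalSpace ((g ≃ₗ⁅ℝ⁆ g) ⧸ innerAut g) := ⊥
    have : DiscreteTopology ((g ≃ₗ⁅ℝ⁆ g) ⧸ innerAut g) := ⟨rfl⟩
    exact hf.2.inv

end Aut

section LAB

variable {n : ℕ} {M : Type*} [TopologicalSpace M] [ChartedSpace (EuclideanSpace ℝ (Fin n)) M]
  {g : Type*} [NormedLieAlgebra g]
  {V : M → Type*} [TopologicalSpace (TotalSpace g V)]
  [∀ x, LieRing (V x)] [∀ x, LieAlgebra ℝ (V x)] [∀ x, TopologicalSpace (V x)]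
  [FiberBundle g V]

variable (n g V) in
/-- A smooth local trivialization `U × g ≅ p⁻¹(U)` of `V` over an open set `U` (the `baseSet`) which
is a Lie algebra isomorphism on each fibre. -/
structure LieTrivialization where
  toTriv : Trivialization g (π g V)
  linear : toTriv.IsLinear ℝ
  smooth : ContMDiffOn ((𝓡 n).prod 𝓘(ℝ, g)) ((𝓡 n).prod 𝓘(ℝ, g)) ∞ toTriv toTriv.source
  smooth_symm : ContMDiffOn ((𝓡 n).prod 𝓘(ℝ, g)) ((𝓡 n).prod 𝓘(ℝ, g)) ∞
    toTriv.toOpenPartialHomeomorph.symm toTriv.target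
  map_lie : ∀ x ∈ toTriv.baseSet, ∀ a b : V x,
    (toTriv ⟨x, ⁅a, b⁆⟩).2 = ⁅(toTriv ⟨x, a⟩).2, (toTriv ⟨x, b⟩).2⁆

variable (n g V) in
/-- `V` is a Lie algebra bundle with fibre `g`: around each point there is a smooth local
trivialization which is a Lie algebra isomorphism on each fibre. -/
def IsLieAlgebraBundle : Prop :=
  ∀ x : M, ∃ e : LieTrivialization n g V, x ∈ e.toTriv.baseSet

namespace LieTrivialization

/-- The inverse `V x → g` of the fibre map of a local trivialization. -/
def fibreInv (e : LieTrivialization n g V) (x : M) (hx : x ∈ e.toTriv.baseSet) :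
    V x ≃ₗ⁅ℝ⁆ g :=
  have := e.linear
  { e.toTriv.linearEquivAt ℝ x hx with
    map_lie' := fun {a b} => e.map_lie x hx a b }

/-- The fibre map `φ(x) : g → V x` of a local trivialization `φ : U × g → p⁻¹(U)`. -/
def fibreMap (e : LieTrivialization n g V) (x : M) (hx : x ∈ e.toTriv.baseSet) :
    g ≃ₗ⁅ℝ⁆ V x :=
  (e.fibreInv x hx).symm

theorem fibreInv_apply (e : LieTrivialization n g V) (x : M) (hx : x ∈ e.toTriv.baseSet)
    (a : V x) : e.fibreInv x hx a = (e.toTriv ⟨x, a⟩).2 := rfl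

/-- The transition function `x ↦ φ'(x)⁻¹ ∘ φ(x)` on `U ∩ U'`. -/
def transition (e e' : LieTrivialization n g V)
    (x : ↥(e.toTriv.baseSet ∩ e'.toTriv.baseSet)) : AutDelta g :=
  (e.fibreMap x x.2.1).trans (e'.fibreMap x x.2.2).symm

variable [FiniteDimensional ℝ g]

/-- The transition function between two trivializations is continuous into `Aut^δ g`. -/
def DeltaCompatible (e e' : LieTrivialization n g V) : Prop :=
  Continuous (transition e e')

theorem DeltaCompatible.symm {e e' : LieTrivialization n g V} (h : DeltaCompatible e e') :
    DeltaCompatible e' e := by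
  have h2 : Continuous (fun x : ↥(e'.toTriv.baseSet ∩ e.toTriv.baseSet) =>
      (transition e e' ⟨x, x.2.2, x.2.1⟩)⁻¹) :=
    autDelta_continuous_inv (h.comp (by fun_prop))
  exact h2

theorem DeltaCompatible.of_cover {e e'' : LieTrivialization n g V}
    (h : ∀ x : ↥(e.toTriv.baseSet ∩ e''.toTriv.baseSet), ∃ e' : LieTrivialization n g V,
      (x : M) ∈ e'.toTriv.baseSet ∧ DeltaCompatible e e' ∧ DeltaCompatible e' e'') :
    DeltaCompatible e e'' := by
  refine continuous_iff_continuousAt.2 fun x => ?_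
  obtain ⟨e', hx, h1, h2⟩ := h x
  let W : Set ↥(e.toTriv.baseSet ∩ e''.toTriv.baseSet) := Subtype.val ⁻¹' e'.toTriv.baseSet
  have hW : IsOpen W := e'.toTriv.open_baseSet.preimage continuous_subtype_val
  have key : Continuous (fun y : W =>
      transition e' e'' ⟨y.1.1, y.2, y.1.2.2⟩ * transition e e' ⟨y.1.1, y.1.2.1, y.2⟩) :=
    autDelta_continuous_mul (h2.comp (by fun_prop)) (h1.comp (by fun_prop))
  have heq : (fun y : W => transition e e'' y.1) = (fun y : W =>
      transition e' e'' ⟨y.1.1, y.2, y.1.2.2⟩ * transition e e' ⟨y.1.1, y.1.2.1, y.2⟩) := by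
    funext y
    refine LieEquiv.ext fun v => ?_
    exact congrArg (e''.fibreMap y.1.1 y.1.2.2).symm
      (LieEquiv.apply_symm_apply (e'.fibreMap y.1.1 y.2) (e.fibreMap y.1.1 y.1.2.1 v)).symm
  rw [← heq] at key
  exact (continuousOn_iff_continuous_domRestrict.2 key).continuousAt (hW.mem_nhds hx)

end LieTrivialization

variable [FiniteDimensional ℝ g]

variable (n g V) in
/-- A locally trivial structure with structural group `Aut^δ g` on `V`: trivializations over an open
covering, whose transition functions are continuous into `Aut^δ g`. -/
structure DeltaStructure where
  trivs : Set (LieTrivialization n g V)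
  covers : ∀ x : M, ∃ e ∈ trivs, x ∈ e.toTriv.baseSet
  compatible : ∀ e ∈ trivs, ∀ e' ∈ trivs, e.DeltaCompatible e'

/-- Two structures are equivalent if all the maps `φ'⁻¹ ∘ φ`, for `φ` in the first and `φ'` in the
second one, are continuous into `Aut^δ g`. (For structures `φ_α`, `φ'_α` over the same covering this
amounts to the continuity of all `φ'_α⁻¹ ∘ φ_α`.) -/
def DeltaStructure.Equivalent (S T : DeltaStructure n g V) : Prop :=
  ∀ e ∈ S.trivs, ∀ e' ∈ T.trivs, e.DeltaCompatible e'

variable (n g V) in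
def deltaSetoid : Setoid (DeltaStructure n g V) where
  r := DeltaStructure.Equivalent
  iseqv :=
    { refl := fun S => S.compatible
      symm := fun h e he e' he' => (h e' he' e he).symm
      trans := fun {_ T _} h h' e he e'' he'' =>
        LieTrivialization.DeltaCompatible.of_cover fun x => by
          obtain ⟨e', he', hx⟩ := T.covers x
          exact ⟨e', hx, h e he e' he', h' e' he' e'' he''⟩ }

variable (n g V) in
/-- `LAB^δ(V)`: classes of locally trivial structures on `V` with structural group `Aut^δ g`. -/
def LABDelta : Type _ := Quotient (deltaSetoid n g V)

end LAB

section Connections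

variable {n : ℕ} {M : Type*} [TopologicalSpace M] [ChartedSpace (EuclideanSpace ℝ (Fin n)) M]
  [IsManifold (𝓡 n) ∞ M]
  {g : Type*} [NormedLieAlgebra g]
  {V : M → Type*} [TopologicalSpace (TotalSpace g V)]
  [∀ x, LieRing (V x)] [∀ x, LieAlgebra ℝ (V x)] [∀ x, TopologicalSpace (V x)]
  [∀ x, IsTopologicalAddGroup (V x)] [∀ x, ContinuousSMul ℝ (V x)]
  [FiberBundle g V] [VectorBundle ℝ g V]

variable (n g) in
/-- `u ∈ Γ^∞(V)`. -/
def IsSmoothSection (u : Π x : M, V x) : Prop :=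
  ContMDiff (𝓡 n) ((𝓡 n).prod 𝓘(ℝ, g)) ∞ (fun x => (⟨x, u x⟩ : TotalSpace g V))

variable (n) in
/-- `X ∈ Γ^∞(TM)`. -/
def IsSmoothVectorField (X : Π x : M, TangentSpace (𝓡 n) x) : Prop :=
  ContMDiff (𝓡 n) (𝓡 n).tangent ∞ (fun x => (⟨x, X x⟩ : TangentBundle (𝓡 n) M))

/-- The curvature `R(X, Y) u = ∇_X ∇_Y u - ∇_Y ∇_X u - ∇_{[X, Y]} u`;
in Mathlib `nabla u x (X x)` is the value of `∇_X u` at `x`. -/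
def curvature (nabla : CovariantDerivative (𝓡 n) g V) (X Y : Π x : M, TangentSpace (𝓡 n) x)
    (u : Π x : M, V x) (x : M) : V x :=
  nabla (fun y => nabla u y (Y y)) x (X x) - nabla (fun y => nabla u y (X y)) x (Y x) -
    nabla u x (VectorField.mlieBracket (𝓡 n) X Y x)

variable (n g V) in
/-- A differential 2-form on `M` with values in `V`. -/
structure TwoForm where
  toFun : Π x : M, TangentSpace (𝓡 n) x →ₗ[ℝ] TangentSpace (𝓡 n) x →ₗ[ℝ] V x
  alternating : ∀ x (a : TangentSpace (𝓡 n) x), toFun x a a = 0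
  smooth : ∀ X Y, IsSmoothVectorField n X → IsSmoothVectorField n Y →
    IsSmoothSection n g (fun x => toFun x (X x) (Y x))

variable (n g V) in
/-- A smooth bundle map `TM → V`, linear on fibres. -/
structure OneForm where
  toFun : Π x : M, TangentSpace (𝓡 n) x →ₗ[ℝ] V x
  smooth : ∀ X, IsSmoothVectorField n X → IsSmoothSection n g (fun x => toFun x (X x))

variable (n g V) in
/-- A smooth linear connection on the Lie algebra bundle `V` which differentiates the fibrewise
bracket, and whose curvature is `R = ad ∘ Ω` for some differential 2-form `Ω` with values in `V`. -/
structure DeltaConnection where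
  nabla : CovariantDerivative (𝓡 n) g V
  smooth : nabla.ContMDiffCovariantDerivative ∞
  leibniz_lie : ∀ u v : Π x : M, V x, IsSmoothSection n g u → IsSmoothSection n g v →
    ∀ (x : M) (a : TangentSpace (𝓡 n) x),
      nabla (fun y => ⁅u y, v y⁆) x a = ⁅nabla u x a, v x⁆ + ⁅u x, nabla v x a⁆
  curvature_inner : ∃ Ω : TwoForm n g V, ∀ X Y, IsSmoothVectorField n X →
    IsSmoothVectorField n Y → ∀ u, IsSmoothSection n g u → ∀ x,
      curvature nabla X Y u x = ⁅Ω.toFun x (X x) (Y x), u x⁆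

/-- `∇'_X u = ∇_X u + [l(X), u]` for some bundle map `l : TM → V`. -/
def DeltaConnection.Equivalent (D D' : DeltaConnection n g V) : Prop :=
  ∃ l : OneForm n g V, ∀ u, IsSmoothSection n g u →
    ∀ (x : M) (a : TangentSpace (𝓡 n) x),
      D'.nabla u x a = D.nabla u x a + ⁅l.toFun x a, u x⁆

variable (n g V) in
def couplingSetoid : Setoid (DeltaConnection n g V) where
  r := DeltaConnection.Equivalent
  iseqv :=
    { refl := fun D => ⟨⟨fun _ => 0, fun _ _ => contMDiff_zeroSection ℝ V⟩, by simp⟩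
      symm := by
        rintro D D' ⟨l, hl⟩
        exact ⟨⟨fun x => -l.toFun x, fun X hX => (l.smooth X hX).neg_section⟩,
          fun u hu x a => by
            simp only [hl u hu, LinearMap.neg_apply, neg_lie, add_neg_cancel_right]⟩
      trans := by
        rintro D D' D'' ⟨l, hl⟩ ⟨l', hl'⟩
        exact ⟨⟨fun x => l.toFun x + l'.toFun x,
          fun X hX => (l.smooth X hX).add_section (l'.smooth X hX)⟩,
          fun u hu x a => by simp [hl u hu, hl' u hu, add_assoc]⟩ }

variable (n g V) in
/-- `Coup(V)`: classes of connections with curvature `ad ∘ Ω`, modulo `ad ∘ l`. -/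
def Coup : Type _ := Quotient (couplingSetoid n g V)

/-- `u` is a parallel section of `V` along `γ : [0,1] → M`. With `e` a local trivialization of `V`
at `γ t`, the covariant derivative of `u` along `γ` at `t` is
`e⁻¹ (d/ds (e u(s)))` at `s = t`, plus `∇_{γ'(t)}` of the local section through `u t` which is
constant with respect to `e`. -/
def IsParallelAlong (nabla : CovariantDerivative (𝓡 n) g V) (γ : ℝ → M)
    (u : ℝ → TotalSpace g V) : Prop :=
  ∀ t ∈ Icc (0 : ℝ) 1, (u t).proj = γ t ∧ ∃ d : g,
    HasDerivWithinAt (fun s => (trivializationAt g V (γ t) (u s)).2) d (Icc 0 1) t ∧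
    (trivializationAt g V (γ t)).symm (γ t) d +
      nabla (fun y => (trivializationAt g V (γ t)).symm y (trivializationAt g V (γ t) (u t)).2)
        (γ t) (mfderivWithin 𝓘(ℝ, ℝ) (𝓡 n) γ (Icc 0 1) t (1 : ℝ)) = 0

/-- `q` is the result of parallel transport of `p` along `γ : [0,1] → M`. -/
def IsParallelTransport (nabla : CovariantDerivative (𝓡 n) g V) (γ : ℝ → M)
    (p q : TotalSpace g V) : Prop :=
  ∃ u : ℝ → TotalSpace g V, IsParallelAlong nabla γ u ∧ u 0 = p ∧ u 1 = q

variable (n g V) in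
/-- The auxiliary choices: an atlas of charts `U_α ≅ ℝⁿ`, a point `x_α ∈ U_α` and an isomorphism
`ψ_α : g → V x_α` for each `α`, and smooth paths `t ↦ γ_{α,x}(t)`, `t ∈ [0,1]`, from `x_α` to
`x ∈ U_α`, depending smoothly on `x`. -/
structure TransportData (ι : Type*) where
  chart : ι → OpenPartialHomeomorph M (EuclideanSpace ℝ (Fin n))
  chart_mem : ∀ α, chart α ∈ IsManifold.maximalAtlas (𝓡 n) ∞ M
  chart_target : ∀ α, (chart α).target = univ
  covers : ∀ x : M, ∃ α, x ∈ (chart α).source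
  center : ι → M
  center_mem : ∀ α, center α ∈ (chart α).source
  frame : ∀ α, g ≃ₗ⁅ℝ⁆ V (center α)
  path : ι → M → ℝ → M
  path_smooth : ∀ α, ContMDiffOn (𝓘(ℝ, ℝ).prod (𝓡 n)) (𝓡 n) ∞
    (fun p : ℝ × M => path α p.2 p.1) (Icc 0 1 ×ˢ (chart α).source)
  path_zero : ∀ α, ∀ x ∈ (chart α).source, path α x 0 = center α
  path_one : ∀ α, ∀ x ∈ (chart α).source, path α x 1 = x

/-- The image under a chart `e : U ≅ ℝⁿ` of the straight segment from `e c` to `e x`. -/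
def radialPath (e : OpenPartialHomeomorph M (EuclideanSpace ℝ (Fin n))) (c x : M) (t : ℝ) : M :=
  e.symm (e c + t • (e x - e c))

variable (n g V) in
/-- The auxiliary choices with the radial paths of the charts as the system of paths. -/
def TransportData.radial {ι : Type*}
    (chart : ι → OpenPartialHomeomorph M (EuclideanSpace ℝ (Fin n)))
    (chart_mem : ∀ α, chart α ∈ IsManifold.maximalAtlas (𝓡 n) ∞ M)
    (chart_target : ∀ α, (chart α).target = univ)
    (covers : ∀ x : M, ∃ α, x ∈ (chart α).source)
    (center : ι → M) (center_mem : ∀ α, center α ∈ (chart α).source)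
    (frame : ∀ α, g ≃ₗ⁅ℝ⁆ V (center α)) : TransportData n g V ι where
  chart := chart
  chart_mem := chart_mem
  chart_target := chart_target
  covers := covers
  center := center
  center_mem := center_mem
  frame := frame
  path := fun α => radialPath (chart α) (center α)
  path_smooth := fun α => by
    have h1 : ContMDiffOn (𝓘(ℝ, ℝ).prod (𝓡 n)) (𝓡 n) ∞
        (fun p : ℝ × M => chart α p.2) (Icc 0 1 ×ˢ (chart α).source) :=
      (contMDiffOn_of_mem_maximalAtlas (chart_mem α)).comp contMDiffOn_snd
        fun p hp => hp.2
    have h2 : ContMDiffOn (𝓘(ℝ, ℝ).prod (𝓡 n)) (𝓡 n) ∞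
        (fun p : ℝ × M => chart α (center α) + p.1 • (chart α p.2 - chart α (center α)))
        (Icc 0 1 ×ˢ (chart α).source) :=
      contMDiffOn_const.add (contMDiffOn_fst.smul (h1.sub contMDiffOn_const))
    exact (contMDiffOn_symm_of_mem_maximalAtlas (chart_mem α)).comp h2
      fun p _ => by simp [chart_target]
  path_zero := fun α x _ => by simp [radialPath, center_mem]
  path_one := fun α x hx => by simp [radialPath, hx]

namespace TransportData

variable {ι : Type*} (T : TransportData n g V ι)

/-- The open set `U_α`. -/
def U (α : ι) : Set M := (T.chart α).source

/-- `w` is obtained from `ψ_α v` by parallel transport along `γ_{α,x}`. -/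
def IsTransported (D : DeltaConnection n g V) (α : ι) (x : M) (v : g) (w : V x) : Prop :=
  IsParallelTransport D.nabla (T.path α x) ⟨T.center α, T.frame α v⟩ ⟨x, w⟩

/-- The map `φ^∇_α(x) : g → V x`: the isomorphism `ψ_α` followed by parallel transport along
`γ_{α,x}`. -/
def phi (D : DeltaConnection n g V) (α : ι) (x : M) (v : g) : V x :=
  Classical.epsilon (T.IsTransported D α x v)

end TransportData

end Connections

end

/-! Call a Lie trivialization adapted to `∇` if the matrix of `∇` in it takes its values in the
inner derivations `ad g`. The theorem follows from two facts: the transported trivializations are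
adapted, and any two trivializations adapted to one connection are compatible over `Aut^δ g`.

Adaptedness. Transport a frame along a smooth family of paths `Γ(t, z)` issuing from one point. In a
local trivialization let `q(t, z)` be its matrix and `B` the pulled-back connection matrix, so that
`∂_t q = -B(∂_t) q`. Then `∂_t (q⁻¹ (∂_h q + B(h) q)) = q⁻¹ F(∂_t, h) q`, where `F` is the
curvature. By hypothesis `F` is inner, and conjugation by an automorphism preserves `ad g`; so
modulo `ad g` the quantity `q⁻¹ (∂_h q + B(h) q)` does not depend on `t`. At `t = 0` it vanishes,
since all paths start at the same point. At `t = 1`, in the trivialization defined by the frame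
itself, `q = 1`, and what remains says that `B(h)` is inner. This is the content of
`parallel_frame_variation`, `InnerFrameAt.of_isGoodBox`, `innerFrameAt_of_parallel` and
`TransportData.exists_adapted`.

Compatibility. A transition function `τ` satisfies `dτ = τ A - A' τ` with `A`, `A'` the two
connection matrices. If `A = ad X` and `A' = ad Y`, then `dτ = ad (τ X - Y) τ`. A curve of
automorphisms with logarithmic derivative in `ad g` stays in one coset of `Inn g`
(`innerAut_of_hasDerivWithinAt`): locally it is a product of exponentials times its initial value,
by uniqueness for linear equations. So the class of `τ` modulo `Inn g` is locally constant, while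
`τ` itself is smooth.

Passing to an equivalent connection adds inner derivations to the matrices, so both connections have
the same adapted trivializations. Hence `f` is well defined.

The analytic input is the theory of linear equations with parameters. Existence and smooth
dependence on a short interval come from inverting `1 - volterra` on a Banach space of continuous
functions; connectedness (`forall_Icc_of_locally`) extends the results to `[0, 1]`. -/

open scoped BoundedContinuousFunction

noncomputable section

set_option linter.unusedSectionVars false

/-! ### Integration on the Banach space of continuous functions on an interval -/

section Primitive

variable {F : Type*} [NormedAddCommGroup F] [NormedSpace ℝ F] {a b : ℝ}

/-- The Banach space of continuous functions on `[a, b]`. -/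
def IccMap (a b : ℝ) (F : Type*) [NormedAddCommGroup F] : Type _ := Icc a b →ᵇ F

namespace IccMap

instance : NormedAddCommGroup (IccMap a b F) := inferInstanceAs (NormedAddCommGroup (Icc a b →ᵇ F))

instance : NormedSpace ℝ (IccMap a b F) := inferInstanceAs (NormedSpace ℝ (Icc a b →ᵇ F))

instance [CompleteSpace F] : CompleteSpace (IccMap a b F) :=
  inferInstanceAs (CompleteSpace (Icc a b →ᵇ F))

instance : FunLike (IccMap a b F) (Icc a b) F := inferInstanceAs (FunLike (Icc a b →ᵇ F) _ _)

/-- A continuous function as an element of the Banach space `IccMap`. -/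
def mk (f : Icc a b → F) (hf : Continuous f) : IccMap a b F :=
  BoundedContinuousFunction.mkOfCompact ⟨f, hf⟩

@[simp]
theorem mk_apply (f : Icc a b → F) (hf : Continuous f) (t : Icc a b) : mk f hf t = f t := rfl

@[ext]
theorem ext {Y Z : IccMap a b F} (h : ∀ t, Y t = Z t) : Y = Z := DFunLike.ext _ _ h

@[simp]
theorem add_apply (Y Z : IccMap a b F) (t : Icc a b) : (Y + Z) t = Y t + Z t := rfl

@[simp]
theorem sub_apply (Y Z : IccMap a b F) (t : Icc a b) : (Y - Z) t = Y t - Z t := rfl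

@[simp]
theorem smul_apply (c : ℝ) (Y : IccMap a b F) (t : Icc a b) : (c • Y) t = c • Y t := rfl

theorem continuous (Y : IccMap a b F) : Continuous Y :=
  BoundedContinuousFunction.continuous (α := Icc a b) Y

theorem norm_coe_le_norm (Y : IccMap a b F) (t : Icc a b) : ‖Y t‖ ≤ ‖Y‖ :=
  BoundedContinuousFunction.norm_coe_le_norm (α := Icc a b) Y t

theorem norm_le {Y : IccMap a b F} {C : ℝ} (hC : 0 ≤ C) : ‖Y‖ ≤ C ↔ ∀ t, ‖Y t‖ ≤ C :=
  BoundedContinuousFunction.norm_le (α := Icc a b) hC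

/-- Evaluation at a point of `[a, b]`. -/
def eval (t : Icc a b) : IccMap a b F →L[ℝ] F :=
  LinearMap.mkContinuous
    { toFun := fun Y => Y t
      map_add' := fun _ _ => rfl
      map_smul' := fun _ _ => rfl } 1 fun Y => by
    rw [one_mul]
    exact norm_coe_le_norm Y t

/-- On the compact interval the sup norm induces the compact-open topology, for which joint
continuity implies continuity of the curried map. -/
theorem continuous_of_uncurry {X : Type*} [TopologicalSpace X] {f : X → IccMap a b F}
    (hf : Continuous fun p : X × Icc a b => f p.1 p.2) : Continuous f := by
  refine (ContinuousMap.isometryEquivBoundedOfCompact (Icc a b) F).symm.isometry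
    |>.isEmbedding.continuous_iff.2 ?_
  exact ContinuousMap.continuous_of_continuous_uncurry _ hf

end IccMap

/-- A continuous function on `[a, b]`, extended to `ℝ` by constants. -/
def iccExtend (t₁ : Icc a b) (Y : IccMap a b F) : ℝ → F :=
  -- The base point serves only to witness `a ≤ b`.
  IccExtend (t₁.2.1.trans t₁.2.2) Y

theorem continuous_iccExtend (t₁ : Icc a b) (Y : IccMap a b F) : Continuous (iccExtend t₁ Y) :=
  Y.continuous.Icc_extend'

theorem iccExtend_apply (t₁ : Icc a b) (Y : IccMap a b F) (t : Icc a b) :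
    iccExtend t₁ Y t = Y t :=
  IccExtend_val _ _ t

/-- The constant functions on `[a, b]`. -/
def iccConst (a b : ℝ) (F : Type*) [NormedAddCommGroup F] [NormedSpace ℝ F] :
    F →L[ℝ] IccMap a b F :=
  LinearMap.mkContinuous
    { toFun := fun c => IccMap.mk (fun _ => c) continuous_const
      map_add' := fun _ _ => rfl
      map_smul' := fun _ _ => rfl } 1 fun c => by
    rw [one_mul]
    exact (IccMap.norm_le (norm_nonneg c)).2 fun _ => le_rfl

/-- The operator `Y ↦ (t ↦ ∫_{t₁}^t Y)` on the continuous functions on `[a, b]`. -/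
def primitive (t₁ : Icc a b) : IccMap a b F →L[ℝ] IccMap a b F :=
  LinearMap.mkContinuous
    { toFun := fun Y => IccMap.mk
        (fun t => ∫ s in (t₁ : ℝ)..t, iccExtend t₁ Y s)
        ((intervalIntegral.continuous_primitive
          (fun _ _ => (continuous_iccExtend t₁ Y).intervalIntegrable _ _) _).comp
          continuous_subtype_val)
      map_add' := fun Y Z => by
        ext t
        exact intervalIntegral.integral_add ((continuous_iccExtend t₁ Y).intervalIntegrable _ _)
          ((continuous_iccExtend t₁ Z).intervalIntegrable _ _)
      map_smul' := fun c Y => by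
        ext t
        exact intervalIntegral.integral_smul c _ }
    (b - a) fun Y => by
      have hab : a ≤ b := t₁.2.1.trans t₁.2.2
      refine (IccMap.norm_le (mul_nonneg (sub_nonneg.2 hab) (norm_nonneg _))).2 fun t => ?_
      refine (intervalIntegral.norm_integral_le_of_norm_le_const (C := ‖Y‖) fun s _ =>
        Y.norm_coe_le_norm _).trans ?_
      rw [mul_comm]
      refine mul_le_mul_of_nonneg_right ?_ (norm_nonneg _)
      rw [abs_le]
      constructor <;> linarith [t.2.1, t.2.2, t₁.2.1, t₁.2.2]

theorem primitive_apply (t₁ : Icc a b) (Y : IccMap a b F) (t : Icc a b) :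
    primitive t₁ Y t = ∫ s in (t₁ : ℝ)..t, iccExtend t₁ Y s := rfl

theorem norm_primitive_le (t₁ : Icc a b) : ‖(primitive t₁ : IccMap a b F →L[ℝ] _)‖ ≤ b - a :=
  LinearMap.mkContinuous_norm_le _ (sub_nonneg.2 (t₁.2.1.trans t₁.2.2)) _

theorem eq_of_hasDerivWithinAt_zero {f : ℝ → F} (hf : ∀ t ∈ Icc a b,
    HasDerivWithinAt f 0 (Icc a b) t) {s t : ℝ} (hs : s ∈ Icc a b) (ht : t ∈ Icc a b) :
    f s = f t := by
  have h : ∀ x ∈ Icc a b, f x = f a := by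
    refine constant_of_derivWithin_zero (fun x hx => (hf x hx).differentiableWithinAt) ?_
    intro x hx
    have hx' := Ico_subset_Icc_self hx
    exact (hf x hx').derivWithin ((uniqueDiffOn_Icc (hx.1.trans_lt hx.2)) x hx')
  rw [h s hs, h t ht]

variable [CompleteSpace F]

/-- With its converse `eq_primitive_of_hasDerivWithinAt`, this exchanges a differential equation for
an integral equation in `IccMap`, where it becomes a linear-algebra problem. Derivatives are
one-sided at the endpoints. -/
theorem hasDerivWithinAt_of_eq_primitive {t₁ : Icc a b} {Y R : IccMap a b F} {c : F}
    (h : Y = iccConst a b _ c + primitive t₁ R) {y : ℝ → F}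
    (hy : ∀ t : Icc a b, y t = Y t) (t : Icc a b) :
    HasDerivWithinAt y (R t) (Icc a b) t := by
  have h1 := ((continuous_iccExtend t₁ R).integral_hasStrictDerivAt t₁ t).hasDerivAt.const_add c
  rw [iccExtend_apply] at h1
  refine h1.hasDerivWithinAt.congr_of_mem (fun s hs => ?_) t.2
  rw [hy ⟨s, hs⟩, h]
  rfl

theorem eq_primitive_of_hasDerivWithinAt {t₁ : Icc a b} {Y R : IccMap a b F} {y : ℝ → F}
    (hy : ∀ t : Icc a b, y t = Y t)
    (h : ∀ t : Icc a b, HasDerivWithinAt y (R t) (Icc a b) t) :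
    Y = iccConst a b _ (y t₁) + primitive t₁ R := by
  have h2 : ∀ t ∈ Icc a b, HasDerivWithinAt
      (fun t => y t - ∫ s in (t₁ : ℝ)..t, iccExtend t₁ R s) 0 (Icc a b) t := by
    intro t ht
    have h1 := ((continuous_iccExtend t₁ R).integral_hasStrictDerivAt t₁ t).hasDerivAt
    have := (h ⟨t, ht⟩).sub h1.hasDerivWithinAt
    rw [← iccExtend_apply t₁ R ⟨t, ht⟩, sub_self] at this
    exact this
  ext t
  have h3 := eq_of_hasDerivWithinAt_zero h2 t.2 t₁.2
  rw [intervalIntegral.integral_same, sub_zero, sub_eq_iff_eq_add] at h3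
  rw [← hy, h3]
  rfl

end Primitive

/-! ### Volterra operators and linear equations on short intervals -/

section Volterra

variable {A : Type*} [NormedRing A] [NormedAlgebra ℝ A] {a b : ℝ}

/-- Pointwise multiplication of continuous functions on `[a, b]`. -/
def iccMul (a b : ℝ) (A : Type*) [NormedRing A] [NormedAlgebra ℝ A] :
    IccMap a b A →L[ℝ] IccMap a b A →L[ℝ] IccMap a b A :=
  LinearMap.mkContinuous₂
    (LinearMap.mk₂ ℝ (fun X Y : IccMap a b A =>
      IccMap.mk (fun t => X t * Y t) (X.continuous.mul Y.continuous))
      (fun _ _ _ => by ext; simp [add_mul]) (fun _ _ _ => by ext; simp)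
      (fun _ _ _ => by ext; simp [mul_add]) (fun _ _ _ => by ext; simp)) 1 fun X Y => by
    rw [one_mul]
    refine (IccMap.norm_le (by positivity)).2 fun t => ?_
    exact (norm_mul_le _ _).trans
      (mul_le_mul (X.norm_coe_le_norm t) (Y.norm_coe_le_norm t) (norm_nonneg _) (norm_nonneg _))

theorem iccMul_apply (X Y : IccMap a b A) (t : Icc a b) : iccMul a b A X Y t = X t * Y t := rfl

/-- The Volterra operator `Y ↦ (t ↦ ∫_{t₁}^t X Y)`. -/
def volterra (t₁ : Icc a b) : IccMap a b A →L[ℝ] IccMap a b A →L[ℝ] IccMap a b A :=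
  (ContinuousLinearMap.compL ℝ _ _ _ (primitive t₁)) ∘L (iccMul a b A)

theorem volterra_apply (t₁ : Icc a b) (X Y : IccMap a b A) :
    volterra t₁ X Y = primitive t₁ (iccMul a b A X Y) := rfl

/-- The crude bound (sup of the coefficient) times (length of the interval) suffices, at the price
of working on short intervals: it makes `1 - volterra t₁ X` invertible by a Neumann series. -/
theorem norm_volterra_lt_one {t₁ : Icc a b} {X : IccMap a b A} {K : ℝ}
    (hX : ∀ t, ‖X t‖ ≤ K) (hK : K * (b - a) < 1) : ‖volterra t₁ X‖ < 1 := by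
  have hab : 0 ≤ b - a := sub_nonneg.2 (t₁.2.1.trans t₁.2.2)
  have hK0 : 0 ≤ K := (norm_nonneg _).trans (hX t₁)
  refine lt_of_le_of_lt ?_ hK
  refine ContinuousLinearMap.opNorm_le_bound _ (mul_nonneg hK0 hab) fun Y => ?_
  rw [volterra_apply]
  calc ‖primitive t₁ (iccMul a b A X Y)‖ ≤ (b - a) * ‖iccMul a b A X Y‖ :=
        (primitive t₁).le_of_opNorm_le (norm_primitive_le t₁) _
    _ ≤ (b - a) * (K * ‖Y‖) := by
        gcongr
        refine (IccMap.norm_le (by positivity)).2 fun t => ?_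
        exact (norm_mul_le _ _).trans
          (mul_le_mul (hX t) (Y.norm_coe_le_norm t) (norm_nonneg _) hK0)
    _ = K * (b - a) * ‖Y‖ := by ring

variable [CompleteSpace A]

/-- Solutions of `y' = X y` are thus recovered from their value at `t₁` by inverting `1 - volterra
t₁ X`. -/
theorem one_sub_volterra_apply_of_hasDerivWithinAt {t₁ : Icc a b} {X Y : IccMap a b A}
    {y : ℝ → A} (hy : ∀ t : Icc a b, y t = Y t)
    (h : ∀ t : Icc a b, HasDerivWithinAt y (X t * y t) (Icc a b) t) :
    (1 - volterra t₁ X) Y = iccConst a b _ (y t₁) := by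
  have := eq_primitive_of_hasDerivWithinAt (t₁ := t₁) (R := iccMul a b A X Y) hy
    (fun t => by rw [iccMul_apply, ← hy]; exact h t)
  rw [sub_apply, volterra_apply, one_apply_eq_self, sub_eq_iff_eq_add]
  exact this

/-- Existence for the linear equation `y' = X y` on a short interval. -/
theorem exists_linearODE_solution {t₁ : Icc a b} {X : IccMap a b A} {K : ℝ}
    (hX : ∀ t, ‖X t‖ ≤ K) (hK : K * (b - a) < 1) (c : A) :
    ∃ y : ℝ → A, y t₁ = c ∧ ∀ t : Icc a b, HasDerivWithinAt y (X t * y t) (Icc a b) t := by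
  obtain ⟨T, hT⟩ := isUnit_one_sub_of_norm_lt_one (norm_volterra_lt_one (t₁ := t₁) hX hK)
  set Y : IccMap a b A := (↑T⁻¹ : IccMap a b A →L[ℝ] IccMap a b A) (iccConst a b _ c)
    with hYdef
  have h1 : (1 - volterra t₁ X) Y = iccConst a b _ c := by
    rw [← hT, hYdef, ← mul_apply_eq_comp, T.mul_inv, one_apply_eq_self]
  rw [sub_apply, volterra_apply, one_apply_eq_self,
    sub_eq_iff_eq_add] at h1
  refine ⟨iccExtend t₁ Y, ?_, fun t => ?_⟩
  · rw [iccExtend_apply, h1, IccMap.add_apply, primitive_apply,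
      intervalIntegral.integral_same, add_zero]
    rfl
  · have := hasDerivWithinAt_of_eq_primitive h1 (iccExtend_apply t₁ Y) t
    rwa [iccExtend_apply]

end Volterra

/-! ### Functions with parameters as maps into a function space -/

section ContinuousFamilies

variable {E F : Type*} [NormedAddCommGroup E] [NormedSpace ℝ E]
  [NormedAddCommGroup F] [NormedSpace ℝ F] {a b : ℝ}

open Classical in
/-- The function `t ↦ f (t, z)` on `[a, b]`, as an element of the space of continuous functions. -/
def iccCurry (a b : ℝ) (f : ℝ × E → F) (z : E) : IccMap a b F :=
  if h : ContinuousOn (fun t => f (t, z)) (Icc a b) then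
    IccMap.mk (fun t => f (t, z)) (continuousOn_iff_continuous_domRestrict.1 h) else 0

theorem iccCurry_apply {f : ℝ × E → F} {W : Set E} (hf : ContinuousOn f (Icc a b ×ˢ W)) {z : E}
    (hz : z ∈ W) (t : Icc a b) : iccCurry a b f z t = f (t, z) := by
  have h : ContinuousOn (fun t => f (t, z)) (Icc a b) :=
    hf.comp (by fun_prop) fun t ht => ⟨ht, hz⟩
  rw [iccCurry, dif_pos h]
  rfl

theorem continuousOn_iccCurry {f : ℝ × E → F} {W : Set E} (hf : ContinuousOn f (Icc a b ×ˢ W)) :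
    ContinuousOn (iccCurry a b f) W := by
  rw [continuousOn_iff_continuous_domRestrict]
  refine IccMap.continuous_of_uncurry ?_
  have : Continuous (fun p : W × Icc a b => f (p.2, p.1)) :=
    hf.comp_continuous (by fun_prop) fun p => ⟨p.2.2, p.1.2⟩
  refine this.congr fun p => ?_
  exact (iccCurry_apply hf p.1.2 p.2).symm

/-- A continuous family of linear maps, applied pointwise to a vector. -/
def iccFlip (a b : ℝ) (E F : Type*) [NormedAddCommGroup E] [NormedSpace ℝ E]
    [NormedAddCommGroup F] [NormedSpace ℝ F] :
    IccMap a b (E →L[ℝ] F) →L[ℝ] E →L[ℝ] IccMap a b F :=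
  LinearMap.mkContinuous₂
    (LinearMap.mk₂ ℝ (fun (G : IccMap a b (E →L[ℝ] F)) (h : E) =>
      IccMap.mk (fun t => G t h) (G.continuous.clm_apply continuous_const))
      (fun _ _ _ => by ext; simp) (fun _ _ _ => by ext; simp) (fun _ _ _ => by ext; simp)
      (fun _ _ _ => by ext; simp)) 1 fun G h => by
    rw [one_mul]
    refine (IccMap.norm_le (by positivity)).2 fun t => ?_
    exact ((G t).le_opNorm h).trans (by gcongr; exact G.norm_coe_le_norm t)

theorem iccFlip_apply (G : IccMap a b (E →L[ℝ] F)) (h : E) (t : Icc a b) :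
    iccFlip a b E F G h t = G t h := rfl

/-- The partial derivative of `f` with respect to the second variable. -/
def sndDeriv (f : ℝ × E → F) (s : Set (ℝ × E)) (p : ℝ × E) : E →L[ℝ] F :=
  (fderivWithin ℝ f s p) ∘L (ContinuousLinearMap.inr ℝ ℝ E)

theorem hasFDerivAt_sndDeriv {f : ℝ × E → F} {W : Set E} (hW : IsOpen W)
    (hf : DifferentiableOn ℝ f (Icc a b ×ˢ W)) {t : ℝ} (ht : t ∈ Icc a b) {z : E} (hz : z ∈ W) :
    HasFDerivAt (fun z => f (t, z)) (sndDeriv f (Icc a b ×ˢ W) (t, z)) z := by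
  have h1 : HasFDerivWithinAt (fun z : E => (t, z)) (ContinuousLinearMap.inr ℝ ℝ E) W z :=
    (hasFDerivAt_prodMk_right t z).hasFDerivWithinAt
  have h2 := HasFDerivWithinAt.comp z (hf (t, z) ⟨ht, hz⟩).hasFDerivWithinAt h1
    fun y hy => ⟨ht, hy⟩
  exact h2.hasFDerivAt (hW.mem_nhds hz)

theorem uniqueDiffOn_Icc_prod {W : Set E} (hab : a < b) (hW : IsOpen W) :
    UniqueDiffOn ℝ (Icc a b ×ˢ W) :=
  (uniqueDiffOn_Icc hab).prod hW.uniqueDiffOn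

theorem contDiffOn_sndDeriv {f : ℝ × E → F} {W : Set E} (hab : a < b) (hW : IsOpen W)
    {m n : WithTop ℕ∞} (hf : ContDiffOn ℝ n f (Icc a b ×ˢ W)) (hmn : m + 1 ≤ n) :
    ContDiffOn ℝ m (sndDeriv f (Icc a b ×ˢ W)) (Icc a b ×ˢ W) :=
  (hf.fderivWithin (uniqueDiffOn_Icc_prod hab hW) hmn).clm_comp contDiffOn_const

/-- The remainder must be small uniformly in `t`. Continuity of the curried partial derivative gives
a ball around `z` on which it varies by less than `ε` in sup norm, and the mean value inequality on
that ball applies for every `t` at once. -/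
theorem hasFDerivAt_iccCurry {f : ℝ × E → F} {W : Set E} (hab : a < b) (hW : IsOpen W)
    (hf : ContDiffOn ℝ 1 f (Icc a b ×ˢ W)) {z : E} (hz : z ∈ W) :
    HasFDerivAt (iccCurry a b f)
      (iccFlip a b E F (iccCurry a b (sndDeriv f (Icc a b ×ˢ W)) z)) z := by
  set f₂ := sndDeriv f (Icc a b ×ˢ W) with hf₂
  have hc₂ : ContinuousOn f₂ (Icc a b ×ˢ W) :=
    (contDiffOn_sndDeriv (m := 0) hab hW hf (by simp)).continuousOn
  have hcont := (continuousOn_iccCurry hc₂).continuousAt (hW.mem_nhds hz)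
  rw [hasFDerivAt_iff_isLittleO, Asymptotics.isLittleO_iff]
  intro ε hε
  have h1 : ∀ᶠ y in 𝓝 z, y ∈ W ∧ dist (iccCurry a b f₂ y) (iccCurry a b f₂ z) < ε :=
    (hW.eventually_mem hz).and (hcont.eventually (Metric.ball_mem_nhds _ hε))
  obtain ⟨δ, hδ, hball⟩ := Metric.eventually_nhds_iff_ball.1 h1
  filter_upwards [Metric.ball_mem_nhds z hδ] with y hy
  refine (IccMap.norm_le (by positivity)).2 fun t => ?_
  simp only [IccMap.sub_apply, iccFlip_apply]
  rw [iccCurry_apply hf.continuousOn (hball y hy).1, iccCurry_apply hf.continuousOn hz]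
  refine Convex.norm_image_sub_le_of_norm_hasFDerivWithin_le' (𝕜 := ℝ) (s := Metric.ball z δ)
    (f := fun z => f (t, z)) (f' := fun z => f₂ (t, z)) (fun x hx => ?_) (fun x hx => ?_)
    (convex_ball z δ) (Metric.mem_ball_self hδ) hy
  · exact (hasFDerivAt_sndDeriv hW (hf.differentiableOn (by simp)) t.2 (hball x hx).1).hasFDerivWithinAt
  · have h2 := (hball x hx).2.le
    rw [dist_eq_norm] at h2
    have h3 := (IccMap.norm_coe_le_norm _ t).trans h2
    rwa [IccMap.sub_apply, iccCurry_apply hc₂ (hball x hx).1] at h3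

end ContinuousFamilies

/-- The derivative of the curried map is, up to the continuous linear map `iccFlip`, the curried
partial derivative, so induction applies with `E →L[ℝ] F` in place of `F`. For this `F` is
quantified inside the induction, and `E : Type` keeps `E →L[ℝ] F` in the universe of `F`. -/
theorem contDiffOn_iccCurry_nat {E : Type} [NormedAddCommGroup E] [NormedSpace ℝ E] {a b : ℝ}
    {W : Set E} (hab : a < b) (hW : IsOpen W) (n : ℕ) : ∀ {F : Type*} [NormedAddCommGroup F]
    [NormedSpace ℝ F] {f : ℝ × E → F}, ContDiffOn ℝ n f (Icc a b ×ˢ W) →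
      ContDiffOn ℝ n (iccCurry a b f) W := by
  induction n with
  | zero =>
    intro F _ _ f hf
    simp only [Nat.cast_zero, contDiffOn_zero] at hf ⊢
    exact continuousOn_iccCurry hf
  | succ n ih =>
    intro F _ _ f hf
    have hf1 : ContDiffOn ℝ 1 f (Icc a b ×ˢ W) := hf.of_le (by simp)
    simp only [Nat.cast_succ] at hf ⊢
    rw [contDiffOn_succ_iff_fderiv_of_isOpen hW]
    refine ⟨fun z hz => (hasFDerivAt_iccCurry hab hW hf1 hz).differentiableAt.differentiableWithinAt,
      by simp, ?_⟩
    have h1 := (iccFlip a b E F).contDiff.comp_contDiffOn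
      (ih (contDiffOn_sndDeriv hab hW hf le_rfl))
    exact h1.congr fun z hz => (hasFDerivAt_iccCurry hab hW hf1 hz).fderiv

theorem contDiffOn_iccCurry {E : Type} [NormedAddCommGroup E] [NormedSpace ℝ E] {a b : ℝ}
    {W : Set E} (hab : a < b) (hW : IsOpen W) {F : Type*} [NormedAddCommGroup F]
    [NormedSpace ℝ F] {f : ℝ × E → F} (hf : ContDiffOn ℝ ∞ f (Icc a b ×ˢ W)) :
    ContDiffOn ℝ ∞ (iccCurry a b f) W :=
  contDiffOn_infty.2 fun n => contDiffOn_iccCurry_nat hab hW n (contDiffOn_infty.1 hf n)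

/-! ### Smooth dependence on parameters and the variation of parallel frames -/

section Dependence

variable {E : Type} [NormedAddCommGroup E] [NormedSpace ℝ E]
  {A : Type*} [NormedRing A] [NormedAlgebra ℝ A] [CompleteSpace A] {a b K : ℝ} {W : Set E}
  {X : ℝ × E → A} {q : ℝ → E → A}

/-- Smooth dependence on parameters of the solutions of the linear equation `q' = X q` on a short
interval, with the variational equation. -/
theorem linearODE_smooth_dependence (hab : a < b) (hW : IsOpen W)
    (hX : ContDiffOn ℝ ∞ X (Icc a b ×ˢ W)) (hXK : ∀ p ∈ Icc a b ×ˢ W, ‖X p‖ ≤ K)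
    (hK : K * (b - a) < 1)
    (hq : ∀ z ∈ W, ∀ t ∈ Icc a b, HasDerivWithinAt (fun t => q t z) (X (t, z) * q t z) (Icc a b) t)
    {t₁ : ℝ} (ht₁ : t₁ ∈ Icc a b) (hq₁ : ContDiffOn ℝ ∞ (q t₁) W) :
    (∀ t ∈ Icc a b, ContDiffOn ℝ ∞ (q t) W) ∧
    ∀ z ∈ W, ∀ h : E, ∀ t ∈ Icc a b, HasDerivWithinAt (fun t => fderiv ℝ (q t) z h)
      (sndDeriv X (Icc a b ×ˢ W) (t, z) h * q t z + X (t, z) * fderiv ℝ (q t) z h) (Icc a b) t := by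
  let τ : Icc a b := ⟨t₁, ht₁⟩
  let f : ℝ × E → A := fun p => q p.1 p.2
  -- Joint continuity of `q` is not known at this point; continuity in `t` for fixed `z` is enough
  -- to evaluate `iccCurry`.
  have hqc : ∀ z ∈ W, ∀ t : Icc a b, iccCurry a b f z t = q t z := by
    intro z hz t
    have h : ContinuousOn (fun t => f (t, z)) (Icc a b) :=
      fun t ht => (hq z hz t ht).continuousWithinAt
    rw [iccCurry, dif_pos h]
    rfl
  have hXc : ∀ z ∈ W, ∀ t : Icc a b, iccCurry a b X z t = X (t, z) :=
    fun z hz t => iccCurry_apply hX.continuousOn hz t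
  have hv : ContDiff ℝ ∞ (fun Y : IccMap a b A => volterra τ Y) :=
    ContinuousLinearMap.contDiff (volterra (A := A) τ)
  have hT : ContDiffOn ℝ ∞ (fun z => 1 - volterra τ (iccCurry a b X z)) W :=
    contDiffOn_const.sub (hv.comp_contDiffOn (contDiffOn_iccCurry hab hW hX))
  have hu : ∀ z ∈ W, IsUnit (1 - volterra τ (iccCurry a b X z)) := fun z hz =>
    isUnit_one_sub_of_norm_lt_one (norm_volterra_lt_one
      (fun t => by rw [hXc z hz]; exact hXK _ ⟨t.2, hz⟩) hK)
  have heq : ∀ z ∈ W, (1 - volterra τ (iccCurry a b X z)) (iccCurry a b f z) =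
      iccConst a b A (q t₁ z) := by
    intro z hz
    refine one_sub_volterra_apply_of_hasDerivWithinAt (t₁ := τ) (y := fun t => q t z)
      (fun t => (hqc z hz t).symm) fun t => ?_
    rw [hXc z hz]
    exact hq z hz t t.2
  have hc : ContDiffOn ℝ ∞ (fun z => iccConst a b A (q t₁ z)) W :=
    (iccConst a b A).contDiff.comp_contDiffOn hq₁
  -- The curried solution is `(1 - volterra τ X_z)⁻¹` applied to the constant `q t₁ z`, and
  -- inversion of bounded operators is smooth.
  have hQ : ContDiffOn ℝ ∞ (iccCurry a b f) W := by
    have hinv : ContDiffOn ℝ ∞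
        (fun z => Ring.inverse (1 - volterra τ (iccCurry a b X z))) W := by
      intro z hz
      obtain ⟨T, hT'⟩ := hu z hz
      have := contDiffAt_ringInverse ℝ (n := ∞) T
      rw [hT'] at this
      exact this.comp_contDiffWithinAt z (hT z hz)
    refine (hinv.clm_apply hc).congr fun z hz => ?_
    rw [← heq z hz, ← mul_apply_eq_comp, Ring.inverse_mul_cancel _ (hu z hz),
      one_apply_eq_self]
  have hev : ∀ t : Icc a b, ∀ z ∈ W,
      q t z = IccMap.eval t (iccCurry a b f z) := fun t z hz => (hqc z hz t).symm
  refine ⟨fun t ht => ?_, fun z hz h t ht => ?_⟩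
  · exact ((IccMap.eval ⟨t, ht⟩).contDiff.comp_contDiffOn hQ).congr (hev ⟨t, ht⟩)
  · have hQd : HasFDerivAt (iccCurry a b f) (fderiv ℝ (iccCurry a b f) z) z :=
      ((hQ.contDiffAt (hW.mem_nhds hz)).differentiableAt (by simp)).hasFDerivAt
    have hXd := hasFDerivAt_iccCurry hab hW (hX.of_le (by simp)) hz
    have hqd : ∀ t : Icc a b, fderiv ℝ (q t) z h = fderiv ℝ (iccCurry a b f) z h t := by
      intro t
      have h1 := ((IccMap.eval t).hasFDerivAt.comp z hQd).congr_of_eventuallyEq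
        ((hW.eventually_mem hz).mono (hev t))
      rw [h1.fderiv]
      rfl
    have hcd : HasFDerivAt (fun z => iccConst a b A (q t₁ z))
        (fderiv ℝ (fun z => iccConst a b A (q t₁ z)) z) z :=
      ((hc.contDiffAt (hW.mem_nhds hz)).differentiableAt (by simp)).hasFDerivAt
    -- Differentiating the integral equation `q = q t₁ + ∫ X q` in the parameter gives the integral
    -- form of the variational equation, with integrand `R` below.
    have hprod := (((volterra τ).hasFDerivAt.comp z hXd).clm_apply hQd)
    have hsum := hcd.add hprod
    have hall : HasFDerivAt (iccCurry a b f) _ z := hsum.congr_of_eventuallyEq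
      ((hW.eventually_mem hz).mono fun y hy => by
        have := heq y hy
        rw [sub_apply, one_apply_eq_self, sub_eq_iff_eq_add] at this
        exact this)
    have hqc₁ : HasFDerivAt (q t₁) (fderiv ℝ (q t₁) z) z :=
      ((hq₁.contDiffAt (hW.mem_nhds hz)).differentiableAt (by simp)).hasFDerivAt
    have hce := hcd.unique ((iccConst a b A).hasFDerivAt.comp z hqc₁)
    have h2 := DFunLike.congr_fun (hQd.unique hall) h
    rw [hce] at h2
    set R : IccMap a b A := iccMul a b A (iccCurry a b X z) (fderiv ℝ (iccCurry a b f) z h) +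
      iccMul a b A (iccFlip a b E A (iccCurry a b (sndDeriv X (Icc a b ×ˢ W)) z) h)
        (iccCurry a b f z) with hR
    have h3 : fderiv ℝ (iccCurry a b f) z h =
        iccConst a b _ (fderiv ℝ (q t₁) z h) + primitive τ R := by
      rw [h2, hR, map_add]
      rfl
    have h4 := hasDerivWithinAt_of_eq_primitive h3
      (y := fun t => fderiv ℝ (q t) z h) hqd ⟨t, ht⟩
    have hs : ContinuousOn (sndDeriv X (Icc a b ×ˢ W)) (Icc a b ×ˢ W) :=
      (contDiffOn_sndDeriv (m := 0) hab hW hX (by simp)).continuousOn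
    rw [hR, IccMap.add_apply, iccMul_apply, iccMul_apply, iccFlip_apply,
      hqc z hz, hXc z hz, iccCurry_apply hs hz, ← hqd, add_comm] at h4
    exact h4

/-- The curvature of a connection form `B` in the directions `(1, 0)` and `(0, h)`. -/
def curvatureForm (B : ℝ × E → (ℝ × E →L[ℝ] A)) (s : Set (ℝ × E)) (p : ℝ × E) (h : E) : A :=
  fderivWithin ℝ B s p (1, 0) (0, h) - fderivWithin ℝ B s p (0, h) (1, 0) +
    (B p (1, 0) * B p (0, h) - B p (0, h) * B p (1, 0))

/-- If the conjugates by `q` of the curvature of `B` are annihilated by `pr`, and `q` is parallel in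
the first variable, then `pr (q⁻¹ (∂_h q + B(h) q))` does not depend on the first variable. -/
theorem parallel_frame_variation {B : ℝ × E → (ℝ × E →L[ℝ] A)} {G : Type*}
    [NormedAddCommGroup G] [NormedSpace ℝ G] (pr : A →L[ℝ] G) (hab : a < b) (hW : IsOpen W)
    (hB : ContDiffOn ℝ ∞ B (Icc a b ×ˢ W)) (hBK : ∀ p ∈ Icc a b ×ˢ W, ‖B p (1, 0)‖ ≤ K)
    (hK : K * (b - a) < 1)
    (hq : ∀ z ∈ W, ∀ t ∈ Icc a b,
      HasDerivWithinAt (fun t => q t z) (-B (t, z) (1, 0) * q t z) (Icc a b) t)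
    (hqu : ∀ z ∈ W, ∀ t ∈ Icc a b, IsUnit (q t z))
    (hF : ∀ z ∈ W, ∀ t ∈ Icc a b, ∀ h : E,
      pr (Ring.inverse (q t z) * (curvatureForm B (Icc a b ×ˢ W) (t, z) h * q t z)) = 0)
    {t₁ : ℝ} (ht₁ : t₁ ∈ Icc a b) (hq₁ : ContDiffOn ℝ ∞ (q t₁) W) {z : E} (hz : z ∈ W) (h : E)
    {t : ℝ} (ht : t ∈ Icc a b) :
    pr (Ring.inverse (q t z) * (fderiv ℝ (q t) z h + B (t, z) (0, h) * q t z)) =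
      pr (Ring.inverse (q t₁ z) * (fderiv ℝ (q t₁) z h + B (t₁, z) (0, h) * q t₁ z)) := by
  have hX : ContDiffOn ℝ ∞ (fun p => -B p (1, 0)) (Icc a b ×ˢ W) :=
    (hB.clm_apply contDiffOn_const).neg
  obtain ⟨-, hvar⟩ := linearODE_smooth_dependence (X := fun p => -B p (1, 0)) hab hW hX
    (fun p hp => by rw [norm_neg]; exact hBK p hp) hK hq ht₁ hq₁
  -- It remains to check that the `t`-derivative before applying `pr` is `q⁻¹ F q`, with `F` the
  -- curvature in the directions `∂_t` and `h`.
  refine eq_of_hasDerivWithinAt_zero (a := a) (b := b)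
    (f := fun t => pr (Ring.inverse (q t z) * (fderiv ℝ (q t) z h + B (t, z) (0, h) * q t z)))
    (fun t ht => ?_) ht ht₁
  have hBd : HasFDerivWithinAt B (fderivWithin ℝ B (Icc a b ×ˢ W) (t, z)) (Icc a b ×ˢ W) (t, z) :=
    (hB.differentiableOn (by simp) (t, z) ⟨ht, hz⟩).hasFDerivWithinAt
  have hud : UniqueDiffWithinAt ℝ (Icc a b ×ˢ W) (t, z) :=
    uniqueDiffOn_Icc_prod hab hW (t, z) ⟨ht, hz⟩
  have hline : HasDerivWithinAt (fun t : ℝ => (t, z)) ((1 : ℝ), (0 : E)) (Icc a b) t :=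
    ((hasDerivAt_id t).prodMk (hasDerivAt_const t z)).hasDerivWithinAt
  have hBt : HasDerivWithinAt (fun t => B (t, z) (0, h))
      (fderivWithin ℝ B (Icc a b ×ˢ W) (t, z) (1, 0) (0, h)) (Icc a b) t := by
    have h1 : HasDerivWithinAt (fun t => B (t, z))
        (fderivWithin ℝ B (Icc a b ×ˢ W) (t, z) (1, 0)) (Icc a b) t :=
      hBd.comp_hasDerivWithinAt t hline (fun s hs => (⟨hs, hz⟩ : (s, z) ∈ Icc a b ×ˢ W))
    simpa using h1.clm_apply (hasDerivWithinAt_const t (Icc a b) ((0 : ℝ), h))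
  have hsnd : sndDeriv (fun p => -B p (1, 0)) (Icc a b ×ˢ W) (t, z) h =
      -fderivWithin ℝ B (Icc a b ×ˢ W) (t, z) (0, h) (1, 0) := by
    have h1 : HasFDerivWithinAt (fun p => -B p (1, 0)) _ (Icc a b ×ˢ W) (t, z) :=
      (hBd.clm_apply (hasFDerivWithinAt_const ((1 : ℝ), (0 : E)) (t, z) _)).neg
    rw [sndDeriv, h1.fderivWithin hud]
    simp
  have hv := hvar z hz h t ht
  rw [hsnd] at hv
  obtain ⟨Q, hQ⟩ := hqu z hz t ht
  -- From `q' = -B(∂_t) q`: `(q⁻¹)' = -q⁻¹ q' q⁻¹ = q⁻¹ B(∂_t)`.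
  have hinv : HasDerivWithinAt (fun t => Ring.inverse (q t z))
      (Ring.inverse (q t z) * B (t, z) (1, 0)) (Icc a b) t := by
    have h1 := hasFDerivAt_ringInverse (𝕜 := ℝ) Q
    rw [hQ] at h1
    refine (h1.comp_hasDerivWithinAt t (hq z hz t ht)).congr_deriv ?_
    rw [← hQ, Ring.inverse_unit]
    change -((↑Q⁻¹ : A) * (-B (t, z) (1, 0) * ↑Q) * ↑Q⁻¹) = ↑Q⁻¹ * B (t, z) (1, 0)
    rw [neg_mul, mul_neg, neg_mul, neg_neg, mul_assoc, mul_assoc, Q.mul_inv, mul_one]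
  have hmain := pr.hasFDerivAt.comp_hasDerivWithinAt t
    (hinv.mul (hv.add (hBt.mul (hq z hz t ht))))
  refine hmain.congr_deriv ?_
  rw [← hF z hz t ht h]
  congr 1
  simp only [curvatureForm, Pi.add_apply, Pi.mul_apply]
  noncomm_ring

end Dependence

/-- Uniqueness for the linear equation `y' = X y` on an interval. -/
theorem linearODE_unique {F : Type*} [NormedAddCommGroup F] [NormedSpace ℝ F] {a b K : ℝ}
    {X : ℝ → F → F} (hX : ∀ t ∈ Icc a b, ∀ v w, ‖X t v - X t w‖ ≤ K * ‖v - w‖) {y z : ℝ → F}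
    (hy : ∀ t ∈ Icc a b, HasDerivWithinAt y (X t (y t)) (Icc a b) t)
    (hz : ∀ t ∈ Icc a b, HasDerivWithinAt z (X t (z t)) (Icc a b) t)
    {t₁ : ℝ} (ht₁ : t₁ ∈ Icc a b) (h₁ : y t₁ = z t₁) : EqOn y z (Icc a b) := by
  have hL : ∀ t ∈ Icc a b, LipschitzOnWith K.toNNReal (X t) univ := fun t ht =>
    (LipschitzWith.of_dist_le' fun v w => by
      rw [dist_eq_norm, dist_eq_norm]; exact hX t ht v w).lipschitzOnWith
  have hl : Icc a t₁ ⊆ Icc a b := Icc_subset_Icc_right ht₁.2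
  have hr : Icc t₁ b ⊆ Icc a b := Icc_subset_Icc_left ht₁.1
  have hli : ∀ t ∈ Ioc a t₁, Icc a b ∈ 𝓝[Iic t] t := fun t ht =>
    mem_of_superset (Icc_mem_nhdsLE ht.1) (Icc_subset_Icc_right (ht.2.trans ht₁.2))
  have hri : ∀ t ∈ Ico t₁ b, Icc a b ∈ 𝓝[Ici t] t := fun t ht =>
    mem_of_superset (Icc_mem_nhdsGE ht.2) (Icc_subset_Icc_left (ht₁.1.trans ht.1))
  -- The initial point may lie inside the interval, so uniqueness is used backwards on `[a, t₁]` and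
  -- forwards on `[t₁, b]`.
  rw [← Icc_union_Icc_eq_Icc ht₁.1 ht₁.2]
  refine EqOn.union ?_ ?_
  · refine ODE_solution_unique_of_mem_Icc_left (v := X) (s := fun _ => univ)
      (fun t ht => hL t (hl (Ioc_subset_Icc_self ht)))
      (fun t ht => ((hy t (hl ht)).continuousWithinAt).mono hl)
      (fun t ht => ?_) (fun _ _ => mem_univ _)
      (fun t ht => ((hz t (hl ht)).continuousWithinAt).mono hl)
      (fun t ht => ?_) (fun _ _ => mem_univ _) h₁
    · exact (hy t (hl (Ioc_subset_Icc_self ht))).mono_of_mem_nhdsWithin (hli t ht)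
    · exact (hz t (hl (Ioc_subset_Icc_self ht))).mono_of_mem_nhdsWithin (hli t ht)
  · refine ODE_solution_unique_of_mem_Icc_right (v := X) (s := fun _ => univ)
      (fun t ht => hL t (hr (Ico_subset_Icc_self ht)))
      (fun t ht => ((hy t (hr ht)).continuousWithinAt).mono hr)
      (fun t ht => ?_) (fun _ _ => mem_univ _)
      (fun t ht => ((hz t (hr ht)).continuousWithinAt).mono hr)
      (fun t ht => ?_) (fun _ _ => mem_univ _) h₁
    · exact (hy t (hr (Ico_subset_Icc_self ht))).mono_of_mem_nhdsWithin (hri t ht)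
    · exact (hz t (hr (Ico_subset_Icc_self ht))).mono_of_mem_nhdsWithin (hri t ht)

/-! ### Inner automorphisms and curves with inner logarithmic derivative -/

section InnerAutomorphisms

variable {g : Type*} [NormedLieAlgebra g] [FiniteDimensional ℝ g]

variable (g) in
/-- The adjoint representation as a continuous linear map. -/
def adL : g →L[ℝ] g →L[ℝ] g :=
  LinearMap.toContinuousLinearMap
    { toFun := adCLM
      map_add' := fun u v => by ext w; simp [adCLM_apply]
      map_smul' := fun c u => by ext w; simp [adCLM_apply] }

theorem adL_apply (u : g) : adL g u = adCLM u := rfl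

theorem hasDerivWithinAt_lie {x y : ℝ → g} {x' y' : g} {s : Set ℝ} {r : ℝ}
    (hx : HasDerivWithinAt x x' s r) (hy : HasDerivWithinAt y y' s r) :
    HasDerivWithinAt (fun r => ⁅x r, y r⁆) (⁅x', y r⁆ + ⁅x r, y'⁆) s r :=
  ((adL g).hasFDerivAt.comp_hasDerivWithinAt r hx).clm_apply hy

/-- Replace `u` by `r u`: by the Jacobi identity both sides solve `y' = [u, y]` in `r`, and they
agree at `r = 0`. -/
theorem exp_adCLM_lie (u x y : g) :
    NormedSpace.exp (adCLM u) ⁅x, y⁆ =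
      ⁅NormedSpace.exp (adCLM u) x, NormedSpace.exp (adCLM u) y⁆ := by
  set e : ℝ → g →L[ℝ] g := fun r => NormedSpace.exp (r • adCLM u) with he
  have hd : ∀ r, HasDerivAt e (adCLM u * e r) r := fun r =>
    hasDerivAt_exp_smul_const' (𝕂 := ℝ) (adCLM u) r
  have happ : ∀ (v : g) (r : ℝ), HasDerivAt (fun r => e r v) ⁅u, e r v⁆ r := fun v r => by
    simpa using! (hd r).clm_apply (hasDerivAt_const r v)
  have h0 : e 0 = 1 := by simp [he]
  have h1 : e 1 = NormedSpace.exp (adCLM u) := by simp [he]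
  have := linearODE_unique (a := 0) (b := 1) (K := ‖adCLM u‖) (X := fun _ v => ⁅u, v⁆)
    (y := fun r => e r ⁅x, y⁆) (z := fun r => ⁅e r x, e r y⁆)
    (fun _ _ v w => by rw [← lie_sub]; exact (adCLM u).le_opNorm _)
    (fun r _ => (happ _ r).hasDerivWithinAt)
    (fun r _ => by
      rw [leibniz_lie u (e r x) (e r y)]
      exact hasDerivWithinAt_lie (happ x r).hasDerivWithinAt (happ y r).hasDerivWithinAt)
    (left_mem_Icc.2 zero_le_one) (by simp [h0]) (right_mem_Icc.2 zero_le_one)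
  simpa [h1] using this

/-- `innerAut` is generated by those automorphisms whose underlying map is an exponential; this
shows that every `u` contributes such a generator, with inverse `exp (-ad u)`. -/
theorem exists_innerAut_eq_exp (u : g) :
    ∃ a ∈ innerAut g, lieAutToCLM a = NormedSpace.exp (adCLM u) := by
  let _ : NormedAlgebra ℚ (g →L[ℝ] g) := NormedAlgebra.restrictScalars ℚ ℝ (g →L[ℝ] g)
  have h1 : NormedSpace.exp (adCLM u) * NormedSpace.exp (-adCLM u) = 1 := by
    rw [← NormedSpace.exp_add_of_commute (Commute.neg_right (Commute.refl _)), add_neg_cancel,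
      NormedSpace.exp_zero]
  have h2 : NormedSpace.exp (-adCLM u) * NormedSpace.exp (adCLM u) = 1 := by
    rw [← NormedSpace.exp_add_of_commute (Commute.neg_left (Commute.refl (adCLM u))), neg_add_cancel,
      NormedSpace.exp_zero]
  let a : g ≃ₗ⁅ℝ⁆ g :=
    { toFun := fun v => (NormedSpace.exp (adCLM u) : g →L[ℝ] g) v
      map_add' := fun v w => map_add _ v w
      map_smul' := fun c v => map_smul _ c v
      invFun := fun v => (NormedSpace.exp (-adCLM u) : g →L[ℝ] g) v
      left_inv := fun v => DFunLike.congr_fun h2 v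
      right_inv := fun v => DFunLike.congr_fun h1 v
      map_lie' := fun {x y} => exp_adCLM_lie u x y }
  have ha : lieAutToCLM a = NormedSpace.exp (adCLM u) := by ext v; rfl
  exact ⟨a, Subgroup.subset_closure ⟨u, ha⟩, ha⟩

theorem lieAutToCLM_mul (a b : g ≃ₗ⁅ℝ⁆ g) :
    lieAutToCLM (a * b) = lieAutToCLM a * lieAutToCLM b := rfl

theorem lieAutToCLM_injective : Function.Injective (lieAutToCLM (g := g)) :=
  fun _ _ h => LieEquiv.ext fun v => DFunLike.congr_fun h v

theorem lieAutToCLM_mul_adCLM (a : g ≃ₗ⁅ℝ⁆ g) (x : g) :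
    lieAutToCLM a * adCLM x = adCLM (a x) * lieAutToCLM a := by
  ext v
  exact a.map_lie x v

section ExpChart

variable {ι : Type*} [Fintype ι] (u : ι → g)

/-- Products of exponentials `exp (t_i ad u_i)`: canonical coordinates of the second kind on the
group of inner automorphisms. -/
def expChart : List ι → (ι → ℝ) → (g →L[ℝ] g)
  | [], _ => 1
  | i :: l, t => NormedSpace.exp (adCLM (t i • u i)) * expChart l t

/-- The right logarithmic derivative of `expChart`. -/
def expChartForm : List ι → (ι → ℝ) → ((ι → ℝ) →L[ℝ] g)
  | [], _ => 0
  | i :: l, t => (ContinuousLinearMap.proj i : (ι → ℝ) →L[ℝ] ℝ).smulRight (u i) +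
      (NormedSpace.exp (adCLM (t i • u i)) : g →L[ℝ] g) ∘L expChartForm l t

theorem exists_innerAut_eq_expChart (l : List ι) (t : ι → ℝ) :
    ∃ a ∈ innerAut g, lieAutToCLM a = expChart u l t := by
  induction l with
  | nil => exact ⟨1, one_mem _, rfl⟩
  | cons i l ih =>
    obtain ⟨a, ha, hae⟩ := ih
    obtain ⟨b, hb, hbe⟩ := exists_innerAut_eq_exp (t i • u i)
    exact ⟨b * a, mul_mem hb ha, by rw [lieAutToCLM_mul, hae, hbe, expChart]⟩

theorem expChart_zero (l : List ι) : expChart u l 0 = 1 := by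
  induction l with
  | nil => rfl
  | cons i l ih => simp [expChart, ih, ← adL_apply]

/-- The form takes its values in `g` and not in `ad g`. So at the origin it is an isomorphism when
`u` is a basis and `l` lists each index once, even if `g` has a centre. -/
theorem expChartForm_zero (l : List ι) (h : ι → ℝ) :
    expChartForm u l 0 h = (l.map fun i => h i • u i).sum := by
  induction l with
  | nil => rfl
  | cons i l ih => simp [expChartForm, ih, ← adL_apply]

theorem contDiff_exp_adCLM_smul (i : ι) {n : WithTop ℕ∞} :
    ContDiff ℝ n (fun t : ι → ℝ => (NormedSpace.exp (adCLM (t i • u i)) : g →L[ℝ] g)) := by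
  have h : ContDiff ℝ n (NormedSpace.exp : (g →L[ℝ] g) → (g →L[ℝ] g)) :=
    contDiff_iff_contDiffAt.2 fun x => (NormedSpace.exp_analytic (𝕂 := ℝ) x).contDiffAt
  have h2 : ContDiff ℝ n (fun t : ι → ℝ => t i • u i) := by fun_prop
  exact h.comp ((adL g).contDiff.comp h2)

theorem contDiff_expChartForm (l : List ι) {n : WithTop ℕ∞} :
    ContDiff ℝ n (expChartForm u l) := by
  induction l with
  | nil => exact contDiff_const
  | cons i l ih => exact contDiff_const.add ((contDiff_exp_adCLM_smul u i).clm_comp ih)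

/-- Product rule: moving the first factor `exp (ad (t_i u_i))` past the `ad` coming from the
remaining factors conjugates it, which is the second summand of `expChartForm`. -/
theorem hasDerivWithinAt_expChart (l : List ι) {c : ℝ → ι → ℝ} {c' : ι → ℝ} {s : Set ℝ} {r : ℝ}
    (hc : HasDerivWithinAt c c' s r) :
    HasDerivWithinAt (fun r => expChart u l (c r))
      (adCLM (expChartForm u l (c r) c') * expChart u l (c r)) s r := by
  induction l with
  | nil =>
    refine (hasDerivWithinAt_const r s (1 : g →L[ℝ] g)).congr_deriv ?_
    simp [expChartForm, ← adL_apply]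
  | cons i l ih =>
    have hci : HasDerivWithinAt (fun r => c r i) (c' i) s r := hasDerivWithinAt_pi.1 hc i
    have h1 : HasDerivWithinAt
        (fun r => (NormedSpace.exp (adCLM (c r i • u i)) : g →L[ℝ] g))
        (c' i • (adCLM (u i) * NormedSpace.exp (adCLM (c r i • u i)))) s r := by
      simp only [← adL_apply, map_smul]
      exact HasDerivAt.scomp_hasDerivWithinAt r (hasDerivAt_exp_smul_const' (adL g (u i)) (c r i))
        hci
    refine (h1.mul ih).congr_deriv ?_
    obtain ⟨a, -, ha⟩ := exists_innerAut_eq_exp (c r i • u i)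
    have h2 : adCLM (expChartForm u (i :: l) (c r) c') =
        c' i • adCLM (u i) + adCLM (a (expChartForm u l (c r) c')) := by
      simp only [← adL_apply, ← map_smul, ← map_add]
      rw [expChartForm, ← ha]
      rfl
    rw [h2, expChart, ← ha, ← mul_assoc, lieAutToCLM_mul_adCLM]
    simp only [add_mul, smul_mul_assoc, mul_assoc]

end ExpChart

/-- Solve `expChartForm (α) α' = c` with `α s₀ = 0`, that is `α' = expChartForm(α)⁻¹ c`. Then
`expChart (α s) * X s₀` and `X` solve the same linear equation with the same value at `s₀`, so they
agree nearby, and `expChart` takes its values in the inner automorphisms. -/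
theorem innerAut_of_hasDerivWithinAt_local {a b : ℝ} {c : ℝ → g} (hc : ContinuousOn c (Icc a b))
    {X : ℝ → g →L[ℝ] g}
    (hX : ∀ s ∈ Icc a b, HasDerivWithinAt X (adCLM (c s) * X s) (Icc a b) s)
    {s₀ : ℝ} (hs₀ : s₀ ∈ Icc a b) :
    ∀ᶠ s in 𝓝[Icc a b] s₀, ∃ i ∈ innerAut g, X s = lieAutToCLM i * X s₀ := by
  have hab : a ≤ b := hs₀.1.trans hs₀.2
  let β := Module.finBasis ℝ g
  let l := (Finset.univ : Finset (Fin (Module.finrank ℝ g))).toList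
  set B := expChartForm β l with hBdef
  let L : (Fin (Module.finrank ℝ g) → ℝ) ≃L[ℝ] g := β.equivFun.symm.toContinuousLinearEquiv
  have hB0 : B 0 = L := by
    ext h
    rw [hBdef, expChartForm_zero, Finset.sum_map_toList]
    exact (β.equivFun_symm_apply _).symm
  -- A `C^1` map is locally Lipschitz, which is the regularity needed for the nonlinear equation for
  -- `α`.
  have hBinv : ContDiffAt ℝ 1 (fun t => (B t).inverse) 0 := by
    have h := contDiffAt_map_inverse (𝕜 := ℝ) (n := 1) L
    rw [← hB0] at h
    exact h.comp 0 (contDiff_expChartForm β l).contDiffAt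
  have hBunit : ∀ᶠ t in 𝓝 0, ∃ L' : (Fin (Module.finrank ℝ g) → ℝ) ≃L[ℝ] g, (L' : _ →L[ℝ] g) = B t := by
    have h1 := (contDiff_expChartForm β l (n := 0)).continuous.continuousAt (x := 0)
    have h2 := h1.eventually_mem ((ContinuousLinearEquiv.isOpen (𝕜 := ℝ)).mem_nhds ⟨L, hB0.symm⟩)
    exact h2
  obtain ⟨K, U, hU, hKU⟩ := hBinv.exists_lipschitzOnWith
  obtain ⟨C, hC⟩ : ∃ C, ∀ s ∈ Icc a b, ‖c s‖ ≤ C := isCompact_Icc.exists_bound_of_continuousOn hc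
  have hC0 : 0 ≤ C := (norm_nonneg _).trans (hC s₀ hs₀)
  -- The nonlinear equation is solved on a two-sided interval around `s₀`, which may be an endpoint;
  -- so `c` is extended by constants.
  let c' : ℝ → g := IccExtend hab ((Icc a b).domRestrict c)
  have hc'C : ∀ s, ‖c' s‖ ≤ C := fun s => hC _ (projIcc a b hab s).2
  have hc'eq : ∀ s ∈ Icc a b, c' s = c s := fun s hs => IccExtend_of_mem hab _ hs
  have hc'c : Continuous c' := (continuousOn_iff_continuous_domRestrict.1 hc).Icc_extend'
  set N := ‖(B 0).inverse‖ + 1 with hN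
  have hbd : ∀ᶠ t in 𝓝 0, ‖(B t).inverse‖ < N :=
    hBinv.continuousAt.norm.eventually_lt_const (lt_add_one _)
  obtain ⟨r, hr, hball⟩ := Metric.nhds_basis_closedBall.eventually_iff.1
    ((Filter.eventually_mem_set.2 hU).and (hbd.and hBunit))
  have hN0 : 0 < N := by positivity
  let D := N * C + 1
  have hD0 : 0 < D := by positivity
  -- `D` bounds the speed on the ball of radius `r` (the summand `1` keeps it positive if `C = 0`),
  -- so in time `r / D` the solution cannot leave the ball.
  set ε := r / D with hε
  have hε0 : 0 < ε := by positivity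
  have hpl : IsPicardLindelof (fun s t => (B t).inverse (c' s))
      (⟨s₀, by constructor <;> linarith⟩ : Icc (s₀ - ε) (s₀ + ε)) 0 ⟨r, hr.le⟩ 0 ⟨D, hD0.le⟩
      (K * ⟨C, hC0⟩) := by
    constructor
    · intro s _
      refine LipschitzOnWith.of_dist_le_mul fun t ht t' ht' => ?_
      rw [dist_eq_norm, ← sub_apply]
      refine ((((B t).inverse - (B t').inverse).le_opNorm _).trans
        (mul_le_mul_of_nonneg_left (hc'C s) (norm_nonneg _))).trans ?_
      have := hKU.dist_le_mul t (hball ht).1 t' (hball ht').1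
      rw [dist_eq_norm] at this
      refine (mul_le_mul_of_nonneg_right this hC0).trans (le_of_eq ?_)
      change (K : ℝ) * dist t t' * C = (K : ℝ) * C * dist t t'
      ring
    · intro t _
      exact ((B t).inverse.continuous.comp hc'c).continuousOn
    · intro s _ t ht
      refine ((B t).inverse.le_opNorm _).trans ?_
      have h1 : ‖(B t).inverse‖ * ‖c' s‖ ≤ N * C :=
        mul_le_mul (hball ht).2.1.le (hc'C s) (norm_nonneg _) hN0.le
      exact h1.trans (by change N * C ≤ N * C + 1; linarith)
    · have h1 : max (s₀ + ε - s₀) (s₀ - (s₀ - ε)) = ε := by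
        rw [add_sub_cancel_left, sub_sub_cancel, max_self]
      change D * max (s₀ + ε - s₀) (s₀ - (s₀ - ε)) ≤ r - 0
      rw [h1, hε, mul_div_cancel₀ _ hD0.ne', sub_zero]
  obtain ⟨α, hα0, hα⟩ := hpl.exists_eq_forall_mem_Icc_hasDerivWithinAt₀
  have hα0' : α s₀ = 0 := hα0
  have hαc : ContinuousAt α s₀ := by
    have hmem : s₀ ∈ Icc (s₀ - ε) (s₀ + ε) := by constructor <;> linarith
    exact (hα s₀ hmem).continuousWithinAt.continuousAt
      (Icc_mem_nhds (by linarith) (by linarith))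
  have hαball : ∀ᶠ s in 𝓝 s₀, ∃ L' : (Fin (Module.finrank ℝ g) → ℝ) ≃L[ℝ] g,
      (L' : _ →L[ℝ] g) = B (α s) := by
    have h1 : Tendsto α (𝓝 s₀) (𝓝 0) := hα0' ▸ hαc
    exact h1.eventually hBunit
  obtain ⟨δ', hδ', hδball⟩ := Metric.nhds_basis_closedBall.eventually_iff.1 hαball
  -- Short enough for `α` to exist and for the form to be invertible along it.
  set δ := min δ' ε with hδ
  have hδ0 : 0 < δ := lt_min hδ' hε0
  set a' := max a (s₀ - δ) with ha'
  set b' := min b (s₀ + δ) with hb'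
  have hJ : ∀ s ∈ Icc a' b', s ∈ Icc a b ∧ s ∈ Icc (s₀ - δ) (s₀ + δ) := fun s hs =>
    ⟨⟨(le_max_left _ _).trans hs.1, hs.2.trans (min_le_left _ _)⟩,
      ⟨(le_max_right _ _).trans hs.1, hs.2.trans (min_le_right _ _)⟩⟩
  have hs₀J : s₀ ∈ Icc a' b' :=
    ⟨max_le hs₀.1 (by linarith), le_min hs₀.2 (by linarith)⟩
  have hsub : Icc (s₀ - δ) (s₀ + δ) ⊆ Icc (s₀ - ε) (s₀ + ε) :=
    Icc_subset_Icc (by linarith [min_le_right δ' ε]) (by linarith [min_le_right δ' ε])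
  have hY : ∀ s ∈ Icc a' b', HasDerivWithinAt (fun s => expChart β l (α s) * X s₀)
      (adCLM (c s) * (expChart β l (α s) * X s₀)) (Icc a' b') s := by
    intro s hs
    have h1 := hasDerivWithinAt_expChart β l
      ((hα s (hsub (hJ s hs).2)).mono fun r hr => hsub (hJ r hr).2)
    have h2 : expChartForm β l (α s) ((B (α s)).inverse (c' s)) = c s := by
      obtain ⟨L', hL'⟩ := hδball (x := s) (by
        have := (hJ s hs).2
        rw [Real.closedBall_eq_Icc]
        exact ⟨by linarith [min_le_left δ' ε, this.1], by linarith [min_le_left δ' ε, this.2]⟩)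
      rw [← hBdef, ← hL', ContinuousLinearMap.inverse_equiv, hc'eq s (hJ s hs).1]
      exact L'.apply_symm_apply _
    rw [h2] at h1
    rw [← mul_assoc]
    exact h1.mul_const (X s₀)
  have huniq := linearODE_unique (K := ‖adL g‖ * C) (X := fun s Y => adCLM (c s) * Y)
    (fun s hs v w => by
      rw [← mul_sub]
      refine (norm_mul_le _ _).trans (mul_le_mul_of_nonneg_right ?_ (norm_nonneg _))
      exact ((adL g).le_opNorm _).trans (by gcongr; exact hC s (hJ s hs).1))
    (fun s hs => (hX s (hJ s hs).1).mono fun r hr => (hJ r hr).1) hY hs₀J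
    (by rw [hα0', expChart_zero, one_mul])
  have hmem : Icc a' b' ∈ 𝓝[Icc a b] s₀ := by
    have h1 : Icc (s₀ - δ) (s₀ + δ) ∈ 𝓝 s₀ := Icc_mem_nhds (by linarith) (by linarith)
    filter_upwards [self_mem_nhdsWithin, mem_nhdsWithin_of_mem_nhds h1] with s hs hs'
    exact ⟨max_le hs.1 hs'.1, le_min hs.2 hs'.2⟩
  filter_upwards [hmem] with s hs
  obtain ⟨i, hi, hie⟩ := exists_innerAut_eq_expChart β l (α s)
  exact ⟨i, hi, by rw [hie]; exact huniq hs⟩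

/-- A curve of automorphisms whose logarithmic derivative consists of inner derivations stays in
one coset of the group of inner automorphisms. -/
theorem innerAut_of_hasDerivWithinAt {a b : ℝ} {c : ℝ → g} (hc : ContinuousOn c (Icc a b))
    {X : ℝ → g ≃ₗ⁅ℝ⁆ g} (hX : ∀ s ∈ Icc a b,
      HasDerivWithinAt (fun s => lieAutToCLM (X s)) (adCLM (c s) * lieAutToCLM (X s)) (Icc a b) s)
    {s t : ℝ} (hs : s ∈ Icc a b) (ht : t ∈ Icc a b) :
    (QuotientGroup.mk (X s) : (g ≃ₗ⁅ℝ⁆ g) ⧸ innerAut g) = QuotientGroup.mk (X t) := by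
  -- Lying in the same coset is an equivalence relation, so on a connected interval the local
  -- statement suffices.
  refine isPreconnected_Icc.induction₂
    (fun s t => (QuotientGroup.mk (X s) : (g ≃ₗ⁅ℝ⁆ g) ⧸ innerAut g) = QuotientGroup.mk (X t))
    (fun s hs => ?_) (fun _ _ _ _ _ _ h h' => h.trans h') (fun _ _ _ _ h => h.symm) hs ht
  filter_upwards [innerAut_of_hasDerivWithinAt_local hc hX hs] with t ht
  obtain ⟨i, hi, hie⟩ := ht
  rw [← lieAutToCLM_mul] at hie
  -- The inner factor stands on the left, while the quotient is by left cosets; normality makes the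
  -- class map multiplicative.
  rw [lieAutToCLM_injective hie, QuotientGroup.mk_mul, (QuotientGroup.eq_one_iff i).2 hi, one_mul]

end InnerAutomorphisms

/-! ### The matrix of a connection in a trivialization -/

section ConnectionForms

variable {n : ℕ} {M : Type*} [TopologicalSpace M] [ChartedSpace (EuclideanSpace ℝ (Fin n)) M]
  [IsManifold (𝓡 n) ∞ M]
  {g : Type*} [NormedLieAlgebra g] [FiniteDimensional ℝ g]
  {V : M → Type*} [TopologicalSpace (TotalSpace g V)]
  [∀ x, LieRing (V x)] [∀ x, LieAlgebra ℝ (V x)] [∀ x, TopologicalSpace (V x)]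
  [∀ x, IsTopologicalAddGroup (V x)] [∀ x, ContinuousSMul ℝ (V x)]
  [FiberBundle g V] [VectorBundle ℝ g V] [ContMDiffVectorBundle ∞ g V (𝓡 n)]

variable (n) in
/-- A trivialization of `V` which is smooth together with its inverse. -/
structure IsSmoothTriv (e : Trivialization g (π g V)) : Prop where
  smooth : ContMDiffOn ((𝓡 n).prod 𝓘(ℝ, g)) ((𝓡 n).prod 𝓘(ℝ, g)) ∞ e e.source
  smooth_symm : ContMDiffOn ((𝓡 n).prod 𝓘(ℝ, g)) ((𝓡 n).prod 𝓘(ℝ, g)) ∞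
    e.toOpenPartialHomeomorph.symm e.target

instance LieTrivialization.toTriv_isLinear (e : LieTrivialization n g V) :
    e.toTriv.IsLinear ℝ := e.linear

theorem LieTrivialization.isSmoothTriv (e : LieTrivialization n g V) :
    IsSmoothTriv n e.toTriv := ⟨e.smooth, e.smooth_symm⟩

theorem isSmoothTriv_trivializationAt (x : M) : IsSmoothTriv n (trivializationAt g V x) :=
  ⟨Trivialization.contMDiffOn _, Trivialization.contMDiffOn_symm _⟩

variable {e e' : Trivialization g (π g V)} {x : M}

theorem IsSmoothTriv.contMDiffAt_symm (he : IsSmoothTriv n e) (hx : x ∈ e.baseSet) {f : M → g}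
    (hf : ContMDiffAt (𝓡 n) 𝓘(ℝ, g) ∞ f x) :
    ContMDiffAt (𝓡 n) ((𝓡 n).prod 𝓘(ℝ, g)) ∞
      (fun y => (⟨y, e.symm y (f y)⟩ : TotalSpace g V)) x := by
  have h1 : ContMDiffAt ((𝓡 n).prod 𝓘(ℝ, g)) ((𝓡 n).prod 𝓘(ℝ, g)) ∞
      e.toOpenPartialHomeomorph.symm (x, f x) :=
    he.smooth_symm.contMDiffAt (e.open_target.mem_nhds (e.mem_target.2 hx))
  have h2 : ContMDiffAt (𝓡 n) ((𝓡 n).prod 𝓘(ℝ, g)) ∞ (fun y => (y, f y)) x :=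
    contMDiffAt_id.prodMk hf
  refine (h1.comp x h2).congr_of_eventuallyEq ?_
  filter_upwards [e.open_baseSet.mem_nhds hx] with y hy
  exact e.mk_symm hy (f y)

theorem IsSmoothTriv.contMDiffOn_symm_const (he : IsSmoothTriv n e) (v : g) :
    ContMDiffOn (𝓡 n) ((𝓡 n).prod 𝓘(ℝ, g)) ∞
      (fun y => (⟨y, e.symm y v⟩ : TotalSpace g V)) e.baseSet := fun _ hy =>
  (he.contMDiffAt_symm hy (contMDiffAt_const (c := v))).contMDiffWithinAt

theorem IsSmoothTriv.mdifferentiableAt_symm_const (he : IsSmoothTriv n e) (hx : x ∈ e.baseSet)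
    (v : g) : MDifferentiableAt (𝓡 n) ((𝓡 n).prod 𝓘(ℝ, g))
      (fun y => (⟨y, e.symm y v⟩ : TotalSpace g V)) x :=
  (he.contMDiffAt_symm hx (contMDiffAt_const (c := v))).mdifferentiableAt (by simp)

theorem IsSmoothTriv.contMDiffAt_apply (he : IsSmoothTriv n e) (hx : x ∈ e.baseSet)
    {u : Π y, V y} (hu : ContMDiffAt (𝓡 n) ((𝓡 n).prod 𝓘(ℝ, g)) ∞
      (fun y => (⟨y, u y⟩ : TotalSpace g V)) x) :
    ContMDiffAt (𝓡 n) 𝓘(ℝ, g) ∞ (fun y => (e ⟨y, u y⟩).2) x := by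
  have h1 : ContMDiffAt ((𝓡 n).prod 𝓘(ℝ, g)) ((𝓡 n).prod 𝓘(ℝ, g)) ∞ e ⟨x, u x⟩ :=
    he.smooth.contMDiffAt (e.open_source.mem_nhds (e.mem_source.2 hx))
  exact (h1.comp x hu).snd

theorem IsSmoothTriv.mdifferentiableAt_apply (he : IsSmoothTriv n e) (hx : x ∈ e.baseSet)
    {u : Π y, V y} (hu : MDifferentiableAt (𝓡 n) ((𝓡 n).prod 𝓘(ℝ, g))
      (fun y => (⟨y, u y⟩ : TotalSpace g V)) x) :
    MDifferentiableAt (𝓡 n) 𝓘(ℝ, g) (fun y => (e ⟨y, u y⟩).2) x := by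
  have h1 : MDifferentiableAt ((𝓡 n).prod 𝓘(ℝ, g)) ((𝓡 n).prod 𝓘(ℝ, g)) e
      (⟨x, u x⟩ : TotalSpace g V) :=
    (he.smooth.contMDiffAt (e.open_source.mem_nhds (e.mem_source.2 hx))).mdifferentiableAt
      (by simp)
  exact (h1.comp x hu).snd

/-- Both terms satisfy the same Leibniz rule, so the derivatives of `f` cancel in the difference.
Hence it depends only on the value of the section at `x`. -/
theorem tensorialAt_sub_mvfderiv (nabla : CovariantDerivative (𝓡 n) g V) [e.IsLinear ℝ]
    (he : IsSmoothTriv n e) (hx : x ∈ e.baseSet) (a : TangentSpace (𝓡 n) x) :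
    TensorialAt (𝓡 n) g (fun u : Π y, V y => (e ⟨x, nabla u x a⟩).2 -
      mvfderiv (𝓡 n) (fun y => (e ⟨y, u y⟩).2) x a) x where
  smul := by
    intro f u hf hu
    have h1 := nabla.isCovariantDerivativeOn.leibniz hu hf (mem_univ x)
    have hl := e.linear ℝ hx
    have h2 : (fun y => (e ⟨y, (f • u) y⟩).2) =ᶠ[𝓝 x] f • (fun y => (e ⟨y, u y⟩).2) := by
      filter_upwards [e.open_baseSet.mem_nhds hx] with y hy
      exact (e.linear ℝ hy).map_smul (f y) (u y)
    have h3 : mvfderiv (𝓡 n) (fun y => (e ⟨y, (f • u) y⟩).2) x =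
        mvfderiv (𝓡 n) (f • (fun y => (e ⟨y, u y⟩).2)) x := by
      simp only [mvfderiv]; rw [h2.mfderiv_eq]; rfl
    rw [h1, h3, mvfderiv_smul hf (he.mdifferentiableAt_apply hx hu)]
    have h4 := hl.map_add (f x • nabla u x a) ((mvfderiv (𝓡 n) f x a) • u x)
    have h5 := hl.map_smul (f x) (nabla u x a)
    have h6 := hl.map_smul (mvfderiv (𝓡 n) f x a) (u x)
    simp [h4, h5, h6, smul_sub]
  add := by
    intro u w hu hw
    have h1 := nabla.isCovariantDerivativeOn.add hu hw (mem_univ x)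
    have hl := e.linear ℝ hx
    have h2 : (fun y => (e ⟨y, (u + w) y⟩).2) =ᶠ[𝓝 x]
        (fun y => (e ⟨y, u y⟩).2) + (fun y => (e ⟨y, w y⟩).2) := by
      filter_upwards [e.open_baseSet.mem_nhds hx] with y hy
      exact (e.linear ℝ hy).map_add (u y) (w y)
    have h3 : mvfderiv (𝓡 n) (fun y => (e ⟨y, (u + w) y⟩).2) x =
        mvfderiv (𝓡 n) ((fun y => (e ⟨y, u y⟩).2) + (fun y => (e ⟨y, w y⟩).2)) x := by
      simp only [mvfderiv]; rw [h2.mfderiv_eq]; rfl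
    rw [h1, h3, mvfderiv_add (he.mdifferentiableAt_apply hx hu) (he.mdifferentiableAt_apply hx hw)]
    have h4 := hl.map_add (nabla u x a) (nabla w x a)
    simp [h4]; abel

theorem mvfderiv_apply_symm_const (hx : x ∈ e.baseSet) (v : g) :
    mvfderiv (𝓡 n) (fun y => (e ⟨y, e.symm y v⟩).2) x = 0 := by
  have h : (fun y => (e ⟨y, e.symm y v⟩).2) =ᶠ[𝓝 x] fun _ => v := by
    filter_upwards [e.open_baseSet.mem_nhds hx] with y hy
    rw [e.apply_mk_symm hy]
  simp only [mvfderiv]; rw [h.mfderiv_eq, mfderiv_const]; rfl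

/-- The matrix of a connection with respect to a local trivialization `e`: for `x` in the base set,
`connForm nabla e x a v` is the coordinate expression of `∇_a` of the section which is constantly
`v` with respect to `e`. -/
def connForm (nabla : CovariantDerivative (𝓡 n) g V) (e : Trivialization g (π g V)) (x : M) :
    EuclideanSpace ℝ (Fin n) →L[ℝ] g →L[ℝ] g :=
  open Classical in
  if h : ∃ A : EuclideanSpace ℝ (Fin n) →L[ℝ] g →L[ℝ] g, ∀ a v,
      A a v = (e ⟨x, nabla (fun y => e.symm y v) x a⟩).2 then h.choose else 0

theorem connForm_apply (nabla : CovariantDerivative (𝓡 n) g V) [e.IsLinear ℝ]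
    (he : IsSmoothTriv n e) (hx : x ∈ e.baseSet) (a : TangentSpace (𝓡 n) x) (v : g) :
    connForm nabla e x a v = (e ⟨x, nabla (fun y => e.symm y v) x a⟩).2 := by
  have hM : ContMDiffVectorBundle 1 g V (𝓡 n) := .of_le (n := ∞) (by simp)
  have h : ∃ A : EuclideanSpace ℝ (Fin n) →L[ℝ] g →L[ℝ] g, ∀ a v,
      A a v = (e ⟨x, nabla (fun y => e.symm y v) x a⟩).2 := by
    have hΦ := fun a => tensorialAt_sub_mvfderiv nabla he hx a
    have hl := e.linear ℝ hx
    -- For sections constant in `e` the subtracted derivative is zero, so tensoriality yields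
    -- linearity in `v`.
    have key : ∀ a v, (e ⟨x, nabla (fun y => e.symm y v) x a⟩).2 =
      (e ⟨x, nabla (fun y => e.symm y v) x a⟩).2 -
      mvfderiv (𝓡 n) (fun y => (e ⟨y, e.symm y v⟩).2) x a := by
      intro a v; rw [mvfderiv_apply_symm_const hx]; simp
    have hd := he.mdifferentiableAt_symm_const hx
    have hM1 : IsManifold (𝓡 n) 1 M := .of_le (n := ∞) (by simp)
    let A : TangentSpace (𝓡 n) x →ₗ[ℝ] g →ₗ[ℝ] g := LinearMap.mk₂ ℝ
      (fun a v => (e ⟨x, nabla (fun y => e.symm y v) x a⟩).2)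
      (by
        intro a b v
        have h4 := hl.map_add (nabla (fun y => e.symm y v) x a) (nabla (fun y => e.symm y v) x b)
        rw [← h4, map_add])
      (by
        intro c a v
        have h4 := hl.map_smul c (nabla (fun y => e.symm y v) x a)
        rw [← h4, map_smul])
      (by
        intro a v w
        rw [key a, key a v, key a w, ← (hΦ a).add (hd v) (hd w)]
        refine (hΦ a).pointwise (hd _) (mdifferentiableAt_add_section (hd v) (hd w)) ?_
        change e.symm x (v + w) = e.symm x v + e.symm x w
        rw [← e.coe_symmₗ (R := ℝ) hx]
        exact map_add _ _ _)
      (by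
        intro c a v
        rw [key a, key a v, ← (hΦ a).smul (f := fun _ => c) mdifferentiableAt_const (hd v)]
        refine (hΦ a).pointwise (hd _) (mdifferentiableAt_const.smul_section (hd v)) ?_
        change e.symm x (c • v) = c • e.symm x v
        rw [← e.coe_symmₗ (R := ℝ) hx]
        exact map_smul _ _ _)
    let A' : EuclideanSpace ℝ (Fin n) →ₗ[ℝ] g →ₗ[ℝ] g := A
    exact ⟨LinearMap.toContinuousLinearMap
      ((LinearMap.toContinuousLinearMap : (g →ₗ[ℝ] g) ≃ₗ[ℝ] _).toLinearMap ∘ₗ A'),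
      fun a v => rfl⟩
  rw [connForm, dif_pos h]
  exact h.choose_spec a v

/-- The coordinate expression of a covariant derivative. -/
theorem apply_nabla (nabla : CovariantDerivative (𝓡 n) g V) [e.IsLinear ℝ]
    (he : IsSmoothTriv n e) (hx : x ∈ e.baseSet) {u : Π y, V y} (hu : MDifferentiableAt (𝓡 n) ((𝓡 n).prod 𝓘(ℝ, g))
      (fun y => (⟨y, u y⟩ : TotalSpace g V)) x)
    (a : TangentSpace (𝓡 n) x) :
    (e ⟨x, nabla u x a⟩).2 = mvfderiv (𝓡 n) (fun y => (e ⟨y, u y⟩).2) x a +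
      connForm nabla e x a (e ⟨x, u x⟩).2 := by
  have hM : ContMDiffVectorBundle 1 g V (𝓡 n) := .of_le (n := ∞) (by simp)
  have hM1 : IsManifold (𝓡 n) 1 M := .of_le (n := ∞) (by simp)
  have h := (tensorialAt_sub_mvfderiv nabla he hx a).pointwise hu
    (he.mdifferentiableAt_symm_const hx (e ⟨x, u x⟩).2) (by
      rw [e.symm_apply_apply_mk hx])
  simp only [mvfderiv_apply_symm_const hx, ← connForm_apply nabla he hx] at h
  rw [← sub_eq_iff_eq_add', h]
  simp

end ConnectionForms

/-! ### Gauge change, compatibility with the bracket, equivalent connections -/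

section ConnectionFormProperties

variable {n : ℕ} {M : Type*} [TopologicalSpace M] [ChartedSpace (EuclideanSpace ℝ (Fin n)) M]
  [IsManifold (𝓡 n) ∞ M]
  {g : Type*} [NormedLieAlgebra g] [FiniteDimensional ℝ g]
  {V : M → Type*} [TopologicalSpace (TotalSpace g V)]
  [∀ x, LieRing (V x)] [∀ x, LieAlgebra ℝ (V x)] [∀ x, TopologicalSpace (V x)]
  [∀ x, IsTopologicalAddGroup (V x)] [∀ x, ContinuousSMul ℝ (V x)]
  [FiberBundle g V] [VectorBundle ℝ g V] [ContMDiffVectorBundle ∞ g V (𝓡 n)]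
  {e e' : Trivialization g (π g V)} {x : M}

theorem ContMDiffAt.clm_of_apply {H E' F G N : Type*} [NormedAddCommGroup E'] [NormedSpace ℝ E']
    [TopologicalSpace H] {I : ModelWithCorners ℝ E' H} [TopologicalSpace N] [ChartedSpace H N]
    [NormedAddCommGroup F] [NormedSpace ℝ F] [FiniteDimensional ℝ F]
    [NormedAddCommGroup G] [NormedSpace ℝ G] {m : ℕ∞ω} {f : N → F →L[ℝ] G} {x : N}
    (h : ∀ v, ContMDiffAt I 𝓘(ℝ, G) m (fun y => f y v) x) :
    ContMDiffAt I 𝓘(ℝ, F →L[ℝ] G) m f x := by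
  let b := Module.finBasis ℝ F
  let L : Fin (Module.finrank ℝ F) → G →L[ℝ] F →L[ℝ] G := fun i =>
    ContinuousLinearMap.smulRightL ℝ F G (LinearMap.toContinuousLinearMap (b.coord i))
  have hf : f = fun y => ∑ i, L i (f y (b i)) := by
    funext y
    ext v
    have : v = ∑ i, b.coord i v • b i := by simp [b.sum_repr]
    conv_lhs => rw [this, map_sum]
    simp only [map_smul, sum_apply]
    rfl
  rw [hf]
  exact contMDiffAt_finsetSum fun i _ => (L i).contMDiff.contMDiffAt.comp x (h (b i))

theorem coordChangeL_apply_apply [e.IsLinear ℝ] [e'.IsLinear ℝ] (hx : x ∈ e.baseSet)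
    (hx' : x ∈ e'.baseSet) (w : V x) :
    e.coordChangeL ℝ e' x (e ⟨x, w⟩).2 = (e' ⟨x, w⟩).2 := by
  rw [e.coordChangeL_apply e' ⟨hx, hx'⟩, e.symm_apply_apply_mk hx]

theorem IsSmoothTriv.contMDiffAt_coordChangeL [e.IsLinear ℝ] [e'.IsLinear ℝ] (he : IsSmoothTriv n e)
    (he' : IsSmoothTriv n e') (hx : x ∈ e.baseSet) (hx' : x ∈ e'.baseSet) :
    ContMDiffAt (𝓡 n) 𝓘(ℝ, g →L[ℝ] g) ∞ (fun y => (e.coordChangeL ℝ e' y : g →L[ℝ] g)) x := by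
  refine ContMDiffAt.clm_of_apply fun v => ?_
  refine (he'.contMDiffAt_apply hx' (he.contMDiffAt_symm hx
    (contMDiffAt_const (c := v)))).congr_of_eventuallyEq ?_
  filter_upwards [e.open_baseSet.mem_nhds hx, e'.open_baseSet.mem_nhds hx'] with y hy hy'
  exact e.coordChangeL_apply e' ⟨hy, hy'⟩ v

/-- The matrices of a connection with respect to two trivializations. -/
theorem coordChangeL_connForm (nabla : CovariantDerivative (𝓡 n) g V) [e.IsLinear ℝ]
    [e'.IsLinear ℝ] (he : IsSmoothTriv n e) (he' : IsSmoothTriv n e') (hx : x ∈ e.baseSet)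
    (hx' : x ∈ e'.baseSet) (a : TangentSpace (𝓡 n) x) :
    (e.coordChangeL ℝ e' x : g →L[ℝ] g) * connForm nabla e x a =
      mvfderiv (𝓡 n) (fun y => (e.coordChangeL ℝ e' y : g →L[ℝ] g)) x a +
        connForm nabla e' x a * (e.coordChangeL ℝ e' x : g →L[ℝ] g) := by
  ext v
  -- The formula results from expressing `∇` of an `e`-constant section in the coordinates of `e'`.
  have h1 := apply_nabla nabla he' hx' (he.mdifferentiableAt_symm_const hx v) a
  have hτ := (IsSmoothTriv.contMDiffAt_coordChangeL he he' hx hx').mdifferentiableAt (by simp)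
  have h2 : mvfderiv (𝓡 n) (fun y => (e' ⟨y, e.symm y v⟩).2) x a =
      mvfderiv (𝓡 n) (fun y => (e.coordChangeL ℝ e' y : g →L[ℝ] g)) x a v := by
    have h3 : (fun y => (e' ⟨y, e.symm y v⟩).2) =ᶠ[𝓝 x]
        (ContinuousLinearMap.apply ℝ g v) ∘ fun y => (e.coordChangeL ℝ e' y : g →L[ℝ] g) := by
      filter_upwards [e.open_baseSet.mem_nhds hx, e'.open_baseSet.mem_nhds hx'] with y hy hy'
      exact (e.coordChangeL_apply e' ⟨hy, hy'⟩ v).symm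
    have h4 := (HasMFDerivAt.comp x
      (ContinuousLinearMap.hasMFDerivAt (ContinuousLinearMap.apply ℝ g v))
      hτ.hasMFDerivAt).congr_of_eventuallyEq h3
    simp only [mvfderiv]
    rw [h4.mfderiv]
    rfl
  rw [← coordChangeL_apply_apply hx hx', ← connForm_apply nabla he hx, h2] at h1
  rw [← e.coordChangeL_apply (R := ℝ) e' ⟨hx, hx'⟩] at h1
  exact h1

variable [T2Space M]

variable (n) in
theorem exists_smooth_cutoff {U : Set M} (hU : U ∈ 𝓝 x) : ∃ χ : M → ℝ,
    ContMDiff (𝓡 n) 𝓘(ℝ, ℝ) ∞ χ ∧ χ =ᶠ[𝓝 x] 1 ∧ tsupport χ ⊆ U := by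
  obtain ⟨f, -, hf⟩ := (SmoothBumpFunction.nhds_basis_tsupport (I := 𝓡 n) x).mem_iff.1 hU
  exact ⟨f, f.contMDiff, f.eventuallyEq_one, hf⟩

/-- The conditions on a `DeltaConnection` concern global smooth sections; cutting off makes them
applicable to locally constant ones. -/
theorem IsSmoothTriv.exists_smooth_section [e.IsLinear ℝ] (he : IsSmoothTriv n e)
    (hx : x ∈ e.baseSet) (v : g) :
    ∃ u : Π y, V y, IsSmoothSection n g u ∧ ∀ᶠ y in 𝓝 x, (e ⟨y, u y⟩).2 = v := by
  obtain ⟨χ, h1, h2, h3⟩ := exists_smooth_cutoff n (e.open_baseSet.mem_nhds hx)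
  refine ⟨χ • fun y => e.symm y v, ?_, ?_⟩
  · exact h1.contMDiffOn.smul_section_of_tsupport e.open_baseSet h3 (he.contMDiffOn_symm_const v)
  · filter_upwards [h2, e.open_baseSet.mem_nhds hx] with y hy hy'
    have : (χ • fun y => e.symm y v) y = e.symm y v := by
      simp [hy]
    rw [this, e.apply_mk_symm hy']

theorem IsSmoothSection.mdifferentiableAt {u : Π y, V y} (hu : IsSmoothSection n g u) (x : M) :
    MDifferentiableAt (𝓡 n) ((𝓡 n).prod 𝓘(ℝ, g)) (fun y => (⟨y, u y⟩ : TotalSpace g V)) x :=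
  (hu x).mdifferentiableAt (by simp)

theorem apply_nabla_of_eventually_eq (nabla : CovariantDerivative (𝓡 n) g V) [e.IsLinear ℝ]
    (he : IsSmoothTriv n e) (hx : x ∈ e.baseSet) {u : Π y, V y} (hu : IsSmoothSection n g u)
    {v : g} (huv : ∀ᶠ y in 𝓝 x, (e ⟨y, u y⟩).2 = v) (a : TangentSpace (𝓡 n) x) :
    (e ⟨x, nabla u x a⟩).2 = connForm nabla e x a v := by
  rw [apply_nabla nabla he hx (hu.mdifferentiableAt x), huv.self_of_nhds]
  have : mvfderiv (𝓡 n) (fun y => (e ⟨y, u y⟩).2) x = 0 := by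
    have h : (fun y => (e ⟨y, u y⟩).2) =ᶠ[𝓝 x] fun _ => v := huv
    simp only [mvfderiv]; rw [h.mfderiv_eq, mfderiv_const]; rfl
  simp [this]

theorem LieTrivialization.isSmoothSection_lie (hL : IsLieAlgebraBundle n g V) {u w : Π y, V y}
    (hu : IsSmoothSection n g u) (hw : IsSmoothSection n g w) :
    IsSmoothSection n g (fun y => ⁅u y, w y⁆) := by
  intro x
  obtain ⟨e, hx⟩ := hL x
  have h1 := e.isSmoothTriv.contMDiffAt_apply hx (hu x)
  have h2 := e.isSmoothTriv.contMDiffAt_apply hx (hw x)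
  have h3 : ContMDiffAt (𝓡 n) 𝓘(ℝ, g) ∞
      (fun y => adL g (e.toTriv ⟨y, u y⟩).2 (e.toTriv ⟨y, w y⟩).2) x :=
    ((adL g).contMDiff.contMDiffAt.comp x h1).clm_apply h2
  refine (e.isSmoothTriv.contMDiffAt_symm hx h3).congr_of_eventuallyEq ?_
  filter_upwards [e.toTriv.open_baseSet.mem_nhds hx] with y hy
  rw [adL_apply, adCLM_apply, ← e.map_lie y hy, e.toTriv.symm_apply_apply_mk hy]

/-- The matrix of a connection compatible with the bracket consists of derivations. -/
theorem DeltaConnection.connForm_lie (D : DeltaConnection n g V) (hL : IsLieAlgebraBundle n g V)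
    (e : LieTrivialization n g V) (hx : x ∈ e.toTriv.baseSet) (a : TangentSpace (𝓡 n) x)
    (v w : g) : connForm D.nabla e.toTriv x a ⁅v, w⁆ =
      ⁅connForm D.nabla e.toTriv x a v, w⁆ + ⁅v, connForm D.nabla e.toTriv x a w⁆ := by
  have he := e.isSmoothTriv
  obtain ⟨u, hu, huv⟩ := he.exists_smooth_section hx v
  obtain ⟨u', hu', huw⟩ := he.exists_smooth_section hx w
  have h1 : ∀ᶠ y in 𝓝 x, (e.toTriv ⟨y, ⁅u y, u' y⁆⟩).2 = ⁅v, w⁆ := by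
    filter_upwards [huv, huw, e.toTriv.open_baseSet.mem_nhds hx] with y h1 h2 h3
    rw [e.map_lie y h3, h1, h2]
  rw [← apply_nabla_of_eventually_eq D.nabla he hx
    (LieTrivialization.isSmoothSection_lie hL hu hu') h1, D.leibniz_lie u u' hu hu',
    ← apply_nabla_of_eventually_eq D.nabla he hx hu huv,
    ← apply_nabla_of_eventually_eq D.nabla he hx hu' huw]
  have hl := (e.toTriv.linear ℝ hx).map_add ⁅D.nabla u x a, u' x⁆ ⁅u x, D.nabla u' x a⁆
  rw [hl, e.map_lie x hx, e.map_lie x hx, huv.self_of_nhds, huw.self_of_nhds]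

/-- Equivalent connections have matrices which differ by inner derivations. -/
theorem DeltaConnection.Equivalent.exists_connForm_eq {D D' : DeltaConnection n g V}
    (h : D.Equivalent D') (e : LieTrivialization n g V) (hx : x ∈ e.toTriv.baseSet)
    (a : TangentSpace (𝓡 n) x) :
    ∃ X : g, connForm D'.nabla e.toTriv x a = connForm D.nabla e.toTriv x a + adCLM X := by
  obtain ⟨l, hl⟩ := h
  have he := e.isSmoothTriv
  refine ⟨(e.toTriv ⟨x, l.toFun x a⟩).2, ?_⟩
  ext v
  obtain ⟨u, hu, huv⟩ := he.exists_smooth_section hx v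
  rw [add_apply, adCLM_apply,
    ← apply_nabla_of_eventually_eq D'.nabla he hx hu huv,
    ← apply_nabla_of_eventually_eq D.nabla he hx hu huv, hl u hu]
  have h2 := (e.toTriv.linear ℝ hx).map_add (D.nabla u x a) ⁅l.toFun x a, u x⁆
  rw [h2, e.map_lie x hx, huv.self_of_nhds]

end ConnectionFormProperties

/-! ### Connection and curvature in a chart -/

section ChartConnectionForms

variable {n : ℕ} {M : Type*} [TopologicalSpace M] [ChartedSpace (EuclideanSpace ℝ (Fin n)) M]
  [IsManifold (𝓡 n) ∞ M]
  {g : Type*} [NormedLieAlgebra g] [FiniteDimensional ℝ g]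
  {V : M → Type*} [TopologicalSpace (TotalSpace g V)]
  [∀ x, LieRing (V x)] [∀ x, LieAlgebra ℝ (V x)] [∀ x, TopologicalSpace (V x)]
  [∀ x, IsTopologicalAddGroup (V x)] [∀ x, ContinuousSMul ℝ (V x)]
  [FiberBundle g V] [VectorBundle ℝ g V] [ContMDiffVectorBundle ∞ g V (𝓡 n)]
  {e : Trivialization g (π g V)} {c : OpenPartialHomeomorph M (EuclideanSpace ℝ (Fin n))}

theorem two_le_infty : (2 : ℕ∞ω) ≤ ∞ := ENat.LEInfty.out

theorem isInvertible_mfderiv_chart (hc : c ∈ atlas (EuclideanSpace ℝ (Fin n)) M) {x : M}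
    (hx : x ∈ c.source) : (mfderiv (𝓡 n) (𝓡 n) c x).IsInvertible :=
  have : IsManifold (𝓡 n) 1 M := .of_le (n := ∞) (by simp)
  ⟨(mdifferentiable_of_mem_atlas (I := 𝓡 n) hc).mfderiv hx, rfl⟩

/-- A constant vector field on the model space. -/
def constField (h y : EuclideanSpace ℝ (Fin n)) : TangentSpace (𝓡 n) y := h

/-- The vector field on the domain of a chart with constant coordinates `h`. -/
def coordField (c : OpenPartialHomeomorph M (EuclideanSpace ℝ (Fin n)))
    (h : EuclideanSpace ℝ (Fin n)) (x : M) : TangentSpace (𝓡 n) x :=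
  VectorField.mpullback (𝓡 n) (𝓡 n) c (constField h) x

theorem mfderiv_coordField (hc : c ∈ atlas (EuclideanSpace ℝ (Fin n)) M) {x : M}
    (hx : x ∈ c.source) (h : EuclideanSpace ℝ (Fin n)) :
    mfderiv (𝓡 n) (𝓡 n) c x (coordField c h x) = h :=
  (isInvertible_mfderiv_chart hc hx).self_apply_inverse h

theorem contMDiffAt_const_vectorField (h y : EuclideanSpace ℝ (Fin n)) :
    ContMDiffAt (𝓡 n) (𝓡 n).tangent ∞ (fun z : EuclideanSpace ℝ (Fin n) =>
      (⟨z, constField h z⟩ : TangentBundle (𝓡 n) (EuclideanSpace ℝ (Fin n)))) y := by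
  rw [Bundle.contMDiffAt_section]
  simp
  exact contMDiffAt_const (c := h)

theorem contMDiffAt_coordField (hc : c ∈ atlas (EuclideanSpace ℝ (Fin n)) M) {x : M}
    (hx : x ∈ c.source) (h : EuclideanSpace ℝ (Fin n)) :
    ContMDiffAt (𝓡 n) (𝓡 n).tangent ∞
      (fun y => (⟨y, coordField c h y⟩ : TangentBundle (𝓡 n) M)) x := by
  have : IsManifold (𝓡 n) 1 M := .of_le (n := ∞) (by simp)
  exact ContMDiffAt.mpullback_vectorField_preimage (contMDiffAt_const_vectorField h (c x))
    (contMDiffAt_of_mem_maximalAtlas (n := ∞) (IsManifold.subset_maximalAtlas hc) hx)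
    (isInvertible_mfderiv_chart hc hx) (by simp)

/-- Pull-back commutes with brackets, and constant fields commute. So the term `∇_{[X, Y]}` drops
out of the curvature. -/
theorem mlieBracket_coordField (hc : c ∈ atlas (EuclideanSpace ℝ (Fin n)) M) {x : M}
    (hx : x ∈ c.source) (h k : EuclideanSpace ℝ (Fin n)) :
    VectorField.mlieBracket (𝓡 n) (coordField c h) (coordField c k) x = 0 := by
  have hM : IsManifold (𝓡 n) (minSmoothness ℝ 2) M := .of_le (n := ∞)
    (by simpa using two_le_infty)
  have := VectorField.mpullback_mlieBracket (I := 𝓡 n) (I' := 𝓡 n) (f := c) (x₀ := x) (n := ∞)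
    (V := constField h) (W := constField k)
    ((contMDiffAt_const_vectorField h (c x)).mdifferentiableAt (by simp))
    ((contMDiffAt_const_vectorField k (c x)).mdifferentiableAt (by simp))
    (contMDiffAt_of_mem_maximalAtlas (n := ∞) (IsManifold.subset_maximalAtlas hc) hx)
    (by simpa using two_le_infty)
  have h0 : VectorField.mlieBracket (𝓡 n) (constField h) (constField k) = 0 := by
    rw [← VectorField.mlieBracketWithin_univ, VectorField.mlieBracketWithin_eq_lieBracketWithin]
    funext y
    change fderivWithin ℝ (fun _ : EuclideanSpace ℝ (Fin n) => k) univ y h -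
      fderivWithin ℝ (fun _ : EuclideanSpace ℝ (Fin n) => h) univ y k = 0
    simp
  refine this.symm.trans ?_
  rw [h0]
  simp [VectorField.mpullback]

/-- The matrix of a connection, in a chart. -/
def chartConnForm (nabla : CovariantDerivative (𝓡 n) g V) (e : Trivialization g (π g V))
    (c : OpenPartialHomeomorph M (EuclideanSpace ℝ (Fin n))) (y : EuclideanSpace ℝ (Fin n)) :
    EuclideanSpace ℝ (Fin n) →L[ℝ] g →L[ℝ] g :=
  (connForm nabla e (c.symm y)).comp
    (show EuclideanSpace ℝ (Fin n) →L[ℝ] EuclideanSpace ℝ (Fin n) from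
      (mfderiv (𝓡 n) (𝓡 n) c (c.symm y)).inverse)

theorem chartConnForm_apply (nabla : CovariantDerivative (𝓡 n) g V)
    (y h : EuclideanSpace ℝ (Fin n)) :
    chartConnForm nabla e c y h = connForm nabla e (c.symm y) (coordField c h (c.symm y)) := rfl

theorem chartConnForm_mfderiv (nabla : CovariantDerivative (𝓡 n) g V)
    (hc : c ∈ atlas (EuclideanSpace ℝ (Fin n)) M) {x : M} (hx : x ∈ c.source)
    (a : TangentSpace (𝓡 n) x) :
    chartConnForm nabla e c (c x) (mfderiv (𝓡 n) (𝓡 n) c x a) = connForm nabla e x a := by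
  have h : c.symm (c x) = x := c.left_inv hx
  change connForm nabla e (c.symm (c x)) ((mfderiv (𝓡 n) (𝓡 n) c (c.symm (c x))).inverse
    (mfderiv (𝓡 n) (𝓡 n) c x a)) = _
  -- The tangent space depends on the base point, so `c.symm (c x)` is replaced by a variable before
  -- being identified with `x`.
  generalize c.symm (c x) = z at h
  subst h
  exact congrArg (connForm nabla e z) ((isInvertible_mfderiv_chart hc hx).inverse_apply_self a)

variable [T2Space M]

theorem IsSmoothVectorField.exists_eventuallyEq_coordField
    (hc : c ∈ atlas (EuclideanSpace ℝ (Fin n)) M) {x : M} (hx : x ∈ c.source)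
    (h : EuclideanSpace ℝ (Fin n)) : ∃ X : Π y : M, TangentSpace (𝓡 n) y,
      IsSmoothVectorField n X ∧ ∀ᶠ y in 𝓝 x, X y = coordField c h y := by
  have : IsManifold (𝓡 n) 1 M := .of_le (n := ∞) (by simp)
  obtain ⟨χ, h1, h2, h3⟩ := exists_smooth_cutoff n (c.open_source.mem_nhds hx)
  refine ⟨χ • coordField c h, ?_, ?_⟩
  · exact h1.contMDiffOn.smul_section_of_tsupport c.open_source h3
      fun y hy => (contMDiffAt_coordField hc hy h).contMDiffWithinAt
  · filter_upwards [h2] with y hy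
    change χ y • coordField c h y = _
    rw [hy]; simp

theorem DeltaConnection.isSmoothSection_nabla (D : DeltaConnection n g V) {u : Π y, V y}
    (hu : IsSmoothSection n g u) {x : M} {X : Π y : M, TangentSpace (𝓡 n) y}
    (hX : ContMDiffAt (𝓡 n) (𝓡 n).tangent ∞
      (fun y => (⟨y, X y⟩ : TangentBundle (𝓡 n) M)) x) :
    ContMDiffAt (𝓡 n) ((𝓡 n).prod 𝓘(ℝ, g)) ∞
      (fun y => (⟨y, D.nabla u y (X y)⟩ : TotalSpace g V)) x := by
  have : IsManifold (𝓡 n) 1 M := .of_le (n := ∞) (by simp)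
  have h1 := D.smooth.contMDiff.contMDiff (σ := u)
    (ContMDiff.contMDiffOn (n := ∞) hu)
  exact ContMDiffAt.clm_bundle_apply (E₁ := fun y : M => TangentSpace (𝓡 n) y) (E₂ := V)
    (b := fun y => y) (h1.contMDiffAt univ_mem) hX

theorem DeltaConnection.eventually_apply_nabla (D : DeltaConnection n g V) [e.IsLinear ℝ]
    (he : IsSmoothTriv n e) {x : M} (hx : x ∈ e.baseSet) {u : Π y, V y}
    (hu : IsSmoothSection n g u) {v : g} (huv : ∀ᶠ y in 𝓝 x, (e ⟨y, u y⟩).2 = v)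
    (hxc : x ∈ c.source) {X : Π y : M, TangentSpace (𝓡 n) y} {h : EuclideanSpace ℝ (Fin n)}
    (hX : ∀ᶠ y in 𝓝 x, X y = coordField c h y) :
    ∀ᶠ y in 𝓝 x, (e ⟨y, D.nabla u y (X y)⟩).2 = chartConnForm D.nabla e c (c y) h v := by
  filter_upwards [huv.eventually_nhds, e.open_baseSet.mem_nhds hx, c.open_source.mem_nhds hxc, hX]
    with y h1 h2 h3 h4
  rw [chartConnForm_apply, c.left_inv h3, apply_nabla_of_eventually_eq D.nabla he h2 hu h1, h4]

/-- In finite dimension it suffices to treat the entries, and these are local coordinates of `∇` of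
smooth sections along coordinate fields. -/
theorem DeltaConnection.contDiffOn_chartConnForm (D : DeltaConnection n g V) [e.IsLinear ℝ]
    (he : IsSmoothTriv n e) (hc : c ∈ atlas (EuclideanSpace ℝ (Fin n)) M) :
    ContDiffOn ℝ ∞ (chartConnForm D.nabla e c) (c.target ∩ c.symm ⁻¹' e.baseSet) := by
  rw [contDiffOn_clm_apply]
  intro h
  rw [contDiffOn_clm_apply]
  rintro v y ⟨hy, hye⟩
  have hxc : c.symm y ∈ c.source := c.map_target hy
  obtain ⟨u, hu, huv⟩ := he.exists_smooth_section hye v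
  have h1 := he.contMDiffAt_apply hye
    (D.isSmoothSection_nabla hu (contMDiffAt_coordField hc hxc h))
  have hs : ContMDiffAt (𝓡 n) (𝓡 n) ∞ c.symm y :=
    contMDiffAt_symm_of_mem_maximalAtlas (IsManifold.subset_maximalAtlas hc) hy
  have h2 := (contMDiffAt_iff_contDiffAt.1 (h1.comp y hs))
  refine (h2.congr_of_eventuallyEq ?_).contDiffWithinAt
  have h3 := (hs.continuousAt).eventually (D.eventually_apply_nabla he hye hu huv hxc
    (h := h) (X := coordField c h) (Eventually.of_forall fun _ => rfl))
  filter_upwards [h3, c.open_target.mem_nhds hy] with z h4 h5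
  rw [c.right_inv h5] at h4
  exact h4.symm

set_option synthInstance.maxHeartbeats 200000 in
/-- The curvature of a connection in a chart is inner. -/
theorem DeltaConnection.exists_curvature_eq (D : DeltaConnection n g V)
    (e : LieTrivialization n g V) (hc : c ∈ atlas (EuclideanSpace ℝ (Fin n)) M)
    {y : EuclideanSpace ℝ (Fin n)} (hy : y ∈ c.target) (hye : c.symm y ∈ e.toTriv.baseSet)
    (h k : EuclideanSpace ℝ (Fin n)) : ∃ X : g,
      fderiv ℝ (chartConnForm D.nabla e.toTriv c) y h k -
        fderiv ℝ (chartConnForm D.nabla e.toTriv c) y k h +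
        (chartConnForm D.nabla e.toTriv c y h * chartConnForm D.nabla e.toTriv c y k -
          chartConnForm D.nabla e.toTriv c y k * chartConnForm D.nabla e.toTriv c y h) =
      adCLM X := by
  obtain ⟨Ω, hΩ⟩ := D.curvature_inner
  obtain ⟨x, rfl⟩ : ∃ x, x = c.symm y := ⟨_, rfl⟩
  have he := e.isSmoothTriv
  set x := c.symm y with hxdef
  have hcx : c x = y := c.right_inv hy
  have hxc : x ∈ c.source := c.map_target hy
  obtain ⟨X, hX, hXh⟩ := IsSmoothVectorField.exists_eventuallyEq_coordField hc hxc h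
  obtain ⟨Y, hY, hYk⟩ := IsSmoothVectorField.exists_eventuallyEq_coordField hc hxc k
  refine ⟨(e.toTriv ⟨x, Ω.toFun x (X x) (Y x)⟩).2, ?_⟩
  set A := chartConnForm D.nabla e.toTriv c with hA
  have hAd : DifferentiableAt ℝ A y := ((D.contDiffOn_chartConnForm he hc).contDiffAt
    ((c.isOpen_inter_preimage_symm e.toTriv.open_baseSet).mem_nhds ⟨hy, hye⟩)).differentiableAt
      (by simp)
  have hcd : HasMFDerivAt (𝓡 n) (𝓡 n) c x (mfderiv (𝓡 n) (𝓡 n) c x) :=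
    ((contMDiffAt_of_mem_maximalAtlas (n := ∞) (IsManifold.subset_maximalAtlas hc)
      hxc).mdifferentiableAt (by simp)).hasMFDerivAt
  ext v
  obtain ⟨u, hu, huv⟩ := he.exists_smooth_section hye v
  -- Near `x` the section and the fields have constant coordinates, so `∇_Y u` has coordinates `A_k
  -- v`, and a second derivative gives `∂_h A_k v + A_h A_k v`. Antisymmetrizing gives the curvature
  -- matrix.
  have key : ∀ (h k : EuclideanSpace ℝ (Fin n)) (X Y : Π y : M, TangentSpace (𝓡 n) y),
      IsSmoothVectorField n Y → (∀ᶠ y in 𝓝 x, X y = coordField c h y) →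
      (∀ᶠ y in 𝓝 x, Y y = coordField c k y) →
      (e.toTriv ⟨x, D.nabla (fun z => D.nabla u z (Y z)) x (X x)⟩).2 =
        fderiv ℝ A y h k v + A y h (A y k v) := by
    intro h k X Y hY hXh hYk
    have h1 : IsSmoothSection n g (fun z => D.nabla u z (Y z)) := fun z =>
      D.isSmoothSection_nabla hu (hY z)
    have h2 := D.eventually_apply_nabla he hye hu huv hxc hYk
    rw [apply_nabla D.nabla he hye (h1.mdifferentiableAt x), h2.self_of_nhds, hcx,
      hXh.self_of_nhds, chartConnForm_apply]
    congr 1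
    have h3 : HasFDerivAt (fun z => A z k v) (((fderiv ℝ A y).flip k).flip v) (c x) := by
      rw [hcx]
      have := (hAd.hasFDerivAt.clm_apply (hasFDerivAt_const k y)).clm_apply (hasFDerivAt_const v y)
      simpa using this
    have h4 := (HasMFDerivAt.comp x h3.hasMFDerivAt hcd).congr_of_eventuallyEq h2
    simp only [mvfderiv]
    rw [h4.mfderiv]
    change fderiv ℝ A y (mfderiv (𝓡 n) (𝓡 n) c x (coordField c h x)) k v = _
    rw [mfderiv_coordField hc hxc]
  have h1 := hΩ X Y hX hY u hu x
  have hbr : VectorField.mlieBracket (𝓡 n) X Y x = 0 := by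
    rw [Filter.EventuallyEq.mlieBracket_vectorField_eq hXh hYk, mlieBracket_coordField hc hxc]
  simp only [curvature, hbr, map_zero, sub_zero] at h1
  have h2 := (e.toTriv.linear ℝ hye).map_sub (D.nabla (fun z => D.nabla u z (Y z)) x (X x))
    (D.nabla (fun z => D.nabla u z (X z)) x (Y x))
  rw [h1, e.map_lie x hye, huv.self_of_nhds, key h k X Y hY hXh hYk,
    key k h Y X hX hYk hXh] at h2
  rw [adCLM_apply, h2]
  simp only [add_apply, sub_apply, mul_apply_eq_comp]
  abel

end ChartConnectionForms

/-! ### Pull-back of matrix-valued forms -/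

section PullbackForm

variable {E : Type} [NormedAddCommGroup E] [NormedSpace ℝ E]
  {E' : Type*} [NormedAddCommGroup E'] [NormedSpace ℝ E']
  {A : Type*} [NormedRing A] [NormedAlgebra ℝ A] {a b : ℝ} {W : Set E} {O : Set E'}
  {C : E' → E' →L[ℝ] A} {G : ℝ × E → E'}

theorem contDiffOn_pullback_form (hab : a < b) (hW : IsOpen W) (hC : ContDiffOn ℝ ∞ C O)
    (hG : ContDiffOn ℝ ∞ G (Icc a b ×ˢ W)) (hGO : MapsTo G (Icc a b ×ˢ W) O) :
    ContDiffOn ℝ ∞ (fun p => (C (G p)).comp (fderivWithin ℝ G (Icc a b ×ˢ W) p))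
      (Icc a b ×ˢ W) :=
  (hC.comp hG hGO).clm_comp (hG.fderivWithin (uniqueDiffOn_Icc_prod hab hW) (by simp))

/-- The curvature of the pull-back of a matrix valued form. -/
theorem curvatureForm_pullback (hab : a < b) (hW : IsOpen W) (hO : IsOpen O)
    (hC : ContDiffOn ℝ ∞ C O) (hG : ContDiffOn ℝ ∞ G (Icc a b ×ˢ W))
    (hGO : MapsTo G (Icc a b ×ˢ W) O) {B : ℝ × E → ℝ × E →L[ℝ] A}
    (hB : ∀ p ∈ Icc a b ×ˢ W, B p = (C (G p)).comp (fderivWithin ℝ G (Icc a b ×ˢ W) p))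
    {p : ℝ × E} (hp : p ∈ Icc a b ×ˢ W) (h : E) :
    ∃ u w : E', curvatureForm B (Icc a b ×ˢ W) p h =
      fderiv ℝ C (G p) u w - fderiv ℝ C (G p) w u + (C (G p) u * C (G p) w - C (G p) w * C (G p) u)
      := by
  set S := Icc a b ×ˢ W with hS
  have hu := uniqueDiffOn_Icc_prod hab hW
  refine ⟨fderivWithin ℝ G S p (1, 0), fderivWithin ℝ G S p (0, h), ?_⟩
  have hd1 : HasFDerivWithinAt (fun q => C (G q)) ((fderiv ℝ C (G p)).comp (fderivWithin ℝ G S p))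
      S p :=
    HasFDerivAt.comp_hasFDerivWithinAt p
      ((hC.contDiffAt (hO.mem_nhds (hGO hp))).differentiableAt (by simp)).hasFDerivAt
      ((hG p hp).differentiableWithinAt (by simp)).hasFDerivWithinAt
  have hd2 : HasFDerivWithinAt (fderivWithin ℝ G S) (fderivWithin ℝ (fderivWithin ℝ G S) S p) S p :=
    (((hG.fderivWithin (m := ∞) hu (by simp)) p hp).differentiableWithinAt
      (by simp)).hasFDerivWithinAt
  -- Second derivatives are symmetric up to the boundary, because the box lies in the closure of its
  -- interior. This cancels the second-order terms of `G` below.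
  have hsymm : IsSymmSndFDerivWithinAt ℝ G S p := by
    refine (hG p hp).isSymmSndFDerivWithinAt (by simpa using two_le_infty) hu ?_ hp
    rw [hS, interior_prod_eq, closure_prod_eq, interior_Icc, closure_Ioo hab.ne, hW.interior_eq]
    exact ⟨hp.1, subset_closure hp.2⟩
  have hd := (hd1.clm_comp hd2).congr hB (hB p hp)
  rw [curvatureForm, hd.fderivWithin (hu p hp), hB p hp]
  simp only [add_apply, ContinuousLinearMap.comp_apply, ContinuousLinearMap.compL_apply,
    ContinuousLinearMap.flip_apply]
  rw [hsymm (1, 0) (0, h)]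
  abel

end PullbackForm

/-! ### Families of paths and boxes adapted to them -/

section Families

/-- Boxes `[a, b] × W` inside a neighbourhood in `[0, 1] × E`. -/
theorem exists_box_subset {E : Type*} [NormedAddCommGroup E] {N : Set (ℝ × E)}
    {t₀ : ℝ} {z₀ : E} (ht₀ : t₀ ∈ Icc (0 : ℝ) 1) (hN : N ∈ 𝓝[Icc 0 1 ×ˢ univ] (t₀, z₀)) {ε : ℝ}
    (hε : 0 < ε) : ∃ (a b : ℝ) (W : Set E), a < b ∧ b - a < ε ∧ Icc a b ⊆ Icc 0 1 ∧
      Icc a b ∈ 𝓝[Icc 0 1] t₀ ∧ IsOpen W ∧ z₀ ∈ W ∧ Icc a b ×ˢ W ⊆ N := by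
  rw [nhdsWithin_prod_eq, nhdsWithin_univ] at hN
  obtain ⟨T, hT, Z, hZ, hTZ⟩ := mem_prod_iff.1 hN
  obtain ⟨W, hWZ, hW, hzW⟩ := mem_nhds_iff.1 hZ
  obtain ⟨δ, hδ, hδT⟩ := Metric.mem_nhdsWithin_iff.1 hT
  obtain ⟨h0, h1⟩ := ht₀
  -- The bound `δ / 2` keeps the interval inside the given neighbourhood, and `ε / 3` makes its
  -- length less than `ε`. Clipping to `[0, 1]` leaves a relative neighbourhood of `t₀`, even at an
  -- endpoint.
  set η := min (min (δ / 2) (ε / 3)) (1 / 2) with hη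
  have hη0 : 0 < η := by positivity
  have hηδ : η < δ := lt_of_le_of_lt ((min_le_left _ _).trans (min_le_left _ _)) (by linarith)
  have hηε : η ≤ ε / 3 := (min_le_left _ _).trans (min_le_right _ _)
  have hη1 : η ≤ 1 / 2 := min_le_right _ _
  have hsub : Icc (max 0 (t₀ - η)) (min 1 (t₀ + η)) ⊆ Icc 0 1 := fun t ht =>
    ⟨(le_max_left _ _).trans ht.1, ht.2.trans (min_le_left _ _)⟩
  refine ⟨max 0 (t₀ - η), min 1 (t₀ + η), W, ?_, ?_, hsub, ?_, hW, hzW, ?_⟩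
  · rw [max_lt_iff, lt_min_iff, lt_min_iff]
    refine ⟨⟨by norm_num, by linarith⟩, by linarith, by linarith⟩
  · have := le_max_right 0 (t₀ - η)
    have := min_le_right 1 (t₀ + η)
    linarith
  · refine Metric.mem_nhdsWithin_iff.2 ⟨η, hη0, ?_⟩
    rintro t ⟨ht, ht0, ht1⟩
    rw [Metric.mem_ball, Real.dist_eq, abs_lt] at ht
    exact ⟨max_le ht0 (by linarith), le_min ht1 (by linarith)⟩
  · rintro ⟨t, z⟩ ⟨ht, hz⟩
    refine hTZ ⟨hδT ⟨?_, hsub ht⟩, hWZ hz⟩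
    have h2 := (le_max_right 0 (t₀ - η)).trans ht.1
    have h3 := ht.2.trans (min_le_right 1 (t₀ + η))
    rw [Metric.mem_ball, Real.dist_eq, abs_lt]
    constructor <;> linarith

variable {n : ℕ} {M : Type*} [TopologicalSpace M] [ChartedSpace (EuclideanSpace ℝ (Fin n)) M]
  [IsManifold (𝓡 n) ∞ M]
  {g : Type*} [NormedLieAlgebra g] [FiniteDimensional ℝ g]
  {V : M → Type*} [TopologicalSpace (TotalSpace g V)]
  [∀ x, LieRing (V x)] [∀ x, LieAlgebra ℝ (V x)] [∀ x, TopologicalSpace (V x)]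
  [∀ x, IsTopologicalAddGroup (V x)] [∀ x, ContinuousSMul ℝ (V x)]
  [FiberBundle g V] [VectorBundle ℝ g V] [ContMDiffVectorBundle ∞ g V (𝓡 n)]
  [T2Space M] {E : Type} [NormedAddCommGroup E] [NormedSpace ℝ E] {Γ : ℝ × E → M}

/-- The pull-back of the matrix of a connection along a family of paths `Γ`. -/
def familyForm (nabla : CovariantDerivative (𝓡 n) g V) (e : Trivialization g (π g V))
    (Γ : ℝ × E → M) (p : ℝ × E) : ℝ × E →L[ℝ] g →L[ℝ] g :=
  (connForm nabla e (Γ p)).comp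
    (show ℝ × E →L[ℝ] EuclideanSpace ℝ (Fin n) from
      mfderivWithin 𝓘(ℝ, ℝ × E) (𝓡 n) Γ (Icc 0 1 ×ˢ univ) p)

/-- Factoring through a chart reduces smoothness and curvature of the family form to the calculus of
pull-backs between normed spaces. -/
theorem familyForm_eq_pullback (nabla : CovariantDerivative (𝓡 n) g V)
    {e : Trivialization g (π g V)}
    (hΓ : ContMDiffOn 𝓘(ℝ, ℝ × E) (𝓡 n) ∞ Γ (Icc 0 1 ×ˢ univ))
    {c : OpenPartialHomeomorph M (EuclideanSpace ℝ (Fin n))}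
    (hc : c ∈ atlas (EuclideanSpace ℝ (Fin n)) M) {a b : ℝ} {W : Set E} (hab : a < b)
    (hI : Icc a b ⊆ Icc 0 1) (hW : IsOpen W) {p : ℝ × E} (hp : p ∈ Icc a b ×ˢ W)
    (hpc : Γ p ∈ c.source) :
    familyForm nabla e Γ p = (chartConnForm nabla e c (c (Γ p))).comp
      (fderivWithin ℝ (fun q => c (Γ q)) (Icc a b ×ˢ W) p) := by
  have h1 : HasMFDerivWithinAt 𝓘(ℝ, ℝ × E) (𝓡 n) Γ (Icc 0 1 ×ˢ univ) p
      (mfderivWithin 𝓘(ℝ, ℝ × E) (𝓡 n) Γ (Icc 0 1 ×ˢ univ) p) :=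
    ((hΓ p ⟨hI hp.1, mem_univ _⟩).mdifferentiableWithinAt (by simp)).hasMFDerivWithinAt
  have hcd : HasMFDerivAt (𝓡 n) (𝓡 n) c (Γ p) (mfderiv (𝓡 n) (𝓡 n) c (Γ p)) :=
    ((contMDiffAt_of_mem_maximalAtlas (n := ∞) (IsManifold.subset_maximalAtlas hc)
      hpc).mdifferentiableAt (by simp)).hasMFDerivAt
  have h2 := (hcd.comp_hasMFDerivWithinAt p h1).mono (prod_mono hI (subset_univ W))
  have h2' : HasFDerivWithinAt (fun q => c (Γ q))
      (show ℝ × E →L[ℝ] EuclideanSpace ℝ (Fin n) from (mfderiv (𝓡 n) (𝓡 n) c (Γ p)).comp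
        (mfderivWithin 𝓘(ℝ, ℝ × E) (𝓡 n) Γ (Icc 0 1 ×ˢ univ) p)) (Icc a b ×ˢ W) p :=
    hasMFDerivWithinAt_iff_hasFDerivWithinAt.1 h2
  have h3 := h2'.fderivWithin (uniqueDiffOn_Icc_prod hab hW p hp)
  refine ContinuousLinearMap.ext fun u => ?_
  rw [ContinuousLinearMap.comp_apply]
  have h4 : fderivWithin ℝ (fun q => c (Γ q)) (Icc a b ×ˢ W) p u =
    mfderiv (𝓡 n) (𝓡 n) c (Γ p) (mfderivWithin 𝓘(ℝ, ℝ × E) (𝓡 n) Γ (Icc 0 1 ×ˢ univ) p u) :=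
    congrArg (fun L => L u) h3
  exact (chartConnForm_mfderiv nabla hc hpc _).symm.trans
    (congrArg (chartConnForm nabla e c (c (Γ p))) h4.symm)

/-- A box `[a, b] × W` around `(t₀, z₀)` over which the family `Γ` of paths stays in the domain of a
trivialization, small enough for the equation of parallel transport to be solved on `[a, b]`. -/
structure IsGoodBox (D : DeltaConnection n g V) (e : LieTrivialization n g V) (Γ : ℝ × E → M)
    (a b : ℝ) (W : Set E) (K : ℝ) : Prop where
  lt : a < b
  subset : Icc a b ⊆ Icc 0 1
  isOpen : IsOpen W
  mem_baseSet : ∀ p ∈ Icc a b ×ˢ W, Γ p ∈ e.toTriv.baseSet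
  contDiffOn : ContDiffOn ℝ ∞ (familyForm D.nabla e.toTriv Γ) (Icc a b ×ˢ W)
  norm_le : ∀ p ∈ Icc a b ×ˢ W, ‖familyForm D.nabla e.toTriv Γ p (1, 0)‖ ≤ K
  mul_lt : K * (b - a) < 1
  curvature : ∀ p ∈ Icc a b ×ˢ W, ∀ h : E, ∃ X : g,
    curvatureForm (familyForm D.nabla e.toTriv Γ) (Icc a b ×ˢ W) p h = adCLM X

theorem DeltaConnection.familyForm_contDiffOn (D : DeltaConnection n g V)
    (e : LieTrivialization n g V) (hΓ : ContMDiffOn 𝓘(ℝ, ℝ × E) (𝓡 n) ∞ Γ (Icc 0 1 ×ˢ univ))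
    {c : OpenPartialHomeomorph M (EuclideanSpace ℝ (Fin n))}
    (hc : c ∈ atlas (EuclideanSpace ℝ (Fin n)) M) {a b : ℝ} {W : Set E} (hab : a < b)
    (hI : Icc a b ⊆ Icc 0 1) (hW : IsOpen W)
    (hS : ∀ p ∈ Icc a b ×ˢ W, Γ p ∈ c.source ∧ Γ p ∈ e.toTriv.baseSet) :
    ContDiffOn ℝ ∞ (familyForm D.nabla e.toTriv Γ) (Icc a b ×ˢ W) ∧
    ∀ p ∈ Icc a b ×ˢ W, ∀ h : E, ∃ X : g,
      curvatureForm (familyForm D.nabla e.toTriv Γ) (Icc a b ×ˢ W) p h = adCLM X := by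
  have hB := fun p (hp : p ∈ Icc a b ×ˢ W) =>
    familyForm_eq_pullback D.nabla (e := e.toTriv) hΓ hc hab hI hW hp (hS p hp).1
  have hO := c.isOpen_inter_preimage_symm e.toTriv.open_baseSet
  have hC := D.contDiffOn_chartConnForm e.isSmoothTriv hc
  have hG : ContDiffOn ℝ ∞ (fun q => c (Γ q)) (Icc a b ×ˢ W) :=
    contMDiffOn_iff_contDiffOn.1 ((contMDiffOn_of_mem_maximalAtlas
      (IsManifold.subset_maximalAtlas hc)).comp (hΓ.mono (prod_mono hI (subset_univ W)))
      fun p hp => (hS p hp).1)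
  have hGO : MapsTo (fun q => c (Γ q)) (Icc a b ×ˢ W)
      (c.target ∩ c.symm ⁻¹' e.toTriv.baseSet) := fun p hp =>
    ⟨c.map_source (hS p hp).1, by
      rw [mem_preimage, c.left_inv (hS p hp).1]; exact (hS p hp).2⟩
  refine ⟨(contDiffOn_pullback_form hab hW hC hG hGO).congr hB, fun p hp h => ?_⟩
  obtain ⟨u, w, huw⟩ := curvatureForm_pullback hab hW hO hC hG hGO hB hp h
  rw [huw]
  exact D.exists_curvature_eq e hc (hGO hp).1 (hGO hp).2 u w

theorem DeltaConnection.exists_isGoodBox (D : DeltaConnection n g V)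
    (e : LieTrivialization n g V) (hΓ : ContMDiffOn 𝓘(ℝ, ℝ × E) (𝓡 n) ∞ Γ (Icc 0 1 ×ˢ univ))
    {t₀ : ℝ} (ht₀ : t₀ ∈ Icc (0 : ℝ) 1) {z₀ : E} (he : Γ (t₀, z₀) ∈ e.toTriv.baseSet) :
    ∃ a b W K, IsGoodBox D e Γ a b W K ∧ Icc a b ∈ 𝓝[Icc 0 1] t₀ ∧ z₀ ∈ W := by
  set c := chartAt (EuclideanSpace ℝ (Fin n)) (Γ (t₀, z₀)) with hcdef
  have hc : c ∈ atlas (EuclideanSpace ℝ (Fin n)) M := chart_mem_atlas _ _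
  have hN : {p | Γ p ∈ c.source ∧ Γ p ∈ e.toTriv.baseSet} ∈ 𝓝[Icc 0 1 ×ˢ univ] (t₀, z₀) :=
    (hΓ (t₀, z₀) ⟨ht₀, mem_univ _⟩).continuousWithinAt.preimage_mem_nhdsWithin
      ((c.open_source.inter e.toTriv.open_baseSet).mem_nhds
        ⟨mem_chart_source _ _, he⟩)
  obtain ⟨a, b, W, hab, -, hI, hIt, hW, hzW, hS⟩ := exists_box_subset ht₀ hN one_pos
  have h1 := (D.familyForm_contDiffOn e hΓ hc hab hI hW hS).1
  have ht₀ab : t₀ ∈ Icc a b := mem_of_mem_nhdsWithin ht₀ hIt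
  set K := ‖familyForm D.nabla e.toTriv Γ (t₀, z₀) (1, 0)‖ + 1 with hK
  have hK0 : 0 < K := by positivity
  have hSn : Icc a b ×ˢ W ∈ 𝓝[Icc 0 1 ×ˢ univ] (t₀, z₀) := by
    rw [nhdsWithin_prod_eq, nhdsWithin_univ]
    exact prod_mem_prod hIt (hW.mem_nhds hzW)
  have h2 : {p | ‖familyForm D.nabla e.toTriv Γ p (1, 0)‖ < K} ∈
      𝓝[Icc 0 1 ×ˢ univ] (t₀, z₀) := by
    have h3 : ContinuousWithinAt (fun p => ‖familyForm D.nabla e.toTriv Γ p (1, 0)‖)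
        (Icc 0 1 ×ˢ univ) (t₀, z₀) :=
      (((h1.continuousOn (t₀, z₀) ⟨ht₀ab, hzW⟩).mono_of_mem_nhdsWithin hSn).clm_apply
        continuousWithinAt_const).norm
    exact h3.eventually (gt_mem_nhds (by rw [hK]; linarith))
  -- The first box provides continuity, hence a local bound `K`; only then can a second box of
  -- length less than `1 / K` be chosen.
  obtain ⟨a', b', W', hab', hlt, hI', hIt', hW', hzW', hS'⟩ :=
    exists_box_subset ht₀ (inter_mem hN h2) (inv_pos.2 hK0)
  have h3 := D.familyForm_contDiffOn e hΓ hc hab' hI' hW' fun p hp => (hS' hp).1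
  refine ⟨a', b', W', K, ⟨hab', hI', hW', fun p hp => (hS' hp).1.2, h3.1,
    fun p hp => le_of_lt (hS' hp).2, ?_, h3.2⟩, hIt', hzW'⟩
  calc K * (b' - a') < K * K⁻¹ := by gcongr
    _ = 1 := mul_inv_cancel₀ hK0.ne'

end Families

/-! ### Parallel sections along a path -/

section ParallelSections

variable {n : ℕ} {M : Type*} [TopologicalSpace M] [ChartedSpace (EuclideanSpace ℝ (Fin n)) M]
  [IsManifold (𝓡 n) ∞ M]
  {g : Type*} [NormedLieAlgebra g] [FiniteDimensional ℝ g]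
  {V : M → Type*} [TopologicalSpace (TotalSpace g V)]
  [∀ x, LieRing (V x)] [∀ x, LieAlgebra ℝ (V x)] [∀ x, TopologicalSpace (V x)]
  [∀ x, IsTopologicalAddGroup (V x)] [∀ x, ContinuousSMul ℝ (V x)]
  [FiberBundle g V] [VectorBundle ℝ g V] [ContMDiffVectorBundle ∞ g V (𝓡 n)]
  {γ : ℝ → M} {t : ℝ} {s : Set ℝ}

/-- The velocity of a path `γ : [0, 1] → M`. -/
def velocity (γ : ℝ → M) (t : ℝ) : TangentSpace (𝓡 n) (γ t) :=
  mfderivWithin 𝓘(ℝ, ℝ) (𝓡 n) γ (Icc 0 1) t (1 : ℝ)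

theorem uniqueMDiffWithinAt_Icc (ht : t ∈ Icc (0 : ℝ) 1) :
    UniqueMDiffWithinAt 𝓘(ℝ, ℝ) (Icc (0 : ℝ) 1) t :=
  (uniqueDiffOn_Icc one_pos t ht).uniqueMDiffWithinAt

theorem velocity_family {E : Type} [NormedAddCommGroup E] [NormedSpace ℝ E] {Γ : ℝ × E → M}
    (hΓ : ContMDiffOn 𝓘(ℝ, ℝ × E) (𝓡 n) ∞ Γ (Icc 0 1 ×ˢ univ)) (ht : t ∈ Icc (0 : ℝ) 1) (z : E) :
    velocity (fun t => Γ (t, z)) t =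
      mfderivWithin 𝓘(ℝ, ℝ × E) (𝓡 n) Γ (Icc 0 1 ×ˢ univ) (t, z) (1, 0) := by
  have h1 : HasMFDerivWithinAt 𝓘(ℝ, ℝ × E) (𝓡 n) Γ (Icc 0 1 ×ˢ univ) (t, z)
      (mfderivWithin 𝓘(ℝ, ℝ × E) (𝓡 n) Γ (Icc 0 1 ×ˢ univ) (t, z)) :=
    ((hΓ (t, z) ⟨ht, mem_univ _⟩).mdifferentiableWithinAt (by simp)).hasMFDerivWithinAt
  have h2 : HasMFDerivWithinAt 𝓘(ℝ, ℝ) 𝓘(ℝ, ℝ × E) (fun t : ℝ => (t, z)) (Icc 0 1) t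
      (ContinuousLinearMap.inl ℝ ℝ E) :=
    (hasFDerivAt_prodMk_left t z).hasFDerivWithinAt.hasMFDerivWithinAt
  have hsub : Icc (0 : ℝ) 1 ⊆ (fun t : ℝ => (t, z)) ⁻¹' (Icc (0 : ℝ) 1 ×ˢ (univ : Set E)) :=
    fun r hr => ⟨hr, mem_univ _⟩
  have h3 := (HasMFDerivWithinAt.comp t h1 h2 hsub).mfderivWithin (uniqueMDiffWithinAt_Icc ht)
  exact congrArg (fun L : ℝ →L[ℝ] EuclideanSpace ℝ (Fin n) => L 1) h3

/-- The inhomogeneous term in the gauge change of the connection matrix cancels the derivative of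
the coordinate change, so the equation of parallel transport may be checked in any one smooth linear
trivialization. -/
theorem hasDerivWithinAt_coordinates_change (nabla : CovariantDerivative (𝓡 n) g V)
    {e e' : Trivialization g (π g V)} [e.IsLinear ℝ] [e'.IsLinear ℝ] (he : IsSmoothTriv n e)
    (he' : IsSmoothTriv n e') (hγ : MDifferentiableWithinAt 𝓘(ℝ, ℝ) (𝓡 n) γ (Icc 0 1) t)
    (hs : s ⊆ Icc 0 1) (hx : γ t ∈ e.baseSet) (hx' : γ t ∈ e'.baseSet) (hts : t ∈ s)
    {w : Π t, V (γ t)}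
    (h : HasDerivWithinAt (fun r => (e ⟨γ r, w r⟩).2)
      (-connForm nabla e (γ t) (velocity γ t) (e ⟨γ t, w t⟩).2) s t) :
    HasDerivWithinAt (fun r => (e' ⟨γ r, w r⟩).2)
      (-connForm nabla e' (γ t) (velocity γ t) (e' ⟨γ t, w t⟩).2) s t := by
  have hτ := ((he.contMDiffAt_coordChangeL he' hx hx').mdifferentiableAt
    (by simp)).hasMFDerivAt
  have h1 : HasFDerivWithinAt (fun r => (e.coordChangeL ℝ e' (γ r) : g →L[ℝ] g))
      (show ℝ →L[ℝ] (g →L[ℝ] g) from (mfderiv (𝓡 n) 𝓘(ℝ, g →L[ℝ] g)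
        (fun y => (e.coordChangeL ℝ e' y : g →L[ℝ] g)) (γ t)).comp
          (mfderivWithin 𝓘(ℝ, ℝ) (𝓡 n) γ (Icc 0 1) t)) (Icc 0 1) t :=
    hasMFDerivWithinAt_iff_hasFDerivWithinAt.1
      (hτ.comp_hasMFDerivWithinAt t hγ.hasMFDerivWithinAt)
  have h2 : HasDerivWithinAt (fun r => (e.coordChangeL ℝ e' (γ r) : g →L[ℝ] g))
      (mvfderiv (𝓡 n) (fun y => (e.coordChangeL ℝ e' y : g →L[ℝ] g)) (γ t) (velocity γ t))
      s t := (h1.hasDerivWithinAt).mono hs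
  have h3 := h2.clm_apply h
  have h4 := congrArg (fun L : g →L[ℝ] g => L (e ⟨γ t, w t⟩).2)
    (coordChangeL_connForm nabla he he' hx hx' (velocity γ t))
  have h5 := coordChangeL_apply_apply (e := e) (e' := e') hx hx' (w t)
  have hev : ∀ᶠ r in 𝓝[s] t, γ r ∈ e.baseSet ∩ e'.baseSet :=
    (hγ.continuousWithinAt.mono hs).eventually
      ((e.open_baseSet.inter e'.open_baseSet).mem_nhds ⟨hx, hx'⟩)
  refine (h3.congr_of_eventuallyEq_of_mem (f₁ := fun r => (e' ⟨γ r, w r⟩).2) ?_ hts).congr_deriv ?_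
  · filter_upwards [hev] with r hr
    exact (coordChangeL_apply_apply hr.1 hr.2 (w r)).symm
  · simp only [add_apply, mul_apply_eq_comp] at h4
    rw [map_neg, h4, ← h5]
    simp

/-- A section `w` along a path `γ` is parallel on `s`, in coordinates. -/
def ParallelOn (nabla : CovariantDerivative (𝓡 n) g V) (γ : ℝ → M) (w : Π t, V (γ t))
    (s : Set ℝ) : Prop :=
  ∀ t ∈ s, ∀ e : LieTrivialization n g V, γ t ∈ e.toTriv.baseSet →
    HasDerivWithinAt (fun r => (e.toTriv ⟨γ r, w r⟩).2)
      (-connForm nabla e.toTriv (γ t) (velocity γ t) (e.toTriv ⟨γ t, w t⟩).2) s t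

variable {nabla : CovariantDerivative (𝓡 n) g V} {w w' : Π t, V (γ t)}

theorem ParallelOn.mono (h : ParallelOn nabla γ w s) {s' : Set ℝ} (hs : s' ⊆ s) :
    ParallelOn nabla γ w s' := fun t ht e he => (h t (hs ht) e he).mono hs

theorem ParallelOn.glue {a b c : ℝ} (hab : a ≤ b) (hbc : b ≤ c)
    (h : ParallelOn nabla γ w (Icc a b)) (h' : ParallelOn nabla γ w' (Icc b c))
    (hw : w b = w' b) :
    ParallelOn nabla γ (fun r => if r ≤ b then w r else w' r) (Icc a c) := by
  obtain ⟨u, hu⟩ : ∃ u : Π r, V (γ r), u = fun r => if r ≤ b then w r else w' r := ⟨_, rfl⟩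
  have h1 : ∀ r ∈ Icc a b, u r = w r := fun r hr => by rw [hu]; exact if_pos hr.2
  have h2 : ∀ r ∈ Icc b c, u r = w' r := by
    intro r hr
    rw [hu]
    by_cases hrb : r ≤ b
    · obtain rfl : b = r := le_antisymm hr.1 hrb
      exact (if_pos hrb).trans hw
    · exact if_neg hrb
  rw [← hu]
  intro t ht e he
  rw [← Icc_union_Icc_eq_Icc hab hbc]
  refine HasDerivWithinAt.union ?_ ?_
  · by_cases htb : t ∈ Icc a b
    · rw [h1 t htb]
      exact (h t htb e he).congr (fun r hr => by rw [h1 r hr]) (by rw [h1 t htb])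
    -- Off the closed piece there is no condition: every value is a derivative within it.
    · exact HasFDerivWithinAt.of_notMem_closure (by rwa [isClosed_Icc.closure_eq])
  · by_cases htb : t ∈ Icc b c
    · rw [h2 t htb]
      exact (h' t htb e he).congr (fun r hr => by rw [h2 r hr]) (by rw [h2 t htb])
    · exact HasFDerivWithinAt.of_notMem_closure (by rwa [isClosed_Icc.closure_eq])

theorem ParallelOn.combine (hγ : ContinuousOn γ (Icc 0 1)) (hs : s ⊆ Icc 0 1)
    (h : ParallelOn nabla γ w s) (h' : ParallelOn nabla γ w' s) (k l : ℝ) :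
    ParallelOn nabla γ (fun t => k • w t + l • w' t) s := by
  intro t ht e he
  have hlin : ∀ r, γ r ∈ e.toTriv.baseSet → (e.toTriv ⟨γ r, k • w r + l • w' r⟩).2 =
      k • (e.toTriv ⟨γ r, w r⟩).2 + l • (e.toTriv ⟨γ r, w' r⟩).2 := by
    intro r hr
    have hl := e.toTriv.linear ℝ hr
    have h1 := hl.map_add (k • w r) (l • w' r)
    have h2 := hl.map_smul k (w r)
    have h3 := hl.map_smul l (w' r)
    rw [h1, h2, h3]
  have hev : ∀ᶠ r in 𝓝[s] t, γ r ∈ e.toTriv.baseSet :=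
    ((hγ t (hs ht)).mono hs).eventually (e.toTriv.open_baseSet.mem_nhds he)
  refine ((((h t ht e he).const_smul k).add ((h' t ht e he).const_smul
    l)).congr_of_eventuallyEq_of_mem (hev.mono fun r hr => hlin r hr) ht).congr_deriv ?_
  rw [hlin t he]
  simp only [map_add, map_smul, smul_neg, neg_add]

/-- The connection matrix acts by derivations, so the bracket of two solutions is again a solution.
-/
theorem DeltaConnection.parallelOn_lie [T2Space M] (D : DeltaConnection n g V)
    (hL : IsLieAlgebraBundle n g V) (hγ : ContinuousOn γ (Icc 0 1)) (hs : s ⊆ Icc 0 1)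
    (h : ParallelOn D.nabla γ w s) (h' : ParallelOn D.nabla γ w' s) :
    ParallelOn D.nabla γ (fun t => ⁅w t, w' t⁆) s := by
  intro t ht e he
  have hev : ∀ᶠ r in 𝓝[s] t, γ r ∈ e.toTriv.baseSet :=
    ((hγ t (hs ht)).mono hs).eventually (e.toTriv.open_baseSet.mem_nhds he)
  refine ((hasDerivWithinAt_lie (h t ht e he) (h' t ht e he)).congr_of_eventuallyEq_of_mem
    (hev.mono fun r hr => e.map_lie (γ r) hr (w r) (w' r)) ht).congr_deriv ?_
  rw [e.map_lie (γ t) he, D.connForm_lie hL e he]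
  simp only [neg_lie, lie_neg, neg_add]

variable [T2Space M]

/-- Around each parameter of a path there is an interval on which the equation of parallel transport
is a linear differential equation with continuous and small coefficients. -/
theorem DeltaConnection.exists_path_interval (D : DeltaConnection n g V)
    (hL : IsLieAlgebraBundle n g V) (hγ : ContMDiffOn 𝓘(ℝ, ℝ) (𝓡 n) ∞ γ (Icc 0 1))
    (ht : t ∈ Icc (0 : ℝ) 1) : ∃ (e : LieTrivialization n g V) (a b K : ℝ),
      Icc a b ⊆ Icc 0 1 ∧ Icc a b ∈ 𝓝[Icc 0 1] t ∧
      (∀ r ∈ Icc a b, γ r ∈ e.toTriv.baseSet) ∧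
      ContinuousOn (fun r => connForm D.nabla e.toTriv (γ r) (velocity γ r)) (Icc a b) ∧
      (∀ r ∈ Icc a b, ‖connForm D.nabla e.toTriv (γ r) (velocity γ r)‖ ≤ K) ∧
      K * (b - a) < 1 := by
  obtain ⟨e, he⟩ := hL (γ t)
  -- A single path is treated as a family with an idle real parameter.
  have hΓ : ContMDiffOn 𝓘(ℝ, ℝ × ℝ) (𝓡 n) ∞ (fun p : ℝ × ℝ => γ p.1) (Icc 0 1 ×ˢ univ) :=
    hγ.comp (contMDiff_iff_contDiff.2 contDiff_fst).contMDiffOn fun p hp => hp.1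
  obtain ⟨a, b, W, K, hB, hab, hW⟩ := D.exists_isGoodBox e hΓ ht (z₀ := 0) he
  have hv : ∀ r ∈ Icc a b, familyForm D.nabla e.toTriv (fun p : ℝ × ℝ => γ p.1) (r, 0) (1, 0) =
      connForm D.nabla e.toTriv (γ r) (velocity γ r) := fun r hr =>
    congrArg (connForm D.nabla e.toTriv (γ r)) (velocity_family hΓ (hB.subset hr) 0).symm
  refine ⟨e, a, b, K, hB.subset, hab, fun r hr => hB.mem_baseSet (r, 0) ⟨hr, hW⟩, ?_, ?_, hB.mul_lt⟩
  · have h1 : ContinuousOn (fun r => familyForm D.nabla e.toTriv (fun p : ℝ × ℝ => γ p.1) (r, 0)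
        (1, 0)) (Icc a b) :=
      (hB.contDiffOn.continuousOn.comp (by fun_prop : ContinuousOn (fun r : ℝ => (r, (0 : ℝ)))
        (Icc a b)) fun r hr => ⟨hr, hW⟩).clm_apply continuousOn_const
    exact h1.congr fun r hr => (hv r hr).symm
  · intro r hr
    rw [← hv r hr]
    exact hB.norm_le (r, 0) ⟨hr, hW⟩

/-- Continuation along `[0, 1]` by connectedness: local propagation between any two parameters
replaces a separate open-and-closed argument. It serves for uniqueness, for existence, and for
transported frames. -/
theorem forall_Icc_of_locally {P : ℝ → Prop}
    (h : ∀ t ∈ Icc (0 : ℝ) 1, ∃ a b, Icc a b ∈ 𝓝[Icc 0 1] t ∧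
      ∀ r ∈ Icc a b, ∀ s ∈ Icc a b, P r → P s)
    {t₁ : ℝ} (ht₁ : t₁ ∈ Icc (0 : ℝ) 1) (hP : P t₁) : ∀ t ∈ Icc (0 : ℝ) 1, P t := by
  intro t ht
  refine isPreconnected_Icc.induction₂' (fun r s => P r → P s) (fun x hx => ?_)
    (fun _ _ _ _ _ _ h1 h2 h3 => h2 (h1 h3)) ht₁ ht hP
  obtain ⟨a, b, hab, h1⟩ := h x hx
  filter_upwards [hab] with y hy
  have hx' := mem_of_mem_nhdsWithin hx hab
  exact ⟨h1 x hx' y hy, h1 y hy x hx'⟩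

theorem DeltaConnection.parallelOn_unique (D : DeltaConnection n g V)
    (hL : IsLieAlgebraBundle n g V) (hγ : ContMDiffOn 𝓘(ℝ, ℝ) (𝓡 n) ∞ γ (Icc 0 1))
    (h : ParallelOn D.nabla γ w (Icc 0 1)) (h' : ParallelOn D.nabla γ w' (Icc 0 1)) {t₁ : ℝ}
    (ht₁ : t₁ ∈ Icc (0 : ℝ) 1) (hw : w t₁ = w' t₁) : ∀ t ∈ Icc (0 : ℝ) 1, w t = w' t := by
  refine forall_Icc_of_locally (fun t ht => ?_) ht₁ hw
  obtain ⟨e, a, b, K, hI, hab, he, -, hK, -⟩ := D.exists_path_interval hL hγ ht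
  refine ⟨a, b, hab, fun r hr s hs hrw => ?_⟩
  have key := linearODE_unique (a := a) (b := b) (K := K)
    (X := fun t v => -connForm D.nabla e.toTriv (γ t) (velocity γ t) v)
    (fun t ht v w => by
      rw [← neg_sub', norm_neg, ← map_sub]
      exact ((connForm D.nabla e.toTriv (γ t) (velocity γ t)).le_opNorm _).trans
        (mul_le_mul_of_nonneg_right (hK t ht) (norm_nonneg _)))
    (fun t ht => (h.mono hI) t ht e (he t ht)) (fun t ht => (h'.mono hI) t ht e (he t ht))
    hr (by simp only [hrw])
  have h1 := key hs
  exact (e.fibreInv (γ s) (he s hs)).injective h1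

theorem ParallelOn.of_exists (hγ : ContMDiffOn 𝓘(ℝ, ℝ) (𝓡 n) ∞ γ (Icc 0 1)) (hs : s ⊆ Icc 0 1)
    (h : ∀ t ∈ s, ∃ e : Trivialization g (π g V), e.IsLinear ℝ ∧ IsSmoothTriv n e ∧
      γ t ∈ e.baseSet ∧ HasDerivWithinAt (fun r => (e ⟨γ r, w r⟩).2)
        (-connForm nabla e (γ t) (velocity γ t) (e ⟨γ t, w t⟩).2) s t) :
    ParallelOn nabla γ w s := by
  intro t ht e' he'
  obtain ⟨e, hlin, he, hx, h1⟩ := h t ht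
  exact hasDerivWithinAt_coordinates_change nabla he e'.isSmoothTriv
    ((hγ t (hs ht)).mdifferentiableWithinAt (by simp)) hs hx he' ht h1

theorem DeltaConnection.exists_parallelOn_interval (D : DeltaConnection n g V)
    (e : LieTrivialization n g V) (hγ : ContMDiffOn 𝓘(ℝ, ℝ) (𝓡 n) ∞ γ (Icc 0 1))
    {a b K : ℝ} (hI : Icc a b ⊆ Icc 0 1) (he : ∀ r ∈ Icc a b, γ r ∈ e.toTriv.baseSet)
    (hc : ContinuousOn (fun r => connForm D.nabla e.toTriv (γ r) (velocity γ r)) (Icc a b))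
    (hK : ∀ r ∈ Icc a b, ‖connForm D.nabla e.toTriv (γ r) (velocity γ r)‖ ≤ K)
    (hKab : K * (b - a) < 1) (ht : t ∈ Icc a b) (v : V (γ t)) :
    ∃ w : Π r, V (γ r), w t = v ∧ ParallelOn D.nabla γ w (Icc a b) := by
  -- The matrix equation is solved with value `1` at `t`; applying the solution to a vector gives
  -- the section.
  obtain ⟨y, hy1, hy⟩ := exists_linearODE_solution (t₁ := (⟨t, ht⟩ : Icc a b))
    (X := IccMap.mk (fun r : Icc a b => -connForm D.nabla e.toTriv (γ r) (velocity γ r))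
      (continuousOn_iff_continuous_domRestrict.1 hc).neg) (K := K)
    (fun r => by
      change ‖-connForm D.nabla e.toTriv (γ r) (velocity γ r)‖ ≤ K
      rw [norm_neg]; exact hK r r.2) hKab (1 : g →L[ℝ] g)
  refine ⟨fun r => e.toTriv.symm (γ r) (y r (e.toTriv ⟨γ t, v⟩).2), ?_, ?_⟩
  · change e.toTriv.symm (γ t) (y t (e.toTriv ⟨γ t, v⟩).2) = v
    simp only at hy1
    rw [hy1]
    exact e.toTriv.symm_apply_apply_mk (he t ht) v
  · refine ParallelOn.of_exists hγ hI fun r hr => ⟨e.toTriv, inferInstance, e.isSmoothTriv,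
      he r hr, ?_⟩
    have h1 : ∀ r ∈ Icc a b, (e.toTriv ⟨γ r, e.toTriv.symm (γ r)
        (y r (e.toTriv ⟨γ t, v⟩).2)⟩).2 = y r (e.toTriv ⟨γ t, v⟩).2 := fun r hr => by
      rw [e.toTriv.apply_mk_symm (he r hr)]
    rw [h1 r hr]
    have h2 := (hy ⟨r, hr⟩).clm_apply (hasDerivWithinAt_const r (Icc a b) (e.toTriv ⟨γ t, v⟩).2)
    refine (h2.congr h1 (h1 r hr)).congr_deriv ?_
    simp only [map_zero, add_zero]
    rfl

theorem DeltaConnection.exists_parallelOn (D : DeltaConnection n g V)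
    (hL : IsLieAlgebraBundle n g V) (hγ : ContMDiffOn 𝓘(ℝ, ℝ) (𝓡 n) ∞ γ (Icc 0 1))
    (v : V (γ 0)) : ∃ w : Π r, V (γ r), w 0 = v ∧ ParallelOn D.nabla γ w (Icc 0 1) := by
  -- The propagated property is existence up to `τ`: a smaller endpoint is reached by restriction, a
  -- larger one by gluing on a local solution.
  refine forall_Icc_of_locally (P := fun τ => 0 ≤ τ → ∃ w : Π r, V (γ r), w 0 = v ∧
    ParallelOn D.nabla γ w (Icc 0 τ)) (fun t ht => ?_) (left_mem_Icc.2 zero_le_one) (fun _ => ?_) 1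
    (right_mem_Icc.2 zero_le_one) zero_le_one
  · obtain ⟨e, a, b, K, hI, hab, he, hc, hK, hKab⟩ := D.exists_path_interval hL hγ ht
    refine ⟨a, b, hab, fun r hr s hs hR hs0 => ?_⟩
    have hr0 : 0 ≤ r := (hI hr).1
    obtain ⟨w, hw0, hw⟩ := hR hr0
    rcases le_total s r with hsr | hrs
    · exact ⟨w, hw0, hw.mono (Icc_subset_Icc_right hsr)⟩
    · obtain ⟨w', hw'r, hw'⟩ := D.exists_parallelOn_interval e hγ hI he hc hK hKab hr (w r)
      refine ⟨_, ?_, hw.glue hr0 hrs (hw'.mono (Icc_subset_Icc hr.1 hs.2)) hw'r.symm⟩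
      rw [if_pos hr0, hw0]
  · obtain ⟨e, a, b, K, hI, hab, he, hc, hK, hKab⟩ := D.exists_path_interval hL hγ
      (left_mem_Icc.2 zero_le_one)
    have h0 := mem_of_mem_nhdsWithin (left_mem_Icc.2 zero_le_one) hab
    obtain ⟨w, hw0, hw⟩ := D.exists_parallelOn_interval e hγ hI he hc hK hKab h0 v
    refine ⟨w, hw0, hw.mono ?_⟩
    rw [Icc_self]
    exact singleton_subset_iff.2 h0

end ParallelSections

/-! ### Parallel transport as a Lie algebra isomorphism -/

section ParallelTransport

variable {n : ℕ} {M : Type*} [TopologicalSpace M] [ChartedSpace (EuclideanSpace ℝ (Fin n)) M]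
  [IsManifold (𝓡 n) ∞ M]
  {g : Type*} [NormedLieAlgebra g] [FiniteDimensional ℝ g]
  {V : M → Type*} [TopologicalSpace (TotalSpace g V)]
  [∀ x, LieRing (V x)] [∀ x, LieAlgebra ℝ (V x)] [∀ x, TopologicalSpace (V x)]
  [∀ x, IsTopologicalAddGroup (V x)] [∀ x, ContinuousSMul ℝ (V x)]
  [FiberBundle g V] [VectorBundle ℝ g V] [ContMDiffVectorBundle ∞ g V (𝓡 n)]
  [T2Space M] {γ : ℝ → M} {nabla : CovariantDerivative (𝓡 n) g V}

theorem ParallelOn.congr {w w' : Π t, V (γ t)} {s : Set ℝ} (h : ParallelOn nabla γ w s)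
    (hw : ∀ t ∈ s, w' t = w t) : ParallelOn nabla γ w' s := by
  intro t ht e he
  rw [hw t ht]
  exact (h t ht e he).congr (fun r hr => by rw [hw r hr]) (by rw [hw t ht])

theorem symm_add_nabla_eq_zero_iff {e : Trivialization g (π g V)} [e.IsLinear ℝ]
    (he : IsSmoothTriv n e) {x : M} (hx : x ∈ e.baseSet) (a : TangentSpace (𝓡 n) x) (d v : g) :
    e.symm x d + nabla (fun y => e.symm y v) x a = 0 ↔ d = -connForm nabla e x a v := by
  have h1 : nabla (fun y => e.symm y v) x a = e.symm x (connForm nabla e x a v) := by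
    rw [connForm_apply nabla he hx, e.symm_apply_apply_mk hx]
  rw [h1, ← e.coe_symmₗ (R := ℝ) hx, ← map_add, eq_neg_iff_add_eq_zero]
  refine ⟨fun h => ?_, fun h => by rw [h, map_zero]⟩
  have h2 := congrArg (e.linearMapAt ℝ x) h
  rwa [e.linearMapAt_symmₗ hx, map_zero] at h2

theorem ParallelOn.isParallelAlong (hL : IsLieAlgebraBundle n g V)
    (hγ : ContMDiffOn 𝓘(ℝ, ℝ) (𝓡 n) ∞ γ (Icc 0 1)) {w : Π t, V (γ t)}
    (h : ParallelOn nabla γ w (Icc 0 1)) :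
    IsParallelAlong nabla γ (fun t => ⟨γ t, w t⟩) := by
  intro t ht
  refine ⟨rfl, _, ?_, (symm_add_nabla_eq_zero_iff (isSmoothTriv_trivializationAt (γ t))
    (FiberBundle.mem_baseSet_trivializationAt g V (γ t)) _ _ _).2 rfl⟩
  obtain ⟨e, he⟩ := hL (γ t)
  exact hasDerivWithinAt_coordinates_change nabla e.isSmoothTriv
    (isSmoothTriv_trivializationAt (γ t)) ((hγ t ht).mdifferentiableWithinAt (by simp)) subset_rfl
    he (FiberBundle.mem_baseSet_trivializationAt g V (γ t)) ht (h t ht e he)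

theorem IsParallelAlong.exists_parallelOn (hγ : ContMDiffOn 𝓘(ℝ, ℝ) (𝓡 n) ∞ γ (Icc 0 1))
    {u : ℝ → TotalSpace g V} (h : IsParallelAlong nabla γ u) :
    ∃ w : Π t, V (γ t), (∀ t ∈ Icc (0 : ℝ) 1, u t = ⟨γ t, w t⟩) ∧
      ParallelOn nabla γ w (Icc 0 1) := by
  have hex : ∀ t, ∃ w : V (γ t), t ∈ Icc (0 : ℝ) 1 → u t = ⟨γ t, w⟩ := by
    intro t
    by_cases ht : t ∈ Icc (0 : ℝ) 1
    · have h1 := (h t ht).1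
      rcases hu : u t with ⟨x, v⟩
      rw [hu] at h1
      obtain rfl : x = γ t := h1
      exact ⟨v, fun _ => rfl⟩
    -- Outside `[0, 1]` the given curve need not lie over `γ`.
    · exact ⟨0, fun h => absurd h ht⟩
  choose w hw using hex
  refine ⟨w, hw, ParallelOn.of_exists hγ subset_rfl fun t ht =>
    ⟨trivializationAt g V (γ t), inferInstance, isSmoothTriv_trivializationAt (γ t),
      FiberBundle.mem_baseSet_trivializationAt g V (γ t), ?_⟩⟩
  obtain ⟨-, d, hd, hd0⟩ := h t ht
  have h2 := (symm_add_nabla_eq_zero_iff (isSmoothTriv_trivializationAt (γ t))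
    (FiberBundle.mem_baseSet_trivializationAt g V (γ t)) _ _ _).1 hd0
  rw [h2, hw t ht] at hd
  exact hd.congr (fun r hr => by rw [hw r hr]) (by rw [hw t ht])

theorem IsLieAlgebraBundle.exists_lieEquiv (hL : IsLieAlgebraBundle n g V) (x : M) :
    Nonempty (g ≃ₗ⁅ℝ⁆ V x) := by
  obtain ⟨e, he⟩ := hL x
  exact ⟨e.fibreMap x he⟩

/-- Parallel transport of a frame along a path. -/
theorem DeltaConnection.exists_transport (D : DeltaConnection n g V)
    (hL : IsLieAlgebraBundle n g V) (hγ : ContMDiffOn 𝓘(ℝ, ℝ) (𝓡 n) ∞ γ (Icc 0 1)) {c : M}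
    (hc : γ 0 = c) (Ψ : g ≃ₗ⁅ℝ⁆ V c) : ∃ P : Π t, g ≃ₗ⁅ℝ⁆ V (γ t),
      (∀ v, ParallelOn D.nabla γ (fun t => P t v) (Icc 0 1)) ∧
      ∀ v, (⟨γ 0, P 0 v⟩ : TotalSpace g V) = ⟨c, Ψ v⟩ := by
  subst hc
  choose w hw0 hw using fun v => D.exists_parallelOn hL hγ (Ψ v)
  have h0 : (0 : ℝ) ∈ Icc (0 : ℝ) 1 := left_mem_Icc.2 zero_le_one
  -- Linear combinations and brackets of parallel sections are parallel, so uniqueness makes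
  -- transport linear and compatible with brackets.
  have hcomb : ∀ (k l : ℝ) (v v' : g), ∀ t ∈ Icc (0 : ℝ) 1,
      w (k • v + l • v') t = k • w v t + l • w v' t := fun k l v v' =>
    D.parallelOn_unique hL hγ (hw _)
      (ParallelOn.combine hγ.continuousOn subset_rfl (hw v) (hw v') k l) h0
      (by simp only [hw0, map_add, map_smul])
  have hlie : ∀ v v' : g, ∀ t ∈ Icc (0 : ℝ) 1, w ⁅v, v'⁆ t = ⁅w v t, w v' t⁆ := fun v v' =>
    D.parallelOn_unique hL hγ (hw _)
      (D.parallelOn_lie hL hγ.continuousOn subset_rfl (hw v) (hw v')) h0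
      (by simp only [hw0, LieEquiv.map_lie])
  have hex : ∀ t, ∃ P : g ≃ₗ⁅ℝ⁆ V (γ t), t ∈ Icc (0 : ℝ) 1 → ∀ v, P v = w v t := by
    intro t
    obtain ⟨P₀⟩ := hL.exists_lieEquiv (γ t)
    by_cases ht : t ∈ Icc (0 : ℝ) 1
    · let F : g →ₗ⁅ℝ⁆ V (γ t) :=
        { toFun := fun v => w v t
          map_add' := fun v v' => by simpa using hcomb 1 1 v v' t ht
          map_smul' := fun k v => by simpa using hcomb k 0 v 0 t ht
          map_lie' := fun {v v'} => hlie v v' t ht }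
      -- Uniqueness backwards from `t` to `0`; surjectivity then follows by equality of dimensions.
      have hinj : Function.Injective F := by
        intro v v' hvv
        have := D.parallelOn_unique hL hγ (hw v) (hw v') ht hvv 0 h0
        rw [hw0, hw0] at this
        exact Ψ.injective this
      have hfd : FiniteDimensional ℝ (V (γ t)) := P₀.toLinearEquiv.finiteDimensional
      have hsurj : Function.Surjective F :=
        (LinearMap.injective_iff_surjective_of_finrank_eq_finrank
          (f := (F : g →ₗ[ℝ] V (γ t))) P₀.toLinearEquiv.finrank_eq).1 hinj
      exact ⟨LieEquiv.ofBijective F ⟨hinj, hsurj⟩, fun _ v => rfl⟩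
    · exact ⟨P₀, fun h => absurd h ht⟩
  choose P hP using hex
  exact ⟨P, fun v => (hw v).congr fun t ht => hP t ht v, fun v => by rw [hP 0 h0, hw0]⟩

theorem DeltaConnection.isParallelTransport_iff (D : DeltaConnection n g V)
    (hL : IsLieAlgebraBundle n g V) (hγ : ContMDiffOn 𝓘(ℝ, ℝ) (𝓡 n) ∞ γ (Icc 0 1))
    {w : Π t, V (γ t)} (hw : ParallelOn D.nabla γ w (Icc 0 1)) (q : TotalSpace g V) :
    IsParallelTransport D.nabla γ ⟨γ 0, w 0⟩ q ↔ q = ⟨γ 1, w 1⟩ := by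
  have h0 : (0 : ℝ) ∈ Icc (0 : ℝ) 1 := left_mem_Icc.2 zero_le_one
  have h1 : (1 : ℝ) ∈ Icc (0 : ℝ) 1 := right_mem_Icc.2 zero_le_one
  constructor
  · rintro ⟨u, hu, hu0, rfl⟩
    obtain ⟨w', huw, hw'⟩ := hu.exists_parallelOn hγ
    rw [huw 0 h0] at hu0
    have h2 : w' 0 = w 0 := by simpa using hu0
    rw [huw 1 h1, D.parallelOn_unique hL hγ hw' hw h0 h2 1 h1]
  · rintro rfl
    exact ⟨fun t => ⟨γ t, w t⟩, hw.isParallelAlong hL hγ, rfl, rfl⟩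

end ParallelTransport

/-! ### Frames transported along a family of paths -/

section TransportedFrames

variable {n : ℕ} {M : Type*} [TopologicalSpace M] [ChartedSpace (EuclideanSpace ℝ (Fin n)) M]
  [IsManifold (𝓡 n) ∞ M]
  {g : Type*} [NormedLieAlgebra g] [FiniteDimensional ℝ g]
  {V : M → Type*} [TopologicalSpace (TotalSpace g V)]
  [∀ x, LieRing (V x)] [∀ x, LieAlgebra ℝ (V x)] [∀ x, TopologicalSpace (V x)]
  [∀ x, IsTopologicalAddGroup (V x)] [∀ x, ContinuousSMul ℝ (V x)]
  [FiberBundle g V] [VectorBundle ℝ g V] [ContMDiffVectorBundle ∞ g V (𝓡 n)]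
  [T2Space M] {E : Type} [NormedAddCommGroup E] [NormedSpace ℝ E] {Γ : ℝ × E → M}

theorem hasDerivWithinAt_clm_of_apply {F G : Type*} [NormedAddCommGroup F] [NormedSpace ℝ F]
    [FiniteDimensional ℝ F] [NormedAddCommGroup G] [NormedSpace ℝ G] {f : ℝ → F →L[ℝ] G}
    {f' : F →L[ℝ] G} {s : Set ℝ} {t : ℝ}
    (h : ∀ v, HasDerivWithinAt (fun r => f r v) (f' v) s t) : HasDerivWithinAt f f' s t := by
  let b := Module.finBasis ℝ F
  let L : Fin (Module.finrank ℝ F) → G →L[ℝ] F →L[ℝ] G := fun i =>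
    ContinuousLinearMap.smulRightL ℝ F G (LinearMap.toContinuousLinearMap (b.coord i))
  have hf : ∀ k : F →L[ℝ] G, k = ∑ i, L i (k (b i)) := by
    intro k
    ext v
    have : v = ∑ i, b.coord i v • b i := by simp [b.sum_repr]
    conv_lhs => rw [this, map_sum]
    simp only [map_smul, sum_apply]
    rfl
  rw [hf f', funext fun r => hf (f r)]
  exact HasDerivWithinAt.fun_sum fun i _ => (L i).hasFDerivAt.comp_hasDerivWithinAt t (h (b i))

/-- An isomorphism `g ≃ V x` in the coordinates of a trivialization. -/
def fibreCoord (e : Trivialization g (π g V)) [e.IsLinear ℝ] {x : M} (φ : g ≃ₗ⁅ℝ⁆ V x) :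
    g →L[ℝ] g :=
  LinearMap.toContinuousLinearMap ((e.linearMapAt ℝ x) ∘ₗ (φ.toLinearEquiv : g →ₗ[ℝ] V x))

theorem fibreCoord_apply {e : Trivialization g (π g V)} [e.IsLinear ℝ] {x : M}
    (hx : x ∈ e.baseSet) (φ : g ≃ₗ⁅ℝ⁆ V x) (v : g) : fibreCoord e φ v = (e ⟨x, φ v⟩).2 := by
  change e.linearMapAt ℝ x (φ v) = _
  rw [e.coe_linearMapAt_of_mem hx]

theorem coordChangeL_mul_fibreCoord {e e' : Trivialization g (π g V)} [e.IsLinear ℝ]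
    [e'.IsLinear ℝ] {x : M} (hx : x ∈ e.baseSet) (hx' : x ∈ e'.baseSet) (φ : g ≃ₗ⁅ℝ⁆ V x) :
    (e.coordChangeL ℝ e' x : g →L[ℝ] g) * fibreCoord e φ = fibreCoord e' φ := by
  ext v
  rw [mul_apply_eq_comp, fibreCoord_apply hx, fibreCoord_apply hx']
  exact coordChangeL_apply_apply hx hx' (φ v)

theorem LieTrivialization.fibreCoord_eq (e : LieTrivialization n g V) {x : M}
    (hx : x ∈ e.toTriv.baseSet) (φ : g ≃ₗ⁅ℝ⁆ V x) :
    fibreCoord e.toTriv φ = lieAutToCLM (φ.trans (e.fibreInv x hx)) := by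
  ext v
  rw [fibreCoord_apply hx]
  rfl

theorem isUnit_lieAutToCLM (a : g ≃ₗ⁅ℝ⁆ g) : IsUnit (lieAutToCLM a) :=
  ⟨⟨lieAutToCLM a, lieAutToCLM a⁻¹, by ext v; exact a.apply_symm_apply v,
    by ext v; exact a.symm_apply_apply v⟩, rfl⟩

theorem inverse_lieAutToCLM_mul (a : g ≃ₗ⁅ℝ⁆ g) (X : g) :
    Ring.inverse (lieAutToCLM a) * (adCLM X * lieAutToCLM a) = adCLM (a.symm X) := by
  have h := lieAutToCLM_mul_adCLM a (a.symm X)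
  rw [LieEquiv.apply_symm_apply] at h
  rw [← h, Ring.inverse_mul_cancel_left _ _ (isUnit_lieAutToCLM a)]

variable (g) in
/-- A linear map whose kernel consists of the inner derivations. -/
theorem exists_ker_eq_inner : ∃ (k : ℕ) (pr : (g →L[ℝ] g) →L[ℝ] (Fin k → ℝ)),
    ∀ L, pr L = 0 ↔ ∃ X : g, L = adCLM X := by
  -- Projecting to the quotient by the inner derivations turns innerness into the vanishing of a
  -- vector-valued function, which can be propagated by differentiation.
  let R : Submodule ℝ (g →L[ℝ] g) := LinearMap.range ((adL g) : g →ₗ[ℝ] (g →L[ℝ] g))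
  let b := Module.finBasis ℝ ((g →L[ℝ] g) ⧸ R)
  refine ⟨_, LinearMap.toContinuousLinearMap (b.equivFun.toLinearMap ∘ₗ R.mkQ), fun L => ?_⟩
  change b.equivFun (R.mkQ L) = 0 ↔ _
  rw [LinearEquiv.map_eq_zero_iff, Submodule.mkQ_apply, Submodule.Quotient.mk_eq_zero,
    LinearMap.mem_range]
  exact ⟨fun ⟨X, hX⟩ => ⟨X, hX.symm⟩, fun ⟨X, hX⟩ => ⟨X, hX.symm⟩⟩

theorem hasMFDerivAt_slice (hΓ : ContMDiffOn 𝓘(ℝ, ℝ × E) (𝓡 n) ∞ Γ (Icc 0 1 ×ˢ univ)) {t : ℝ}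
    (ht : t ∈ Icc (0 : ℝ) 1) (z : E) :
    HasMFDerivAt 𝓘(ℝ, E) (𝓡 n) (fun z => Γ (t, z)) z
      ((mfderivWithin 𝓘(ℝ, ℝ × E) (𝓡 n) Γ (Icc 0 1 ×ˢ univ) (t, z)).comp
        (ContinuousLinearMap.inr ℝ ℝ E)) := by
  have h1 : HasMFDerivWithinAt 𝓘(ℝ, ℝ × E) (𝓡 n) Γ (Icc 0 1 ×ˢ univ) (t, z)
      (mfderivWithin 𝓘(ℝ, ℝ × E) (𝓡 n) Γ (Icc 0 1 ×ˢ univ) (t, z)) :=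
    ((hΓ (t, z) ⟨ht, mem_univ _⟩).mdifferentiableWithinAt (by simp)).hasMFDerivWithinAt
  have h2 : HasMFDerivWithinAt 𝓘(ℝ, E) 𝓘(ℝ, ℝ × E) (fun z : E => (t, z)) univ z
      (ContinuousLinearMap.inr ℝ ℝ E) :=
    (hasFDerivAt_prodMk_right t z).hasFDerivWithinAt.hasMFDerivWithinAt
  have hsub : (univ : Set E) ⊆ (fun z : E => (t, z)) ⁻¹' (Icc (0 : ℝ) 1 ×ˢ (univ : Set E)) :=
    fun _ _ => ⟨ht, mem_univ _⟩
  exact hasMFDerivWithinAt_univ.1 (HasMFDerivWithinAt.comp z h1 h2 hsub)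

theorem contMDiff_slice (hΓ : ContMDiffOn 𝓘(ℝ, ℝ × E) (𝓡 n) ∞ Γ (Icc 0 1 ×ˢ univ)) {t : ℝ}
    (ht : t ∈ Icc (0 : ℝ) 1) : ContMDiff 𝓘(ℝ, E) (𝓡 n) ∞ (fun z => Γ (t, z)) :=
  contMDiffOn_univ.1 (hΓ.comp (contMDiff_iff_contDiff.2 (contDiff_prodMk_right t)).contMDiffOn
    fun _ _ => ⟨ht, mem_univ _⟩)

/-- Near `z₀` the frames `P z t` over `Γ (t, z)` depend smoothly on `z`, and their covariant
derivative in the direction of `z` is inner. -/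
def InnerFrameAt (D : DeltaConnection n g V) (P : Π (z : E) (t : ℝ), g ≃ₗ⁅ℝ⁆ V (Γ (t, z)))
    (e : LieTrivialization n g V) (t : ℝ) (z₀ : E) : Prop :=
  ∃ W : Set E, IsOpen W ∧ z₀ ∈ W ∧ (∀ z ∈ W, Γ (t, z) ∈ e.toTriv.baseSet) ∧
    ContDiffOn ℝ ∞ (fun z => fibreCoord e.toTriv (P z t)) W ∧
    ∀ z ∈ W, ∀ h : E, ∃ X : g, fderiv ℝ (fun z => fibreCoord e.toTriv (P z t)) z h +
      familyForm D.nabla e.toTriv Γ (t, z) (0, h) * fibreCoord e.toTriv (P z t) =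
      fibreCoord e.toTriv (P z t) * adCLM X

variable {D : DeltaConnection n g V} {P : Π (z : E) (t : ℝ), g ≃ₗ⁅ℝ⁆ V (Γ (t, z))}

/-- Under a change of trivialization the frame matrix and its covariant derivative are both
multiplied on the left by the coordinate change, so the same `X` works. -/
theorem InnerFrameAt.change (hΓ : ContMDiffOn 𝓘(ℝ, ℝ × E) (𝓡 n) ∞ Γ (Icc 0 1 ×ˢ univ))
    {e e' : LieTrivialization n g V} {t : ℝ} (ht : t ∈ Icc (0 : ℝ) 1) {z₀ : E}
    (h : InnerFrameAt D P e t z₀) (he' : Γ (t, z₀) ∈ e'.toTriv.baseSet) :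
    InnerFrameAt D P e' t z₀ := by
  obtain ⟨W, hW, hzW, hWe, hQ, hX⟩ := h
  have hs := contMDiff_slice hΓ ht
  set W' := W ∩ (fun z => Γ (t, z)) ⁻¹' e'.toTriv.baseSet with hW'
  have hW'o : IsOpen W' := hW.inter (e'.toTriv.open_baseSet.preimage hs.continuous)
  have heq : ∀ z ∈ W', fibreCoord e'.toTriv (P z t) =
      (e.toTriv.coordChangeL ℝ e'.toTriv (Γ (t, z)) : g →L[ℝ] g) * fibreCoord e.toTriv (P z t) :=
    fun z hz => (coordChangeL_mul_fibreCoord (hWe z hz.1) hz.2 _).symm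
  have hTs : ∀ z ∈ W', ContDiffAt ℝ ∞
      (fun z => (e.toTriv.coordChangeL ℝ e'.toTriv (Γ (t, z)) : g →L[ℝ] g)) z := fun z hz =>
    contMDiffAt_iff_contDiffAt.1 ((e.isSmoothTriv.contMDiffAt_coordChangeL e'.isSmoothTriv
      (hWe z hz.1) hz.2).comp z hs.contMDiffAt)
  refine ⟨W', hW'o, ⟨hzW, he'⟩, fun z hz => hz.2, ?_, fun z hz h => ?_⟩
  · refine ContDiffOn.congr (f := fun z =>
      (e.toTriv.coordChangeL ℝ e'.toTriv (Γ (t, z)) : g →L[ℝ] g) *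
        fibreCoord e.toTriv (P z t)) ?_ heq
    exact ContDiffOn.clm_comp (fun z hz => (hTs z hz).contDiffWithinAt)
      (hQ.mono inter_subset_left)
  · obtain ⟨X, hX⟩ := hX z hz.1 h
    refine ⟨X, ?_⟩
    set a : TangentSpace (𝓡 n) (Γ (t, z)) :=
      mfderivWithin 𝓘(ℝ, ℝ × E) (𝓡 n) Γ (Icc 0 1 ×ˢ univ) (t, z) (0, h) with ha
    have hτ := ((e.isSmoothTriv.contMDiffAt_coordChangeL e'.isSmoothTriv
      (hWe z hz.1) hz.2).mdifferentiableAt (by simp)).hasMFDerivAt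
    have hT : fderiv ℝ (fun z => (e.toTriv.coordChangeL ℝ e'.toTriv (Γ (t, z)) : g →L[ℝ] g)) z h =
        mvfderiv (𝓡 n) (fun y => (e.toTriv.coordChangeL ℝ e'.toTriv y : g →L[ℝ] g)) (Γ (t, z))
          a := by
      have h1 := HasMFDerivAt.comp z hτ (hasMFDerivAt_slice hΓ ht z)
      have h2 := h1.mfderiv
      rw [mfderiv_eq_fderiv] at h2
      exact congrArg (fun L : E →L[ℝ] (g →L[ℝ] g) => L h) h2
    have hQd : HasFDerivAt (fun z => fibreCoord e.toTriv (P z t))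
        (fderiv ℝ (fun z => fibreCoord e.toTriv (P z t)) z) z :=
      ((hQ.contDiffAt (hW.mem_nhds hz.1)).differentiableAt (by simp)).hasFDerivAt
    have hTd := ((hTs z hz).differentiableAt (by simp)).hasFDerivAt
    have hd := (hTd.mul' hQd).congr_of_eventuallyEq
      (Filter.eventuallyEq_of_mem (hW'o.mem_nhds hz) heq)
    have hg := coordChangeL_connForm D.nabla e.isSmoothTriv e'.isSmoothTriv (hWe z hz.1) hz.2 a
    have hf : ∀ e : LieTrivialization n g V, familyForm D.nabla e.toTriv Γ (t, z) (0, h) =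
      connForm D.nabla e.toTriv (Γ (t, z)) a := fun _ => rfl
    rw [hf] at hX ⊢
    rw [hd.fderiv, heq z hz]
    simp only [add_apply, smul_apply, smul_eq_mul, MulOpposite.smul_eq_mul_unop,
      MulOpposite.unop_op, hT]
    have hg' := congrArg (fun L : g →L[ℝ] g => L * fibreCoord e.toTriv (P z t)) hg
    simp only [add_mul] at hg'
    rw [mul_assoc (_ : g →L[ℝ] g) (fibreCoord e.toTriv (P z t)) (adCLM X), ← hX, mul_add,
      ← mul_assoc (e.toTriv.coordChangeL ℝ e'.toTriv (Γ (t, z)) : g →L[ℝ] g)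
        (connForm D.nabla e.toTriv (Γ (t, z)) a), hg', mul_assoc (connForm D.nabla e'.toTriv _ a)]
    exact add_assoc _ _ _

theorem IsGoodBox.mono {e : LieTrivialization n g V} {a b K : ℝ} {W W' : Set E}
    (h : IsGoodBox D e Γ a b W K) (hW' : IsOpen W') (hsub : W' ⊆ W) :
    IsGoodBox D e Γ a b W' K := by
  have hS : Icc a b ×ˢ W' ⊆ Icc a b ×ˢ W := prod_mono subset_rfl hsub
  refine ⟨h.lt, h.subset, hW', fun p hp => h.mem_baseSet p (hS hp), h.contDiffOn.mono hS,
    fun p hp => h.norm_le p (hS hp), h.mul_lt, fun p hp k => ?_⟩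
  obtain ⟨X, hX⟩ := h.curvature p (hS hp) k
  refine ⟨X, ?_⟩
  rw [← hX, curvatureForm, curvatureForm, fderivWithin_subset hS
    (uniqueDiffOn_Icc_prod h.lt hW' p hp)
    ((h.contDiffOn p (hS hp)).differentiableWithinAt (by simp))]

/-- On the box the curvature is inner and the frame matrices are automorphisms, so the conjugated
curvature is inner. By `parallel_frame_variation` the non-inner part of the covariant derivative is
the same at `t₁` and `t`. -/
theorem InnerFrameAt.of_isGoodBox (hΓ : ContMDiffOn 𝓘(ℝ, ℝ × E) (𝓡 n) ∞ Γ (Icc 0 1 ×ˢ univ))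
    (hP : ∀ z v, ParallelOn D.nabla (fun t => Γ (t, z)) (fun t => P z t v) (Icc 0 1))
    {e : LieTrivialization n g V} {a b K : ℝ} {W : Set E} (hB : IsGoodBox D e Γ a b W K)
    {z₀ : E} (hz₀ : z₀ ∈ W) {t₁ t : ℝ} (ht₁ : t₁ ∈ Icc a b) (ht : t ∈ Icc a b)
    (h : InnerFrameAt D P e t₁ z₀) : InnerFrameAt D P e t z₀ := by
  obtain ⟨W₁, hW₁, hzW₁, -, hQ, hX⟩ := h
  have hW₂ : IsOpen (W ∩ W₁) := hB.isOpen.inter hW₁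
  replace hB := hB.mono hW₂ inter_subset_left
  replace hQ := hQ.mono (inter_subset_right : W ∩ W₁ ⊆ W₁)
  have hq : ∀ z ∈ W ∩ W₁, ∀ t ∈ Icc a b,
      HasDerivWithinAt (fun t => fibreCoord e.toTriv (P z t))
        (-familyForm D.nabla e.toTriv Γ (t, z) (1, 0) * fibreCoord e.toTriv (P z t))
        (Icc a b) t := by
    intro z hz t ht
    have hb : ∀ r ∈ Icc a b, Γ (r, z) ∈ e.toTriv.baseSet := fun r hr =>
      hB.mem_baseSet (r, z) ⟨hr, hz⟩
    refine hasDerivWithinAt_clm_of_apply fun v => ?_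
    have h1 := ((hP z v).mono hB.subset) t ht e (hb t ht)
    have h2 := h1.congr (f₁ := fun r => fibreCoord e.toTriv (P z r) v)
      (fun r hr => fibreCoord_apply (hb r hr) (P z r) v) (fibreCoord_apply (hb t ht) (P z t) v)
    refine h2.congr_deriv ?_
    rw [mul_apply_eq_comp, neg_apply, fibreCoord_apply (hb t ht)]
    exact congrArg (fun u : EuclideanSpace ℝ (Fin n) =>
      -connForm D.nabla e.toTriv (Γ (t, z)) u (e.toTriv ⟨Γ (t, z), P z t v⟩).2)
      (velocity_family hΓ (hB.subset ht) z)
  have hqa : ∀ z ∈ W ∩ W₁, ∀ t ∈ Icc a b, ∃ A : g ≃ₗ⁅ℝ⁆ g,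
      fibreCoord e.toTriv (P z t) = lieAutToCLM A := fun z hz t ht =>
    ⟨_, e.fibreCoord_eq (hB.mem_baseSet (t, z) ⟨ht, hz⟩) _⟩
  have hqu : ∀ z ∈ W ∩ W₁, ∀ t ∈ Icc a b, IsUnit (fibreCoord e.toTriv (P z t)) := by
    intro z hz t ht
    obtain ⟨A, hA⟩ := hqa z hz t ht
    rw [hA]; exact isUnit_lieAutToCLM A
  obtain ⟨k, pr, hpr⟩ := exists_ker_eq_inner g
  have hbX : ContDiffOn ℝ ∞ (fun p => -familyForm D.nabla e.toTriv Γ p (1, 0))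
      (Icc a b ×ˢ (W ∩ W₁)) := (hB.contDiffOn.clm_apply contDiffOn_const).neg
  refine ⟨W ∩ W₁, hW₂, ⟨hz₀, hzW₁⟩, fun z hz => hB.mem_baseSet (t, z) ⟨ht, hz⟩,
    (linearODE_smooth_dependence (q := fun t z => fibreCoord e.toTriv (P z t)) hB.lt hW₂ hbX
      (fun p hp => by rw [norm_neg]; exact hB.norm_le p hp) hB.mul_lt hq ht₁ hQ).1 t ht,
    fun z hz h => ?_⟩
  have key := parallel_frame_variation (q := fun t z => fibreCoord e.toTriv (P z t)) pr hB.lt hW₂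
    hB.contDiffOn hB.norm_le hB.mul_lt hq hqu (fun z hz t ht h => by
      obtain ⟨X, hX⟩ := hB.curvature (t, z) ⟨ht, hz⟩ h
      obtain ⟨A, hA⟩ := hqa z hz t ht
      refine (hpr _).2 ⟨A.symm X, ?_⟩
      simp only [hX, hA, inverse_lieAutToCLM_mul]) ht₁ hQ hz h ht
  obtain ⟨X, hX⟩ := hX z hz.2 h
  have h1 : pr (Ring.inverse (fibreCoord e.toTriv (P z t₁)) *
      (fderiv ℝ (fun z => fibreCoord e.toTriv (P z t₁)) z h +
      familyForm D.nabla e.toTriv Γ (t₁, z) (0, h) * fibreCoord e.toTriv (P z t₁))) = 0 := by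
    rw [hX, Ring.inverse_mul_cancel_left _ _ (hqu z hz t₁ ht₁)]
    exact (hpr _).2 ⟨X, rfl⟩
  obtain ⟨Y, hY⟩ := (hpr _).1 (key.trans h1)
  refine ⟨Y, ?_⟩
  rw [← hY, Ring.mul_inverse_cancel_left _ _ (hqu z hz t ht)]

/-- Frames obtained by parallel transport along a smooth family of paths issuing from one point are
smooth, and their covariant derivatives are inner. -/
theorem innerFrameAt_of_parallel (hL : IsLieAlgebraBundle n g V)
    (hΓ : ContMDiffOn 𝓘(ℝ, ℝ × E) (𝓡 n) ∞ Γ (Icc 0 1 ×ˢ univ))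
    (hP : ∀ z v, ParallelOn D.nabla (fun t => Γ (t, z)) (fun t => P z t v) (Icc 0 1))
    {c : M} (hc : ∀ z, Γ (0, z) = c) {Ψ : g ≃ₗ⁅ℝ⁆ V c}
    (hP0 : ∀ z v, (⟨Γ (0, z), P z 0 v⟩ : TotalSpace g V) = ⟨c, Ψ v⟩) (z₀ : E) {t : ℝ}
    (ht : t ∈ Icc (0 : ℝ) 1) {e : LieTrivialization n g V} (he : Γ (t, z₀) ∈ e.toTriv.baseSet) :
    InnerFrameAt D P e t z₀ := by
  have h0 : (0 : ℝ) ∈ Icc (0 : ℝ) 1 := left_mem_Icc.2 zero_le_one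
  have hex : ∃ e : LieTrivialization n g V, InnerFrameAt D P e t z₀ := by
    refine forall_Icc_of_locally (P := fun t => ∃ e : LieTrivialization n g V,
      InnerFrameAt D P e t z₀) (fun τ hτ => ?_) h0 ?_ t ht
    · obtain ⟨e, he⟩ := hL (Γ (τ, z₀))
      obtain ⟨a, b, W, K, hB, hab, hzW⟩ := D.exists_isGoodBox e hΓ hτ he
      refine ⟨a, b, hab, fun r hr s hs ⟨e', he'⟩ => ⟨e, ?_⟩⟩
      exact InnerFrameAt.of_isGoodBox hΓ hP hB hzW hr hs
        (he'.change hΓ (hB.subset hr) (hB.mem_baseSet (r, z₀) ⟨hr, hzW⟩))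
    -- At `t = 0` all paths are at `c`: the frame is constant in `z`, and the connection form
    -- vanishes in the directions of `z`.
    · obtain ⟨e, he⟩ := hL c
      have hb : ∀ z, Γ (0, z) ∈ e.toTriv.baseSet := fun z => by rw [hc z]; exact he
      have hconst : (fun z => fibreCoord e.toTriv (P z 0)) = fun _ => fibreCoord e.toTriv Ψ := by
        funext z
        ext v
        rw [fibreCoord_apply (hb z), hP0 z v, fibreCoord_apply he]
      refine ⟨e, univ, isOpen_univ, mem_univ _, fun z _ => hb z, ?_, fun z _ h => ⟨0, ?_⟩⟩
      · rw [hconst]; exact contDiffOn_const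
      · have h1 : mfderivWithin 𝓘(ℝ, ℝ × E) (𝓡 n) Γ (Icc 0 1 ×ˢ univ) (0, z) (0, h) = 0 := by
          have h2 := (hasMFDerivAt_slice hΓ h0 z).mfderiv
          have h3 : (fun z => Γ (0, z)) = fun _ => c := funext hc
          rw [h3, mfderiv_const] at h2
          exact (congrArg (fun L : E →L[ℝ] EuclideanSpace ℝ (Fin n) => L h) h2).symm
        have h4 : familyForm D.nabla e.toTriv Γ (0, z) (0, h) = 0 := by
          change connForm D.nabla e.toTriv (Γ (0, z)) (mfderivWithin 𝓘(ℝ, ℝ × E) (𝓡 n) Γ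
            (Icc 0 1 ×ˢ univ) (0, z) (0, h)) = 0
          rw [h1]; exact map_zero _
        rw [hconst, h4, ← adL_apply]
        simp
  obtain ⟨e', he'⟩ := hex
  exact he'.change hΓ ht he

end TransportedFrames

/-! ### Local trivializations from smooth frames -/

section TrivializationsFromFrames

variable {n : ℕ} {M : Type*} [TopologicalSpace M] [ChartedSpace (EuclideanSpace ℝ (Fin n)) M]
  [IsManifold (𝓡 n) ∞ M]
  {g : Type*} [NormedLieAlgebra g] [FiniteDimensional ℝ g]
  {V : M → Type*} [TopologicalSpace (TotalSpace g V)]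
  [∀ x, LieRing (V x)] [∀ x, LieAlgebra ℝ (V x)] [∀ x, TopologicalSpace (V x)]
  [∀ x, IsTopologicalAddGroup (V x)] [∀ x, ContinuousSMul ℝ (V x)]
  [FiberBundle g V] [VectorBundle ℝ g V] [ContMDiffVectorBundle ∞ g V (𝓡 n)]
  [T2Space M]

theorem ContMDiffAt.ringInverse {E' H N : Type*} [NormedAddCommGroup E'] [NormedSpace ℝ E']
    [TopologicalSpace H] {I : ModelWithCorners ℝ E' H} [TopologicalSpace N] [ChartedSpace H N]
    {f : N → g →L[ℝ] g} {x : N} (hf : ContMDiffAt I 𝓘(ℝ, g →L[ℝ] g) ∞ f x) (hu : IsUnit (f x)) :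
    ContMDiffAt I 𝓘(ℝ, g →L[ℝ] g) ∞ (fun y => Ring.inverse (f y)) x := by
  have : CompleteSpace g := FiniteDimensional.complete ℝ g
  obtain ⟨u, hu⟩ := hu
  have h := contDiffAt_ringInverse ℝ (n := ∞) u
  rw [hu] at h
  exact h.contMDiffAt.comp x hf

/-- Writes the inverse of a frame through the inverse of its coordinate matrix, so that its
smoothness follows from that of inversion. -/
theorem LieTrivialization.symm_apply_eq (e : LieTrivialization n g V) {x : M}
    (hx : x ∈ e.toTriv.baseSet) (φ : g ≃ₗ⁅ℝ⁆ V x) (w : V x) :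
    φ.symm w = Ring.inverse (fibreCoord e.toTriv φ) (e.toTriv ⟨x, w⟩).2 := by
  have h1 : (e.toTriv ⟨x, w⟩).2 = fibreCoord e.toTriv φ (φ.symm w) := by
    rw [fibreCoord_apply hx, LieEquiv.apply_symm_apply]
  have hu : IsUnit (fibreCoord e.toTriv φ) := by
    rw [e.fibreCoord_eq hx]; exact isUnit_lieAutToCLM _
  rw [h1, ← mul_apply_eq_comp, Ring.inverse_mul_cancel _ hu]
  rfl

/-- A family of Lie algebra isomorphisms `g ≃ V x` is smooth over `U`. -/
def IsSmoothFrame (U : Set M) (φ : Π x, g ≃ₗ⁅ℝ⁆ V x) : Prop :=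
  ∀ e : LieTrivialization n g V, ∀ x ∈ U, x ∈ e.toTriv.baseSet →
    ContMDiffAt (𝓡 n) 𝓘(ℝ, g →L[ℝ] g) ∞ (fun y => fibreCoord e.toTriv (φ y)) x

variable {U : Set M} {φ : Π x, g ≃ₗ⁅ℝ⁆ V x}

theorem IsSmoothFrame.contMDiffOn_coord (hφ : IsSmoothFrame (n := n) U φ)
    (hL : IsLieAlgebraBundle n g V) :
    ContMDiffOn ((𝓡 n).prod 𝓘(ℝ, g)) ((𝓡 n).prod 𝓘(ℝ, g)) ∞
      (fun p : TotalSpace g V => (p.1, (φ p.1).symm p.2)) (TotalSpace.proj ⁻¹' U) := by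
  intro p hp
  obtain ⟨e, he⟩ := hL p.proj
  have hb : e.toTriv.baseSet ∈ 𝓝 p.proj := e.toTriv.open_baseSet.mem_nhds he
  have hpr : ContMDiffAt ((𝓡 n).prod 𝓘(ℝ, g)) (𝓡 n) ∞ (TotalSpace.proj (F := g) (E := V)) p :=
    (Bundle.contMDiff_proj V).contMDiffAt
  have h1 : ContMDiffAt ((𝓡 n).prod 𝓘(ℝ, g)) 𝓘(ℝ, g) ∞ (fun q => (e.toTriv q).2) p :=
    (e.smooth.contMDiffAt (e.toTriv.open_source.mem_nhds (e.toTriv.mem_source.2 he))).snd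
  have hu : IsUnit (fibreCoord e.toTriv (φ p.proj)) := by
    rw [e.fibreCoord_eq he]; exact isUnit_lieAutToCLM _
  have h2 : ContMDiffAt ((𝓡 n).prod 𝓘(ℝ, g)) 𝓘(ℝ, g →L[ℝ] g) ∞
      (fun q : TotalSpace g V => Ring.inverse (fibreCoord e.toTriv (φ q.proj))) p :=
    ((hφ e p.proj hp he).comp p hpr).ringInverse hu
  refine ContMDiffAt.contMDiffWithinAt (hpr.prodMk ((h2.clm_apply h1).congr_of_eventuallyEq ?_))
  filter_upwards [hpr.continuousAt hb] with q hq
  exact e.symm_apply_eq hq (φ q.proj) q.2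

theorem IsSmoothFrame.contMDiffOn_map (hφ : IsSmoothFrame (n := n) U φ)
    (hL : IsLieAlgebraBundle n g V) :
    ContMDiffOn ((𝓡 n).prod 𝓘(ℝ, g)) ((𝓡 n).prod 𝓘(ℝ, g)) ∞
      (fun q : M × g => (⟨q.1, φ q.1 q.2⟩ : TotalSpace g V)) (U ×ˢ univ) := by
  rintro ⟨x, v⟩ ⟨hx, -⟩
  obtain ⟨e, he⟩ := hL x
  have hb : e.toTriv.baseSet ∈ 𝓝 x := e.toTriv.open_baseSet.mem_nhds he
  have hfst : ContMDiffAt ((𝓡 n).prod 𝓘(ℝ, g)) (𝓡 n) ∞ (Prod.fst : M × g → M) (x, v) :=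
    contMDiffAt_fst
  have h1 : ContMDiffAt ((𝓡 n).prod 𝓘(ℝ, g)) 𝓘(ℝ, g) ∞
      (fun q : M × g => fibreCoord e.toTriv (φ q.1) q.2) (x, v) :=
    ContMDiffAt.clm_apply (g := fun q : M × g => fibreCoord e.toTriv (φ q.1))
      (ContMDiffAt.comp (g := fun y => fibreCoord e.toTriv (φ y)) (x, v) (hφ e x hx he) hfst)
      contMDiffAt_snd
  have h2 : ContMDiffAt ((𝓡 n).prod 𝓘(ℝ, g)) ((𝓡 n).prod 𝓘(ℝ, g)) ∞
      e.toTriv.toOpenPartialHomeomorph.symm (x, fibreCoord e.toTriv (φ x) v) :=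
    e.smooth_symm.contMDiffAt (e.toTriv.open_target.mem_nhds (e.toTriv.mem_target.2 he))
  refine ContMDiffAt.contMDiffWithinAt ((ContMDiffAt.comp (x, v) h2
    (hfst.prodMk h1)).congr_of_eventuallyEq ?_)
  filter_upwards [hfst.continuousAt hb] with q hq
  change _ = e.toTriv.toOpenPartialHomeomorph.symm (q.1, fibreCoord e.toTriv (φ q.1) q.2)
  rw [fibreCoord_apply hq, ← e.toTriv.mk_symm hq, e.toTriv.symm_apply_apply_mk hq]

/-- The local trivialization defined by a smooth family of Lie algebra isomorphisms. -/
def IsSmoothFrame.toLieTrivialization (hφ : IsSmoothFrame (n := n) U φ)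
    (hL : IsLieAlgebraBundle n g V) (hU : IsOpen U) : LieTrivialization n g V where
  toTriv :=
    { toFun := fun p => (p.1, (φ p.1).symm p.2)
      invFun := fun q => ⟨q.1, φ q.1 q.2⟩
      source := TotalSpace.proj ⁻¹' U
      target := U ×ˢ univ
      map_source' := fun p hp => ⟨hp, mem_univ _⟩
      map_target' := fun q hq => hq.1
      left_inv' := fun p _ => by simp [LieEquiv.apply_symm_apply]
      right_inv' := fun q _ => by simp [LieEquiv.symm_apply_apply]
      open_source := hU.preimage (FiberBundle.continuous_proj g V)
      open_target := hU.prod isOpen_univ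
      continuousOn_toFun := (hφ.contMDiffOn_coord hL).continuousOn
      continuousOn_invFun := (hφ.contMDiffOn_map hL).continuousOn
      baseSet := U
      open_baseSet := hU
      source_eq := rfl
      target_eq := rfl
      proj_toFun := fun _ _ => rfl }
  linear := ⟨fun x _ => ⟨fun a b => (φ x).symm.map_add a b, fun c a => (φ x).symm.map_smul c a⟩⟩
  smooth := hφ.contMDiffOn_coord hL
  smooth_symm := hφ.contMDiffOn_map hL
  map_lie := fun x _ a b => (φ x).symm.map_lie a b

theorem IsSmoothFrame.toLieTrivialization_fibreMap (hφ : IsSmoothFrame (n := n) U φ)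
    (hL : IsLieAlgebraBundle n g V) (hU : IsOpen U) {x : M} (hx : x ∈ U) :
    (hφ.toLieTrivialization hL hU).fibreMap x hx = φ x := by
  refine LieEquiv.ext fun v => ?_
  refine ((hφ.toLieTrivialization hL hU).fibreInv x hx).injective ?_
  refine (LieEquiv.apply_symm_apply _ v).trans ?_
  exact ((φ x).symm_apply_apply v).symm

theorem IsSmoothFrame.fibreCoord_toLieTrivialization (hφ : IsSmoothFrame (n := n) U φ)
    (hL : IsLieAlgebraBundle n g V) (hU : IsOpen U) {x : M} (hx : x ∈ U) :
    fibreCoord (hφ.toLieTrivialization hL hU).toTriv (φ x) = 1 := by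
  ext v
  exact (fibreCoord_apply (e := (hφ.toLieTrivialization hL hU).toTriv) hx (φ x) v).trans ((φ x).symm_apply_apply v)

end TrivializationsFromFrames

/-! ### Adapted trivializations and their compatibility -/

section AdaptedTrivializations

variable {n : ℕ} {M : Type*} [TopologicalSpace M] [ChartedSpace (EuclideanSpace ℝ (Fin n)) M]
  [IsManifold (𝓡 n) ∞ M]
  {g : Type*} [NormedLieAlgebra g] [FiniteDimensional ℝ g]
  {V : M → Type*} [TopologicalSpace (TotalSpace g V)]
  [∀ x, LieRing (V x)] [∀ x, LieAlgebra ℝ (V x)] [∀ x, TopologicalSpace (V x)]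
  [∀ x, IsTopologicalAddGroup (V x)] [∀ x, ContinuousSMul ℝ (V x)]
  [FiberBundle g V] [VectorBundle ℝ g V] [ContMDiffVectorBundle ∞ g V (𝓡 n)]
  [T2Space M]

variable (g) in
-- `X` is determined by `ad X` only up to the centre; a linear section of `ad` makes a continuous
-- choice of `X` possible along a curve.
theorem exists_adL_section : ∃ S : (g →L[ℝ] g) →L[ℝ] g, ∀ X : g, adCLM (S (adCLM X)) = adCLM X := by
  let A : g →ₗ[ℝ] (g →L[ℝ] g) := (adL g).toLinearMap
  obtain ⟨k, hk⟩ := A.rangeRestrict.exists_rightInverse_of_surjective A.range_rangeRestrict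
  obtain ⟨S, hS⟩ := k.exists_extend
  refine ⟨LinearMap.toContinuousLinearMap S, fun X => ?_⟩
  have h1 : S (adCLM X) = k (A.rangeRestrict X) :=
    LinearMap.congr_fun hS (A.rangeRestrict X)
  change adL g (S (adCLM X)) = adL g X
  rw [h1]
  exact congrArg Subtype.val (LinearMap.congr_fun hk (A.rangeRestrict X))

/-- A smooth family of automorphisms over a convex open set whose derivatives are inner stays in one
coset of the inner automorphisms. -/
theorem mk_eq_mk_of_fderiv_inner {E : Type*} [NormedAddCommGroup E] [NormedSpace ℝ E]
    {B : Set E} (hB : IsOpen B) (hBc : Convex ℝ B) {A : E → g ≃ₗ⁅ℝ⁆ g}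
    {f : E → g →L[ℝ] g} (hf : ContDiffOn ℝ ∞ f B) (hfA : ∀ z ∈ B, f z = lieAutToCLM (A z))
    (hX : ∀ z ∈ B, ∀ h, ∃ X : g, fderiv ℝ f z h = adCLM X * f z) {z w : E} (hz : z ∈ B)
    (hw : w ∈ B) :
    (QuotientGroup.mk (A z) : (g ≃ₗ⁅ℝ⁆ g) ⧸ innerAut g) = QuotientGroup.mk (A w) := by
  obtain ⟨S, hS⟩ := exists_adL_section g
  have : CompleteSpace g := FiniteDimensional.complete ℝ g
  let σ : ℝ → E := fun s => z + s • (w - z)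
  have hσ : ∀ s ∈ Icc (0 : ℝ) 1, σ s ∈ B := fun s hs => hBc.add_smul_sub_mem hz hw hs
  have hσc : Continuous σ := by fun_prop
  have hd : ContinuousOn (fun s => fderiv ℝ f (σ s) (w - z)) (Icc 0 1) :=
    ((hf.continuousOn_fderiv_of_isOpen hB (by simp)).comp hσc.continuousOn hσ).clm_apply
      continuousOn_const
  have hu : ∀ s ∈ Icc (0 : ℝ) 1, IsUnit (f (σ s)) := fun s hs => by
    rw [hfA _ (hσ s hs)]; exact isUnit_lieAutToCLM _
  have hi : ContinuousOn (fun s => Ring.inverse (f (σ s))) (Icc 0 1) := by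
    intro s hs
    obtain ⟨u, hu⟩ := hu s hs
    have h := NormedRing.inverse_continuousAt u
    rw [hu] at h
    exact h.comp_continuousWithinAt (f := fun s => f (σ s)) ((hf.continuousOn.comp hσc.continuousOn hσ) s hs)
  -- The logarithmic derivative along the segment from `z` to `w`, lifted continuously to `g`.
  have hc : ContinuousOn (fun s => S (fderiv ℝ f (σ s) (w - z) * Ring.inverse (f (σ s))))
      (Icc 0 1) := S.continuous.comp_continuousOn (hd.mul hi)
  have key := innerAut_of_hasDerivWithinAt (X := fun s => A (σ s)) hc (fun s hs => ?_)
    (left_mem_Icc.2 zero_le_one) (right_mem_Icc.2 zero_le_one)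
  · simpa [σ] using key
  · obtain ⟨X, hX⟩ := hX (σ s) (hσ s hs) (w - z)
    have h1 : fderiv ℝ f (σ s) (w - z) * Ring.inverse (f (σ s)) = adCLM X := by
      rw [hX, Ring.mul_inverse_cancel_right _ _ (hu s hs)]
    simp only [h1, hS]
    rw [← hfA _ (hσ s hs), ← hX]
    have h2 : HasDerivAt σ (w - z) s := by
      simpa [σ] using ((hasDerivAt_id s).smul_const (w - z)).const_add z
    have h3 := (((hf.contDiffAt (hB.mem_nhds (hσ s hs))).differentiableAt
      (by simp)).hasFDerivAt.comp_hasDerivAt s h2).hasDerivWithinAt (s := Icc 0 1)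
    exact h3.congr (fun r hr => (hfA _ (hσ r hr)).symm) (hfA _ (hσ s hs)).symm

/-- The matrix of the connection with respect to `e` consists of inner derivations. -/
def DeltaConnection.IsAdapted (D : DeltaConnection n g V) (e : LieTrivialization n g V) : Prop :=
  ∀ x ∈ e.toTriv.baseSet, ∀ a : TangentSpace (𝓡 n) x,
    ∃ X : g, connForm D.nabla e.toTriv x a = adCLM X

/-- Adaptedness depends only on the class in `Coup`, since the matrices differ by inner derivations;
this makes `f` well defined. -/
theorem DeltaConnection.Equivalent.isAdapted {D D' : DeltaConnection n g V}
    (h : D.Equivalent D') {e : LieTrivialization n g V} (he : D.IsAdapted e) :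
    D'.IsAdapted e := by
  intro x hx a
  obtain ⟨X, hX⟩ := he x hx a
  obtain ⟨Y, hY⟩ := h.exists_connForm_eq e hx a
  refine ⟨X + Y, ?_⟩
  rw [hY, hX]
  exact ((adL g).map_add X Y).symm

theorem LieTrivialization.lieAutToCLM_transition (e e' : LieTrivialization n g V)
    (x : ↥(e.toTriv.baseSet ∩ e'.toTriv.baseSet)) :
    lieAutToCLM (transition e e' x) = (e.toTriv.coordChangeL ℝ e'.toTriv x : g →L[ℝ] g) := by
  have h := coordChangeL_mul_fibreCoord x.2.1 x.2.2 (e.fibreMap x x.2.1)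
  have h1 : fibreCoord e.toTriv (e.fibreMap x x.2.1) = 1 := by
    rw [e.fibreCoord_eq x.2.1]
    ext v
    exact (e.fibreInv x x.2.1).apply_symm_apply v
  rw [h1, mul_one] at h
  rw [h, e'.fibreCoord_eq x.2.2]
  rfl

/-- Trivializations adapted to the same connection are compatible. -/
theorem DeltaConnection.IsAdapted.deltaCompatible {D : DeltaConnection n g V}
    {e e' : LieTrivialization n g V} (he : D.IsAdapted e) (he' : D.IsAdapted e') :
    e.DeltaCompatible e' := by
  have hW : IsOpen (e.toTriv.baseSet ∩ e'.toTriv.baseSet) :=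
    e.toTriv.open_baseSet.inter e'.toTriv.open_baseSet
  have hτ : ∀ x ∈ e.toTriv.baseSet ∩ e'.toTriv.baseSet, ContMDiffAt (𝓡 n) 𝓘(ℝ, g →L[ℝ] g) ∞
      (fun y => (e.toTriv.coordChangeL ℝ e'.toTriv y : g →L[ℝ] g)) x := fun x hx =>
    e.isSmoothTriv.contMDiffAt_coordChangeL e'.isSmoothTriv hx.1 hx.2
  refine autDelta_continuous_iff.2 ⟨?_, ?_⟩
  · simp only [LieTrivialization.lieAutToCLM_transition]
    exact continuous_iff_continuousAt.2 fun x =>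
      (hτ x x.2).continuousAt.comp continuous_subtype_val.continuousAt
  -- For the discrete quotient, continuity means local constancy, which is checked on a ball in a
  -- chart, where points are joined by segments.
  · refine @IsLocallyConstant.continuous _ _ _ ⊥ _ ?_
    rw [IsLocallyConstant.iff_eventually_eq]
    intro x₀
    let c := chartAt (EuclideanSpace ℝ (Fin n)) (x₀ : M)
    have hcx : (x₀ : M) ∈ c.source := mem_chart_source _ _
    have hN : IsOpen (c.target ∩ c.symm ⁻¹' (e.toTriv.baseSet ∩ e'.toTriv.baseSet)) :=
      c.isOpen_inter_preimage_symm hW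
    obtain ⟨r, hr, hrB⟩ := Metric.isOpen_iff.1 hN (c x₀)
      ⟨c.map_source hcx, by simpa only [mem_preimage, c.left_inv hcx] using x₀.2⟩
    have hev : ∀ᶠ x : ↥(e.toTriv.baseSet ∩ e'.toTriv.baseSet) in 𝓝 x₀,
        (x : M) ∈ c.source ∧ c x ∈ Metric.ball (c x₀) r := by
      have h1 : ∀ᶠ x in 𝓝 (x₀ : M), x ∈ c.source ∧ c x ∈ Metric.ball (c x₀) r :=
        Filter.Eventually.and (c.open_source.mem_nhds hcx)
          ((c.continuousAt hcx).eventually (Metric.ball_mem_nhds _ hr))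
      exact continuous_subtype_val.continuousAt.eventually h1
    filter_upwards [hev] with x hx
    let f : EuclideanSpace ℝ (Fin n) → g →L[ℝ] g := fun z =>
      (e.toTriv.coordChangeL ℝ e'.toTriv (c.symm z) : g →L[ℝ] g)
    let A : EuclideanSpace ℝ (Fin n) → g ≃ₗ⁅ℝ⁆ g := fun z => open Classical in
      if h : c.symm z ∈ e.toTriv.baseSet ∩ e'.toTriv.baseSet then
        LieTrivialization.transition e e' ⟨c.symm z, h⟩ else 1
    have hA : ∀ y : ↥(e.toTriv.baseSet ∩ e'.toTriv.baseSet), (y : M) ∈ c.source →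
        A (c y) = LieTrivialization.transition e e' y := by
      intro y hy
      have h1 : c.symm (c y) = y := c.left_inv hy
      have h2 : c.symm (c y) ∈ e.toTriv.baseSet ∩ e'.toTriv.baseSet := by rw [h1]; exact y.2
      simp only [A, dif_pos h2]
      congr 1
      exact Subtype.ext h1
    rw [← hA x hx.1, ← hA x₀ hcx]
    have hsymm : ∀ z ∈ c.target, ContMDiffAt (𝓡 n) (𝓡 n) ∞ c.symm z := fun z hz =>
      (contMDiffOn_chart_symm (x := (x₀ : M))).contMDiffAt (c.open_target.mem_nhds hz)
    refine mk_eq_mk_of_fderiv_inner (f := f) Metric.isOpen_ball (convex_ball _ _)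
      (fun z hz => ContDiffAt.contDiffWithinAt (contMDiffAt_iff_contDiffAt.1
        ((hτ _ (hrB hz).2).comp z (hsymm z (hrB hz).1)))) (fun z hz => ?_) (fun z hz h => ?_) hx.2
      (Metric.mem_ball_self hr)
    · have h2 := (hrB hz).2
      simp only [mem_preimage] at h2
      simp only [A, dif_pos h2, LieTrivialization.lieAutToCLM_transition, f]
    · have h2 : c.symm z ∈ e.toTriv.baseSet ∩ e'.toTriv.baseSet := (hrB hz).2
      set a : TangentSpace (𝓡 n) (c.symm z) := mfderiv (𝓡 n) (𝓡 n) c.symm z h with ha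
      have h1 : fderiv ℝ f z h = mvfderiv (𝓡 n)
          (fun y => (e.toTriv.coordChangeL ℝ e'.toTriv y : g →L[ℝ] g)) (c.symm z) a := by
        have h3 := (HasMFDerivAt.comp z ((hτ _ h2).mdifferentiableAt (by simp)).hasMFDerivAt
          ((hsymm z (hrB hz).1).mdifferentiableAt (by simp)).hasMFDerivAt).mfderiv
        rw [mfderiv_eq_fderiv] at h3
        exact congrArg (fun L : EuclideanSpace ℝ (Fin n) →L[ℝ] (g →L[ℝ] g) => L h) h3
      obtain ⟨X, hX⟩ := he _ h2.1 a
      obtain ⟨Y, hY⟩ := he' _ h2.2 a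
      have h3 := coordChangeL_connForm D.nabla e.isSmoothTriv e'.isSmoothTriv h2.1 h2.2 a
      have h4 := e.lieAutToCLM_transition e' ⟨c.symm z, h2⟩
      -- From `τ (ad X) = dτ + (ad Y) τ` and `τ (ad X) = ad (τ X) τ` one gets `dτ = ad (τ X - Y) τ`.
      refine ⟨LieTrivialization.transition e e' ⟨c.symm z, h2⟩ X - Y, ?_⟩
      rw [hX, hY, ← h4, lieAutToCLM_mul_adCLM] at h3
      have h5 : f z = lieAutToCLM (LieTrivialization.transition e e' ⟨c.symm z, h2⟩) := h4.symm
      rw [h1, h5, ← adL_apply, map_sub, sub_mul, adL_apply, adL_apply, eq_sub_iff_add_eq]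
      exact h3.symm

end AdaptedTrivializations

/-! ### The transported trivializations are adapted -/

section TransportTrivializations

variable {n : ℕ} {M : Type*} [TopologicalSpace M] [ChartedSpace (EuclideanSpace ℝ (Fin n)) M]
  [IsManifold (𝓡 n) ∞ M]
  {g : Type*} [NormedLieAlgebra g] [FiniteDimensional ℝ g]
  {V : M → Type*} [TopologicalSpace (TotalSpace g V)]
  [∀ x, LieRing (V x)] [∀ x, LieAlgebra ℝ (V x)] [∀ x, TopologicalSpace (V x)]
  [∀ x, IsTopologicalAddGroup (V x)] [∀ x, ContinuousSMul ℝ (V x)]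
  [FiberBundle g V] [VectorBundle ℝ g V] [ContMDiffVectorBundle ∞ g V (𝓡 n)]
  [T2Space M] {ι : Type*}

/-- The end of the path equals `x` only propositionally; comparing in the total space avoids casts
between fibres. -/
theorem exists_lieEquiv_mk_eq {x y : M} (h : y = x) (ψ : g ≃ₗ⁅ℝ⁆ V y) :
    ∃ φ : g ≃ₗ⁅ℝ⁆ V x, ∀ v, (⟨x, φ v⟩ : TotalSpace g V) = ⟨y, ψ v⟩ := by
  subst h
  exact ⟨ψ, fun _ => rfl⟩

/-- Innerness of the connection matrix is first obtained for coordinate directions; this shows that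
they exhaust the tangent space. -/
theorem mfderiv_symm_surjective {c : OpenPartialHomeomorph M (EuclideanSpace ℝ (Fin n))}
    (hc : c ∈ IsManifold.maximalAtlas (𝓡 n) ∞ M) {z : EuclideanSpace ℝ (Fin n)}
    (hz : z ∈ c.target) : Function.Surjective (mfderiv (𝓡 n) (𝓡 n) c.symm z) := by
  have : IsManifold (𝓡 n) 1 M := .of_le (n := ∞) (by simp)
  intro a
  have h1 : MDifferentiableAt (𝓡 n) (𝓡 n) c.symm z :=
    ((contMDiffOn_symm_of_mem_maximalAtlas hc).contMDiffAt
      (c.open_target.mem_nhds hz)).mdifferentiableAt (by simp)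
  have h2 : MDifferentiableAt (𝓡 n) (𝓡 n) c (c.symm z) :=
    ((contMDiffOn_of_mem_maximalAtlas hc).contMDiffAt
      (c.open_source.mem_nhds (c.map_target hz))).mdifferentiableAt (by simp)
  have h1' : HasMFDerivAt (𝓡 n) (𝓡 n) c.symm (c (c.symm z)) (mfderiv (𝓡 n) (𝓡 n) c.symm z) := by
    rw [c.right_inv hz]; exact h1.hasMFDerivAt
  have h3 := HasMFDerivAt.comp (c.symm z) h1' h2.hasMFDerivAt
  have h4 : HasMFDerivAt (𝓡 n) (𝓡 n) (c.symm ∘ c) (c.symm z)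
      (ContinuousLinearMap.id ℝ (TangentSpace (𝓡 n) (c.symm z))) := by
    refine (hasMFDerivAt_id (I := 𝓡 n) (c.symm z)).congr_of_eventuallyEq ?_
    filter_upwards [c.open_source.mem_nhds (c.map_target hz)] with y hy
    exact c.left_inv hy
  have h5 := hasMFDerivAt_unique h3 h4
  exact ⟨mfderiv (𝓡 n) (𝓡 n) c (c.symm z) a,
    congrArg (fun L : EuclideanSpace ℝ (Fin n) →L[ℝ] EuclideanSpace ℝ (Fin n) => L a) h5⟩

/-- The paths of the transport data, in terms of the coordinates of their endpoints. -/
def TransportData.family (T : TransportData n g V ι) (α : ι) (p : ℝ × EuclideanSpace ℝ (Fin n)) :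
    M :=
  T.path α ((T.chart α).symm p.2) p.1

theorem TransportData.mem_source (T : TransportData n g V ι) (α : ι)
    (z : EuclideanSpace ℝ (Fin n)) : (T.chart α).symm z ∈ (T.chart α).source :=
  (T.chart α).map_target (by rw [T.chart_target]; exact mem_univ z)

theorem TransportData.contMDiffOn_family (T : TransportData n g V ι) (α : ι) :
    ContMDiffOn 𝓘(ℝ, ℝ × EuclideanSpace ℝ (Fin n)) (𝓡 n) ∞ (T.family α) (Icc 0 1 ×ˢ univ) := by
  have hc : ContMDiff (𝓡 n) (𝓡 n) ∞ (T.chart α).symm := by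
    have h := contMDiffOn_symm_of_mem_maximalAtlas (T.chart_mem α)
    rwa [T.chart_target, contMDiffOn_univ] at h
  rw [modelWithCornersSelf_prod, ← chartedSpaceSelf_prod]
  have h1 : ContMDiff (𝓘(ℝ, ℝ).prod (𝓡 n)) (𝓘(ℝ, ℝ).prod (𝓡 n)) ∞
      (fun p : ℝ × EuclideanSpace ℝ (Fin n) => (p.1, (T.chart α).symm p.2)) :=
    contMDiff_fst.prodMk (hc.comp contMDiff_snd)
  exact (T.path_smooth α).comp h1.contMDiffOn fun p hp => ⟨hp.1, T.mem_source α p.2⟩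

/-- Parallel transport along the paths of the transport data defines an adapted local
trivialization. -/
theorem TransportData.exists_adapted (T : TransportData n g V ι) (hL : IsLieAlgebraBundle n g V)
    (D : DeltaConnection n g V) (α : ι) :
    ∃ e : LieTrivialization n g V, e.toTriv.baseSet = T.U α ∧ D.IsAdapted e ∧
      ∀ (x : M) (hx : x ∈ e.toTriv.baseSet) (v : g) (w : V x),
        T.IsTransported D α x v w ↔ w = e.fibreMap x hx v := by
  set c := T.chart α with hcdef
  have h0 : (0 : ℝ) ∈ Icc (0 : ℝ) 1 := left_mem_Icc.2 zero_le_one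
  have h1 : (1 : ℝ) ∈ Icc (0 : ℝ) 1 := right_mem_Icc.2 zero_le_one
  have hΓ := T.contMDiffOn_family α
  have hΓ0 : ∀ z, T.family α (0, z) = T.center α := fun z => T.path_zero α _ (T.mem_source α z)
  have hΓ1 : ∀ z, T.family α (1, z) = c.symm z := fun z => T.path_one α _ (T.mem_source α z)
  have hγ : ∀ z, ContMDiffOn 𝓘(ℝ, ℝ) (𝓡 n) ∞ (fun t => T.family α (t, z)) (Icc 0 1) := fun z =>
    hΓ.comp (contMDiff_iff_contDiff.2 (contDiff_prodMk_left z)).contMDiffOn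
      fun t ht => ⟨ht, mem_univ _⟩
  choose P hP hP0 using fun z => D.exists_transport hL (hγ z) (hΓ0 z) (T.frame α)
  have hφ : ∀ x, ∃ φ : g ≃ₗ⁅ℝ⁆ V x, x ∈ c.source →
      ∀ v, (⟨x, φ v⟩ : TotalSpace g V) = ⟨T.family α (1, c x), P (c x) 1 v⟩ := by
    intro x
    by_cases hx : x ∈ c.source
    · obtain ⟨φ, hφ⟩ := exists_lieEquiv_mk_eq ((hΓ1 (c x)).trans (c.left_inv hx)) (P (c x) 1)
      exact ⟨φ, fun _ => hφ⟩
    · obtain ⟨φ⟩ := hL.exists_lieEquiv x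
      exact ⟨φ, fun h => absurd h hx⟩
  choose φ hφ using hφ
  have hcoord : ∀ (e : LieTrivialization n g V) (x : M), x ∈ c.source → x ∈ e.toTriv.baseSet →
      fibreCoord e.toTriv (φ x) = fibreCoord e.toTriv (P (c x) 1) := by
    intro e x hx he
    have he' : T.family α (1, c x) ∈ e.toTriv.baseSet := by rw [hΓ1, c.left_inv hx]; exact he
    ext v
    rw [fibreCoord_apply he, fibreCoord_apply he', hφ x hx v]
  have hin : ∀ (e : LieTrivialization n g V) (x : M), x ∈ c.source → x ∈ e.toTriv.baseSet →
      InnerFrameAt D P e 1 (c x) := fun e x hx he =>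
    innerFrameAt_of_parallel hL hΓ hP hΓ0 hP0 (c x) h1 (by rw [hΓ1, c.left_inv hx]; exact he)
  have hsm : IsSmoothFrame (n := n) c.source φ := by
    intro e x hx he
    obtain ⟨W, hW, hxW, -, hQ, -⟩ := hin e x hx he
    have hcs : ContMDiffAt (𝓡 n) (𝓡 n) ∞ c x :=
      (contMDiffOn_of_mem_maximalAtlas (T.chart_mem α)).contMDiffAt (c.open_source.mem_nhds hx)
    refine ((hQ.contDiffAt (hW.mem_nhds hxW)).contMDiffAt.comp x hcs).congr_of_eventuallyEq ?_
    filter_upwards [c.open_source.mem_nhds hx, e.toTriv.open_baseSet.mem_nhds he] with y hy hy'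
    exact hcoord e y hy hy'
  let e := hsm.toLieTrivialization hL c.open_source
  refine ⟨e, rfl, ?_, ?_⟩
  · intro x hx a
    obtain ⟨W, hW, hxW, hWe, -, hX⟩ := hin e x hx hx
    -- In its own trivialization the frame has matrix `1`, so the inner-frame identity at `t = 1`
    -- reduces to `B(h) = ad X`.
    have hone : ∀ z ∈ W, fibreCoord e.toTriv (P z 1) = 1 := by
      intro z hz
      have h := hsm.fibreCoord_toLieTrivialization hL c.open_source (T.mem_source α z)
      have h' := hcoord e _ (T.mem_source α z) (T.mem_source α z)
      rw [c.right_inv (by rw [T.chart_target]; exact mem_univ z)] at h'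
      exact h'.symm.trans h
    obtain ⟨h, hh⟩ : ∃ h : EuclideanSpace ℝ (Fin n),
        mfderiv (𝓡 n) (𝓡 n) c.symm (c x) h = (a : EuclideanSpace ℝ (Fin n)) :=
      mfderiv_symm_surjective (T.chart_mem α) (c.map_source hx) _
    obtain ⟨X, hX⟩ := hX (c x) hxW h
    have hd : fderiv ℝ (fun z => fibreCoord e.toTriv (P z 1)) (c x) = 0 := by
      rw [(Filter.eventuallyEq_of_mem (hW.mem_nhds hxW) hone).fderiv_eq]
      exact fderiv_const_apply _
    rw [hd, hone _ hxW, one_mul, mul_one, zero_apply, zero_add] at hX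
    refine ⟨X, hX ▸ ?_⟩
    have h2 := (hasMFDerivAt_slice hΓ h1 (c x)).mfderiv
    rw [funext hΓ1] at h2
    have h3 : (mfderivWithin 𝓘(ℝ, ℝ × EuclideanSpace ℝ (Fin n)) (𝓡 n) (T.family α)
        (Icc 0 1 ×ˢ univ) (1, c x) (0, h) : EuclideanSpace ℝ (Fin n)) = a := by
      rw [← hh]
      exact (congrArg (fun L : EuclideanSpace ℝ (Fin n) →L[ℝ] EuclideanSpace ℝ (Fin n) => L h)
        h2).symm
    have h4 : T.family α (1, c x) = x := (hΓ1 _).trans (c.left_inv hx)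
    change connForm D.nabla e.toTriv x a = connForm D.nabla e.toTriv (T.family α (1, c x))
      (mfderivWithin 𝓘(ℝ, ℝ × EuclideanSpace ℝ (Fin n)) (𝓡 n) (T.family α)
        (Icc 0 1 ×ˢ univ) (1, c x) (0, h) : EuclideanSpace ℝ (Fin n))
    rw [h3, h4]
  · intro x hx v w
    have hpath : T.path α x = fun t => T.family α (t, c x) := by
      funext t
      exact congrArg (fun y => T.path α y t) (c.left_inv hx).symm
    have key := D.isParallelTransport_iff hL (hγ (c x)) (hP (c x) v) ⟨x, w⟩
    rw [hP0, ← hφ x hx v] at key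
    rw [TransportData.IsTransported, hpath, key,
      hsm.toLieTrivialization_fibreMap hL c.open_source hx]
    exact ⟨fun h => eq_of_heq (TotalSpace.mk.inj h).2, fun h => by rw [h]⟩

theorem TransportData.phi_eq_of_iff (T : TransportData n g V ι) {D : DeltaConnection n g V} {α : ι}
    {x : M} {v : g} {w : V x} (h : ∀ w', T.IsTransported D α x v w' ↔ w' = w) :
    T.phi D α x v = w :=
  (h _).1 (Classical.epsilon_spec ⟨w, (h w).2 rfl⟩)

end TransportTrivializations

end

/-! ### The main theorem -/

theorem mainTheorem3 {n : ℕ} {M : Type*} [TopologicalSpace M] [T2Space M]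
    [SecondCountableTopology M] [ChartedSpace (EuclideanSpace ℝ (Fin n)) M] [IsManifold (𝓡 n) ∞ M]
    {g : Type*} [NormedLieAlgebra g] [FiniteDimensional ℝ g]
    {V : M → Type*} [TopologicalSpace (TotalSpace g V)]
    [∀ x, LieRing (V x)] [∀ x, LieAlgebra ℝ (V x)] [∀ x, TopologicalSpace (V x)]
    [∀ x, IsTopologicalAddGroup (V x)] [∀ x, ContinuousSMul ℝ (V x)]
    [FiberBundle g V] [VectorBundle ℝ g V] [ContMDiffVectorBundle ∞ g V (𝓡 n)]
    (hL : IsLieAlgebraBundle n g V) {ι : Type*} (T : TransportData n g V ι) :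
    -- the maps `φ^∇_α(x) : g → V x` are well defined and bijective
    (∀ (D : DeltaConnection n g V) (α : ι), ∀ x ∈ T.U α,
      (∀ v, ∃! w, T.IsTransported D α x v w) ∧ Function.Bijective (T.phi D α x)) ∧
    -- `φ^∇_β(x)⁻¹ ∘ φ^∇_α(x)` is in `Aut g` and depends continuously on `x`, in `Aut^δ g`
    (∀ (D : DeltaConnection n g V) (α β : ι), ∃ τ : ↥(T.U α ∩ T.U β) → AutDelta g,
      (∀ x, ⇑(τ x) =
        Function.invFun (T.phi D β (x : M)) ∘ T.phi D α (x : M)) ∧ Continuous τ) ∧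
    -- `∇ ↦ {φ^∇_α}` induces a map `f : Coup(V) → LAB^δ(V)`
    (∃ f : Coup n g V → LABDelta n g V, ∀ D : DeltaConnection n g V,
      ∃ (Φ : DeltaStructure n g V) (e : ι → LieTrivialization n g V),
        (∀ α, (e α).toTriv.baseSet = T.U α ∧
          ∀ (x : M) (hx : x ∈ (e α).toTriv.baseSet) (v : g),
            (e α).fibreMap x hx v = T.phi D α x v) ∧
        Φ.trivs = range e ∧
        f (Quotient.mk (couplingSetoid n g V) D) = Quotient.mk (deltaSetoid n g V) Φ) := by
  choose e he had hiff using fun D α => T.exists_adapted hL D α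
  have hphi : ∀ D α x (hx : x ∈ (e D α).toTriv.baseSet) v,
      T.phi D α x v = (e D α).fibreMap x hx v := fun D α x hx v =>
    T.phi_eq_of_iff fun w => hiff D α x hx v w
  have hbij : ∀ D α, ∀ x ∈ T.U α, Function.Bijective (T.phi D α x) := by
    intro D α x hx
    rw [← he D α] at hx
    rw [show T.phi D α x = (e D α).fibreMap x hx from funext fun v => hphi D α x hx v]
    exact ((e D α).fibreMap x hx).bijective
  refine ⟨fun D α x hx => ⟨fun v => ?_, hbij D α x hx⟩, fun D α β => ?_, ?_⟩
  · rw [← he D α] at hx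
    exact ⟨_, (hiff D α x hx v _).2 rfl, fun w hw => (hiff D α x hx v w).1 hw⟩
  · have hc : Continuous (LieTrivialization.transition (e D α) (e D β)) :=
      (had D α).deltaCompatible (had D β)
    refine ⟨fun x => LieTrivialization.transition (e D α) (e D β)
      ⟨x, by rw [he, he]; exact x.2⟩, fun x => ?_, hc.comp (by fun_prop)⟩
    funext v
    have hα : (x : M) ∈ (e D α).toTriv.baseSet := by rw [he]; exact x.2.1
    have hβ : (x : M) ∈ (e D β).toTriv.baseSet := by rw [he]; exact x.2.2
    -- Applying the bijection `φ_β(x)` removes `Function.invFun`, leaving an identity between the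
    -- fibre maps.
    apply (hbij D β x x.2.2).injective
    rw [Function.comp_apply, Function.invFun_eq ((hbij D β x x.2.2).surjective _),
      hphi D β x hβ, hphi D α x hα]
    exact LieEquiv.apply_symm_apply ((e D β).fibreMap x hβ) _
  · let Φ : DeltaConnection n g V → DeltaStructure n g V := fun D =>
      { trivs := range (e D)
        covers := fun x => by
          obtain ⟨α, hα⟩ := T.covers x
          exact ⟨e D α, mem_range_self α, by rw [he]; exact hα⟩
        compatible := by
          rintro _ ⟨α, rfl⟩ _ ⟨β, rfl⟩
          exact (had D α).deltaCompatible (had D β) }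
    refine ⟨Quotient.lift (fun D => Quotient.mk (deltaSetoid n g V) (Φ D)) fun D D' h =>
      Quotient.sound ?_, fun D => ⟨Φ D, e D, fun α => ⟨he D α, fun x hx v =>
        (hphi D α x hx v).symm⟩, rfl, rfl⟩⟩
    rintro _ ⟨α, rfl⟩ _ ⟨β, rfl⟩
    have h' : D.Equivalent D' := h
    -- The trivializations of `D` are also adapted to the equivalent connection `D'`, so both
    -- families are compared as adapted to `D'`.
    exact (h'.isAdapted (had D α)).deltaCompatible (had D' β)
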